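/- All graphs are finite and simple. A D3 reduction of a graph $G$ is one of the following two operations. (a) If $p,q,r$ are three degree-three vertices that induce a triangle, and their neighbours outside $\{p,q,r\}$ are all distinct, replace $p,q,r$ by a single new vertex adjacent to these three outside neighbours. (b) If $p,q,r$ are three degree-three vertices that induce a path with middle vertex $q$, and some vertex $s$ is adjacent to all of $p,q,r$, delete $q$ and add the edge $pr$. A graph is D3-reducible if some finite (possibly empty) sequence of D3 reductions takes it to (a graph isomorphic to) $K_4$. A rotation system of a connected graph $G$ with at least one edge assigns to each vertex a cyclic order of the edges at that vertex; it determines the boundary walks of its faces. It is a planar embedding of $G$ (on the sphere, with no face chosen as the outer one) if $|V|-|E|+|F|=2$, where $F$ is the set of faces. Theorem. Let $G$ be a D3-reducible graph. Then (1) $G$ is planar: it can be drawn in the Euclidean plane with distinct points as vertices and simple arcs as edges, such that arcs contain no vertices other than their ends and two distinct arcs meet only in common end-vertices; (2) $G$ has a planar embedding, and it is unique up to reflection: any two planar embeddings of $G$ are either equal or mirror images of each other (all cyclic orders reversed); (3) in every planar embedding of $G$, every triangle of $G$ is the boundary of a face. -/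

import Mathlib

universe u

/-! ### D3 reductions -/

namespace D3

variable {V : Type u}

/-- `v` has exactly three neighbours. -/
def DegThree (G : SimpleGraph V) (v : V) : Prop :=
  (G.neighborSet v).ncard = 3

/-- The hypotheses of the triangle reduction: `p`, `q`, `r` are three degree-three vertices that
form a triangle, and their neighbours outside `{p, q, r}` are distinct (the only common neighbour
of two of them is the third one). -/
structure IsTriangleTriple (G : SimpleGraph V) (p q r : V) : Prop where
  adj_pq : G.Adj p q
  adj_qr : G.Adj q r
  adj_rp : G.Adj r p
  deg_p : DegThree G p
  deg_q : DegThree G q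
  deg_r : DegThree G r
  distinct_pq : ∀ x, G.Adj p x → G.Adj q x → x = r
  distinct_qr : ∀ x, G.Adj q x → G.Adj r x → x = p
  distinct_rp : ∀ x, G.Adj r x → G.Adj p x → x = q

/-- The result of the triangle reduction: the vertices `p`, `q`, `r` are replaced by one new vertex
`none`, which is adjacent to all the neighbours that `p`, `q`, `r` have outside `{p, q, r}`. -/
def collapseTriangle (G : SimpleGraph V) (p q r : V) :
    SimpleGraph (Option ↥({p, q, r}ᶜ : Set V)) where
  Adj
    | some x, some y => G.Adj x y
    | some x, none => G.Adj p x ∨ G.Adj q x ∨ G.Adj r x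
    | none, some y => G.Adj p y ∨ G.Adj q y ∨ G.Adj r y
    | none, none => False
  symm := ⟨by
    rintro (_ | x) (_ | y) h
    · exact h
    · exact h
    · exact h
    · exact SimpleGraph.Adj.symm h⟩
  loopless := ⟨by
    rintro (_ | x) h
    · exact h
    · exact G.irrefl h⟩

/-- The hypotheses of the path reduction: `p`, `q`, `r` are three degree-three vertices that induce
a path with middle vertex `q`, and some vertex `s` is adjacent to all three of them. -/
structure IsPathTriple (G : SimpleGraph V) (p q r : V) : Prop where
  ne_pr : p ≠ r
  adj_pq : G.Adj p q
  adj_qr : G.Adj q r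
  not_adj_pr : ¬ G.Adj p r
  deg_p : DegThree G p
  deg_q : DegThree G q
  deg_r : DegThree G r
  apex : ∃ s, G.Adj s p ∧ G.Adj s q ∧ G.Adj s r

/-- The result of the path reduction: `q` is deleted and the edge `pr` is added. -/
def shortenPath (G : SimpleGraph V) (p q r : V) : SimpleGraph ↥({q}ᶜ : Set V) :=
  (G ⊔ SimpleGraph.edge p r).induce {q}ᶜ

end D3

/-- A graph is D3-reducible if some finite (possibly empty) sequence of triangle and path
reductions takes it to a complete graph on four vertices. -/
inductive D3Reducible : ∀ {V : Type u}, SimpleGraph V → Prop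
  | base {V : Type u} (G : SimpleGraph V) (e : G ≃g (⊤ : SimpleGraph (Fin 4))) : D3Reducible G
  | triangle {V : Type u} (G : SimpleGraph V) (p q r : V) (h : D3.IsTriangleTriple G p q r)
      (hred : D3Reducible (D3.collapseTriangle G p q r)) : D3Reducible G
  | path {V : Type u} (G : SimpleGraph V) (p q r : V) (h : D3.IsPathTriple G p q r)
      (hred : D3Reducible (D3.shortenPath G p q r)) : D3Reducible G

/-! ### Drawings in the plane -/

/-- A drawing of `G` in the Euclidean plane without crossings: distinct vertices are distinct
points, every edge is a simple arc between its two end-vertices, an arc contains no vertex other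
than its ends, and two distinct arcs meet only in common end-vertices. -/
structure PlaneDrawing {V : Type u} (G : SimpleGraph V) where
  pos : V → EuclideanSpace ℝ (Fin 2)
  pos_injective : Function.Injective pos
  arc : Sym2 V → Set (EuclideanSpace ℝ (Fin 2))
  arc_simple : ∀ a b, G.Adj a b →
    ∃ γ : Path (pos a) (pos b), Function.Injective γ ∧ Set.range γ = arc s(a, b)
  vertex_mem_arc : ∀ e ∈ G.edgeSet, ∀ v, pos v ∈ arc e → v ∈ e
  arc_inter : ∀ e ∈ G.edgeSet, ∀ f ∈ G.edgeSet, e ≠ f →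
    ∀ x, x ∈ arc e → x ∈ arc f → ∃ v, v ∈ e ∧ v ∈ f ∧ x = pos v

/-- A graph is planar if it can be drawn in the plane without crossings. -/
def PlanarGraph {V : Type u} (G : SimpleGraph V) : Prop :=
  Nonempty (PlaneDrawing G)

/-! ### Combinatorial embeddings -/

/-- A rotation system (combinatorial embedding in an oriented closed surface) of a finite graph: a
permutation of the darts whose cycles are exactly the sets of darts leaving a common vertex. Thus
`rot d` is the dart that follows `d` in the cyclic order around the vertex `d.fst`. -/
@[ext]
structure RotationSystem {V : Type u} (G : SimpleGraph V) where
  rot : Equiv.Perm G.Dart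
  fst_rot : ∀ d, (rot d).fst = d.fst
  sameCycle : ∀ d e : G.Dart, d.fst = e.fst → rot.SameCycle d e

namespace RotationSystem

variable {V : Type u} {G : SimpleGraph V}

/-- The mirror image, in which every cyclic order is reversed. -/
def mirror (R : RotationSystem G) : RotationSystem G where
  rot := R.rot⁻¹
  fst_rot d := by
    have h := R.fst_rot (R.rot⁻¹ d)
    have h' : R.rot (R.rot⁻¹ d) = d := R.rot.apply_symm_apply d
    rw [h'] at h
    exact h.symm
  sameCycle d e h := (R.sameCycle d e h).inv

/-- The face-tracing permutation: after the dart `d` from `u` to `v`, the boundary walk of a face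
leaves `v` along the dart that follows the reversal of `d` in the rotation at `v`. -/
def next (R : RotationSystem G) : Equiv.Perm G.Dart :=
  (Function.Involutive.toPerm SimpleGraph.Dart.symm SimpleGraph.Dart.symm_involutive).trans R.rot

/-- A face, given by the set of darts on its boundary walk: a cycle of the face-tracing
permutation. -/
def IsFace (R : RotationSystem G) (F : Set G.Dart) : Prop :=
  ∃ d : G.Dart, F = {e | R.next.SameCycle d e}

/-- A rotation system of a finite connected graph (with at least one edge) is a planar embedding if
the surface that it describes is the sphere, that is, if `|V| - |E| + |F| = 2`. No face is singled
out as the outer one. -/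
def IsPlanar (R : RotationSystem G) : Prop :=
  G.Connected ∧ Nat.card V + {F | R.IsFace F}.ncard = G.edgeSet.ncard + 2

/-- The triangle `abc` is a face: its three edges, traversed in one of the two directions, are the
boundary walk of a face. -/
def TriangleIsFace (R : RotationSystem G) {a b c : V}
    (hab : G.Adj a b) (hbc : G.Adj b c) (hca : G.Adj c a) : Prop :=
  R.IsFace {⟨(a, b), hab⟩, ⟨(b, c), hbc⟩, ⟨(c, a), hca⟩} ∨
    R.IsFace {⟨(b, a), hab.symm⟩, ⟨(a, c), hca.symm⟩, ⟨(c, b), hbc.symm⟩}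

end RotationSystem

/-! Undoing a D3 reduction amounts to subdividing edges of the reduced graph `G'` and adding one
edge. For a path reduction this is the edge `qs`, where `q` subdivides `pr`. For a triangle
reduction it is the edge `pq`, where `r` is the vertex of `G'` that gets expanded and `p`, `q`
subdivide two of its edges. So `G'` arises from `G` by deleting an edge and suppressing vertices of
degree two (`EdgeReduction`). A rotation system `R` of `G` then induces one of `G'`, called `R'`. It
loses at most one face, and none if both sides of the deleted edge lie on the same face
(`EdgeReduction.faceCount_le`). Hence the bound `|V| + |F| ≤ |E| + 2` for all rotation systems
passes from `G'` to `G`. Moreover, if `R` is planar, then `R'` is planar too and the deleted edge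
lies on two different faces (`EdgeReduction.exists_isPlanar`).

Claims (2) and (3) are proved together by induction over the reductions. The induction hypothesis
`UniquelyEmbedded` also contains the Euler bound and minimum degree three; the latter keeps a
rotation from coinciding with its reverse. In a path reduction the triangle `abs` of `G'` is a face
of `R'`, and `R` must arise by drawing the new edge inside it: other placements put both sides of
the edge on one face or contradict a second reduction of `G` to the same `G'`
(`SubdividedChord.inserted_of_turnFace`). In a triangle reduction the three edges of `pqr` can be
deleted in turn. The three induced embeddings of `G'` agree away from the triangle, so uniqueness
makes them equal, and each of them determines the rotation at one corner
(`TriangleExpansion.exists_expanded`). In both cases `R` and `R'` determine each other up to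
reflection, and conversely each planar `R'` can be extended with one additional face. The base case
`K₄` is a count of darts: a planar embedding has only triangular faces.

Claim (1) is a separate induction that constructs straight-line drawings. For a path reduction the
new vertex is placed on an edge very close to its end; for a triangle reduction a vertex is replaced
with a small triangle inscribed in a circle. -/

/-! ### Rotation systems as successor relations, and the number of faces. -/

namespace RotationSystem

variable {V : Type u} {G : SimpleGraph V}

/-- In the rotation at `v`, the neighbour `u` is followed by the neighbour `w`. -/
def Turn (R : RotationSystem G) (v u w : V) : Prop :=
  ∃ (h : G.Adj v u) (h' : G.Adj v w), R.rot ⟨(v, u), h⟩ = ⟨(v, w), h'⟩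

variable {R S : RotationSystem G}

theorem Turn.adj_left {v u w : V} (h : R.Turn v u w) : G.Adj v u := h.1

theorem Turn.adj_right {v u w : V} (h : R.Turn v u w) : G.Adj v w := h.2.1

theorem Turn.right_unique {v u w w' : V} (h : R.Turn v u w) (h' : R.Turn v u w') : w = w' := by
  obtain ⟨_, _, h⟩ := h
  obtain ⟨_, _, h'⟩ := h'
  have := h.symm.trans h'
  exact congrArg (fun d : G.Dart => d.snd) this

theorem Turn.left_unique {v u u' w : V} (h : R.Turn v u w) (h' : R.Turn v u' w) : u = u' := by
  obtain ⟨_, _, h⟩ := h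
  obtain ⟨_, _, h'⟩ := h'
  have := R.rot.injective (h.trans h'.symm)
  exact congrArg (fun d : G.Dart => d.snd) this

theorem turn_of_rot_eq {d e : G.Dart} (h : R.rot d = e) : R.Turn d.fst d.snd e.snd := by
  obtain ⟨⟨v, u⟩, hd⟩ := d
  obtain ⟨⟨v', w⟩, he⟩ := e
  have := R.fst_rot ⟨(v, u), hd⟩
  rw [h] at this
  obtain rfl : v' = v := this
  exact ⟨hd, he, h⟩

theorem exists_turn (R : RotationSystem G) {v u : V} (h : G.Adj v u) : ∃ w, R.Turn v u w :=
  ⟨_, turn_of_rot_eq (R := R) (d := ⟨(v, u), h⟩) rfl⟩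

theorem turn_mirror {v u w : V} : R.mirror.Turn v u w ↔ R.Turn v w u := by
  constructor
  · rintro ⟨h, h', e⟩
    exact ⟨h', h, (Equiv.Perm.inv_eq_iff_eq.mp e).symm⟩
  · rintro ⟨h, h', e⟩
    exact ⟨h', h, Equiv.Perm.inv_eq_iff_eq.mpr e.symm⟩

theorem exists_turn_left (R : RotationSystem G) {v w : V} (h : G.Adj v w) : ∃ u, R.Turn v u w := by
  obtain ⟨u, hu⟩ := R.mirror.exists_turn h
  exact ⟨u, turn_mirror.mp hu⟩

/-- Both relations are graphs of functions on the darts, so an inclusion is already an equality. -/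
theorem eq_of_turn {R S : RotationSystem G} (h : ∀ v u w, R.Turn v u w → S.Turn v u w) : S = R := by
  ext1
  ext1 ⟨⟨v, u⟩, hd⟩
  obtain ⟨w, hw⟩ := R.exists_turn hd
  obtain ⟨_, _, h2⟩ := h v u w hw
  obtain ⟨_, _, h1⟩ := hw
  rw [h1, h2]

theorem mirror_mirror (R : RotationSystem G) : R.mirror.mirror = R :=
  eq_of_turn fun _ _ _ h => turn_mirror.mpr (turn_mirror.mpr h)

instance finite_dart [Finite V] : Finite G.Dart :=
  Finite.of_injective (fun d => d.toProd) fun _ _ h => SimpleGraph.Dart.ext _ _ h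

/-- The rotation at `v` is a single cycle, so starting from `x` every neighbour is reached after
finitely many turns. -/
theorem mem_of_turn_closed (R : RotationSystem G) {v x z : V} (s : Set V) (hx : G.Adj v x)
    (hxs : x ∈ s) (hs : ∀ u w, u ∈ s → R.Turn v u w → w ∈ s) [Finite V] (hz : G.Adj v z) :
    z ∈ s := by
  have hc := R.sameCycle ⟨(v, x), hx⟩ ⟨(v, z), hz⟩ rfl
  obtain ⟨n, hn⟩ := hc.exists_nat_pow_eq
  have key : ∀ n : ℕ, ((R.rot ^ n) ⟨(v, x), hx⟩).fst = v ∧ ((R.rot ^ n) ⟨(v, x), hx⟩).snd ∈ s := by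
    intro n
    induction n with
    | zero => exact ⟨rfl, hxs⟩
    | succ n ih =>
      rw [pow_succ', Equiv.Perm.mul_apply]
      refine ⟨(R.fst_rot _).trans ih.1, ?_⟩
      have := turn_of_rot_eq (R := R) (d := (R.rot ^ n) ⟨(v, x), hx⟩) rfl
      rw [ih.1] at this
      exact hs _ _ ih.2 this
  have := (key n).2
  rw [hn] at this
  exact this

theorem eq_of_turn_self [Finite V] {v x z : V} (h : R.Turn v x x) (hz : G.Adj v z) : z = x :=
  R.mem_of_turn_closed {x} h.adj_left rfl (by
    rintro u w rfl hw
    exact hw.right_unique h) hz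

/-- The two turns close up to a cycle of length two, which is then the whole rotation. With minimum
degree three, this excludes that a turn occurs in both directions. -/
theorem eq_or_eq_of_turn_turn [Finite V] {v x y z : V} (h : R.Turn v x y) (h' : R.Turn v y x)
    (hz : G.Adj v z) : z = x ∨ z = y :=
  R.mem_of_turn_closed {x, y} h.adj_left (Or.inl rfl) (by
    rintro u w (rfl | rfl) hw
    · exact Or.inr (hw.right_unique h)
    · exact Or.inl (hw.right_unique h')) hz

/-- At a vertex of degree three a single turn determines the whole rotation. -/
theorem turn_three_of_turn [Finite V] {v x y z : V} (hN : ∀ t, G.Adj v t → t = x ∨ t = y ∨ t = z)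
    (hz : G.Adj v z) (hxz : z ≠ x) (hyz : z ≠ y) (h : R.Turn v x y) :
    R.Turn v y z ∧ R.Turn v z x := by
  have hyx : ¬ R.Turn v y x := fun h' => by
    rcases eq_or_eq_of_turn_turn h h' hz with h1 | h1
    · exact hxz h1
    · exact hyz h1
  obtain ⟨w, hw⟩ := R.exists_turn h.adj_right
  have h1 : R.Turn v y z := by
    rcases hN w hw.adj_right with rfl | rfl | rfl
    · exact absurd hw hyx
    · exact absurd (eq_of_turn_self hw hz) hyz
    · exact hw
  refine ⟨h1, ?_⟩
  obtain ⟨w', hw'⟩ := R.exists_turn hz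
  rcases hN w' hw'.adj_right with rfl | rfl | rfl
  · exact hw'
  · exact absurd (hw'.left_unique h) hxz
  · exact absurd (hw'.left_unique h1) hyz

theorem turn_three [Finite V] (R : RotationSystem G) {v x y z : V}
    (hN : ∀ t, G.Adj v t → t = x ∨ t = y ∨ t = z) (hx : G.Adj v x) (hy : G.Adj v y)
    (hz : G.Adj v z) (hxy : x ≠ y) (hxz : x ≠ z) (hyz : y ≠ z) :
    (R.Turn v x y ∧ R.Turn v y z ∧ R.Turn v z x) ∨
      (R.Turn v x z ∧ R.Turn v z y ∧ R.Turn v y x) := by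
  obtain ⟨w, hw⟩ := R.exists_turn hx
  rcases hN w hw.adj_right with rfl | rfl | rfl
  · exact absurd (eq_of_turn_self hw hy).symm hxy
  · exact Or.inl ⟨hw, turn_three_of_turn hN hz hxz.symm hyz.symm hw⟩
  · exact Or.inr ⟨hw, turn_three_of_turn (fun t ht => by have := hN t ht; tauto) hy hxy.symm hyz hw⟩

/-- The boundary of the face to which the dart `d` belongs. -/
def faceOf (R : RotationSystem G) (d : G.Dart) : Set G.Dart :=
  {e | R.next.SameCycle d e}

theorem next_apply (R : RotationSystem G) (d : G.Dart) : R.next d = R.rot d.symm := rfl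

theorem faceOf_eq_iff {d e : G.Dart} : R.faceOf d = R.faceOf e ↔ R.next.SameCycle d e := by
  constructor
  · intro h
    have : e ∈ R.faceOf e := Equiv.Perm.SameCycle.refl _ _
    rw [← h] at this
    exact this
  · intro h
    ext x
    exact ⟨fun hx => h.symm.trans hx, fun hx => h.trans hx⟩

theorem faceOf_next (d : G.Dart) : R.faceOf (R.next d) = R.faceOf d :=
  faceOf_eq_iff.mpr (Equiv.Perm.sameCycle_apply_left.mpr (Equiv.Perm.SameCycle.refl _ _))

/-- This is the form in which invariance along faces is used throughout: a labelling `c` of the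
darts is constant on faces if `c (R.rot d) = c d.symm`. -/
theorem faceOf_rot (d : G.Dart) : R.faceOf (R.rot d) = R.faceOf d.symm := by
  rw [← faceOf_next d.symm, next_apply, SimpleGraph.Dart.symm_symm]

theorem Turn.faceOf_eq {a b c : V} (h : R.Turn b a c) :
    R.faceOf ⟨(a, b), h.adj_left.symm⟩ = R.faceOf ⟨(b, c), h.adj_right⟩ := by
  obtain ⟨h1, h2, h⟩ := h
  rw [← h, faceOf_rot]
  rfl

theorem setOf_isFace (R : RotationSystem G) : {F | R.IsFace F} = Set.range R.faceOf := by
  ext F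
  exact ⟨fun ⟨d, hd⟩ => ⟨d, hd.symm⟩, fun ⟨d, hd⟩ => ⟨d, hd.symm⟩⟩

/-- The number of faces. -/
noncomputable def faceCount (R : RotationSystem G) : ℕ := (Set.range R.faceOf).ncard

theorem apply_eq_of_sameCycle {D X : Type*} [Finite D] {φ : Equiv.Perm D} {f : D → X}
    (hf : ∀ d, f (φ d) = f d) {d e : D} (h : φ.SameCycle d e) : f d = f e := by
  obtain ⟨n, rfl⟩ := h.exists_nat_pow_eq
  induction n with
  | zero => rfl
  | succ n ih =>
    rw [pow_succ', Equiv.Perm.mul_apply, hf]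
    exact ih ⟨n, by simp⟩

/-- A surjective function on darts that is constant on faces bounds the number of faces below. -/
theorem card_le_faceCount [Finite V] (R : RotationSystem G) {X : Type*} (f : G.Dart → X)
    (hf : ∀ d, f (R.rot d) = f d.symm) (hs : Function.Surjective f) :
    Nat.card X ≤ R.faceCount := by
  have hf' : ∀ d, f (R.next d) = f d := fun d => by
    rw [next_apply, hf, SimpleGraph.Dart.symm_symm]
  have : Function.Injective (fun x : X => (⟨R.faceOf (Function.surjInv hs x), _, rfl⟩ :
      Set.range R.faceOf)) := by
    intro x y hxy
    have h := faceOf_eq_iff.mp (congrArg Subtype.val hxy)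
    rw [← Function.surjInv_eq hs x, ← Function.surjInv_eq hs y]
    exact apply_eq_of_sameCycle hf' h
  exact Nat.card_le_card_of_injective _ this

/-- The faces of the mirror image are the same walks traversed backwards, so labelling `d` with the
mirror face of `d.symm` is constant on the faces of `R`. -/
theorem faceCount_mirror_le [Finite V] (R : RotationSystem G) :
    R.mirror.faceCount ≤ R.faceCount := by
  refine R.card_le_faceCount (fun d => Set.rangeFactorization R.mirror.faceOf d.symm)
    (fun d => ?_) ?_
  · refine Subtype.ext ?_
    change R.mirror.faceOf (R.rot d).symm = R.mirror.faceOf d.symm.symm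
    rw [← faceOf_rot, SimpleGraph.Dart.symm_symm]
    congr 1
    exact R.rot.symm_apply_apply d
  · rintro ⟨_, d, rfl⟩
    exact ⟨d.symm, by simp [Set.rangeFactorization]⟩

theorem faceCount_mirror [Finite V] (R : RotationSystem G) : R.mirror.faceCount = R.faceCount := by
  refine le_antisymm R.faceCount_mirror_le ?_
  have := R.mirror.faceCount_mirror_le
  rwa [mirror_mirror] at this

theorem isPlanar_iff (R : RotationSystem G) :
    R.IsPlanar ↔ G.Connected ∧ Nat.card V + R.faceCount = G.edgeSet.ncard + 2 := by
  rw [IsPlanar, setOf_isFace, faceCount]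

theorem IsPlanar.mirror [Finite V] (h : R.IsPlanar) : R.mirror.IsPlanar := by
  rw [isPlanar_iff] at h ⊢
  rwa [faceCount_mirror]

/-- The closed walk `abc` is the boundary of a face. -/
def TurnFace (R : RotationSystem G) (a b c : V) : Prop :=
  R.Turn b a c ∧ R.Turn c b a ∧ R.Turn a c b

/-- A set of darts forgets the order of the walk. It is recovered because the set is closed under
`R.next` and contains only one dart leaving each of `a`, `b`, `c`. -/
theorem isFace_triple_iff [Finite V] (R : RotationSystem G) {a b c : V}
    (hab : G.Adj a b) (hbc : G.Adj b c) (hca : G.Adj c a) :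
    R.IsFace {⟨(a, b), hab⟩, ⟨(b, c), hbc⟩, ⟨(c, a), hca⟩} ↔ R.TurnFace a b c := by
  constructor
  · rintro ⟨d, hd⟩
    have hnext : ∀ e ∈ ({⟨(a, b), hab⟩, ⟨(b, c), hbc⟩, ⟨(c, a), hca⟩} : Set G.Dart),
        R.next e ∈ ({⟨(a, b), hab⟩, ⟨(b, c), hbc⟩, ⟨(c, a), hca⟩} : Set G.Dart) := by
      intro e he
      rw [hd] at he ⊢
      exact Equiv.Perm.sameCycle_apply_right.mpr he
    have key : ∀ (e : G.Dart),
        R.next e ∈ ({⟨(a, b), hab⟩, ⟨(b, c), hbc⟩, ⟨(c, a), hca⟩} : Set G.Dart)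
        → (e.snd = a ∧ R.Turn a e.fst b) ∨ (e.snd = b ∧ R.Turn b e.fst c) ∨
          (e.snd = c ∧ R.Turn c e.fst a) := by
      rintro ⟨⟨x, y⟩, hxy⟩ (h | h | h)
      all_goals
        have h1 := turn_of_rot_eq (R := R) (d := SimpleGraph.Dart.symm ⟨(x, y), hxy⟩) h
        have h2 := R.fst_rot (SimpleGraph.Dart.symm ⟨(x, y), hxy⟩)
        rw [← next_apply, h] at h2
        dsimp at h1 h2
        subst h2
        simp [h1]
    have h1 := key _ (hnext ⟨(a, b), hab⟩ (by simp))
    have h2 := key _ (hnext ⟨(b, c), hbc⟩ (by simp))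
    have h3 := key _ (hnext ⟨(c, a), hca⟩ (by simp))
    have := hab.ne
    have := hbc.ne
    have := hca.ne
    dsimp only at h1 h2 h3
    refine ⟨?_, ?_, ?_⟩ <;> tauto
  · rintro ⟨⟨_, _, h1⟩, ⟨_, _, h2⟩, ⟨_, _, h3⟩⟩
    refine ⟨⟨(a, b), hab⟩, ?_⟩
    have n1 : R.next ⟨(a, b), hab⟩ = ⟨(b, c), hbc⟩ := h1
    have n2 : R.next ⟨(b, c), hbc⟩ = ⟨(c, a), hca⟩ := h2
    have n3 : R.next ⟨(c, a), hca⟩ = ⟨(a, b), hab⟩ := h3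
    refine Set.Subset.antisymm ?_ ?_
    · have s1 : R.next.SameCycle ⟨(a, b), hab⟩ ⟨(b, c), hbc⟩ := ⟨1, by simpa using n1⟩
      have s2 : R.next.SameCycle ⟨(b, c), hbc⟩ ⟨(c, a), hca⟩ := ⟨1, by simpa using n2⟩
      rintro e (rfl | rfl | rfl)
      · exact Equiv.Perm.SameCycle.refl _ _
      · exact s1
      · exact s1.trans s2
    · rintro e he
      obtain ⟨n, rfl⟩ := Equiv.Perm.SameCycle.exists_nat_pow_eq he
      clear he
      induction n with
      | zero => exact Or.inl rfl
      | succ n ih =>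
        rw [pow_succ', Equiv.Perm.mul_apply]
        rcases ih with h | h | h
        · rw [h, n1]; simp
        · rw [h, n2]; simp
        · rw [Set.mem_singleton_iff.mp h, n3]; simp

theorem triangleIsFace_iff [Finite V] (R : RotationSystem G) {a b c : V}
    (hab : G.Adj a b) (hbc : G.Adj b c) (hca : G.Adj c a) :
    R.TriangleIsFace hab hbc hca ↔ R.TurnFace a b c ∨ R.mirror.TurnFace a b c := by
  rw [TriangleIsFace, isFace_triple_iff, isFace_triple_iff]
  refine or_congr Iff.rfl ?_
  simp only [TurnFace, turn_mirror]
  tauto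

end RotationSystem

/-! ### Skipping an element of a permutation, and deleting an edge from a rotation. -/

namespace Equiv.Perm

variable {D : Type*} [DecidableEq D]

/-- The permutation obtained from `σ` by making `x` a fixed point and otherwise skipping it. -/
def bypass (σ : Perm D) (x : D) : Perm D := swap x (σ x) * σ

variable {σ : Perm D} {x d e : D}

theorem bypass_self : σ.bypass x x = x := by simp [bypass]

theorem bypass_of_eq (h : σ d = x) : σ.bypass x d = σ x := by simp [bypass, h]

theorem bypass_of_ne (h : σ d ≠ x) (hd : d ≠ x) : σ.bypass x d = σ d := by
  rw [bypass, mul_apply, swap_apply_of_ne_of_ne h]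
  exact fun h' => hd (σ.injective h')

/-- Strong induction on the number of steps of `σ`: two steps through `x` become one step of the
bypass. -/
theorem SameCycle.bypass [Finite D] (h : σ.SameCycle d e) (hd : d ≠ x) (he : e ≠ x) :
    (σ.bypass x).SameCycle d e := by
  obtain ⟨n, rfl⟩ := h.exists_nat_pow_eq
  clear h
  induction n using Nat.strong_induction_on with
  | _ n ih =>
    rcases n with _ | n
    · exact SameCycle.refl _ _
    rw [pow_succ', mul_apply] at he ⊢
    by_cases hn : (σ ^ n) d = x
    · rcases n with _ | n
      · exact absurd hn hd
      rw [pow_succ', mul_apply] at hn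
      have hx : (σ ^ n) d ≠ x := by
        intro h'
        rw [h'] at hn
        apply he
        rw [pow_succ', mul_apply, h', hn, hn]
      have := ih n (by omega) hx
      rw [pow_succ', mul_apply, hn, ← bypass_of_eq hn]
      exact sameCycle_apply_right.mpr this
    · rw [← bypass_of_ne he hn]
      exact sameCycle_apply_right.mpr (ih n (by omega) hn)

end Equiv.Perm

namespace RotationSystem

variable {V : Type u} {G : SimpleGraph V}

open Classical in
/-- The rotation after the deletion of the edge that carries the dart `e`. -/
noncomputable def eraseRot (R : RotationSystem G) (e : G.Dart) : Equiv.Perm G.Dart :=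
  (R.rot.bypass e).bypass e.symm

variable {R : RotationSystem G} {e d : G.Dart}

/-- The two darts of an edge leave different vertices, so no step of the rotation has to skip both
of them. -/
theorem eraseRot_apply (hd : d ≠ e) (hd' : d ≠ e.symm) :
    (R.rot d ≠ e ∧ R.rot d ≠ e.symm ∧ R.eraseRot e d = R.rot d) ∨
      (R.rot d = e ∧ R.eraseRot e d = R.rot e) ∨
      (R.rot d = e.symm ∧ R.eraseRot e d = R.rot e.symm) := by
  classical
  have hne : e.fst ≠ e.symm.fst := e.adj.ne
  have h1 : R.rot e ≠ e.symm := fun h => hne ((R.fst_rot e).symm.trans (congrArg (·.fst) h))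
  have h2 : R.rot e.symm ≠ e := fun h =>
    hne ((congrArg (·.fst) h).symm.trans (R.fst_rot e.symm))
  have h3 : e.symm ≠ e := fun h => hne (congrArg (·.fst) h).symm
  by_cases he : R.rot d = e
  · refine Or.inr (Or.inl ⟨he, ?_⟩)
    have := Equiv.Perm.bypass_of_eq he
    rw [eraseRot, Equiv.Perm.bypass_of_ne (by rwa [this]) hd', this]
  · have := Equiv.Perm.bypass_of_ne he hd
    by_cases he' : R.rot d = e.symm
    · refine Or.inr (Or.inr ⟨he', ?_⟩)
      rw [eraseRot, Equiv.Perm.bypass_of_eq (by rwa [this]), Equiv.Perm.bypass_of_ne h2 h3]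
    · refine Or.inl ⟨he, he', ?_⟩
      rw [eraseRot, Equiv.Perm.bypass_of_ne (by rwa [this]) hd', this]

theorem eraseRot_self : R.eraseRot e e = e := by
  classical
  have hne : e.fst ≠ e.symm.fst := e.adj.ne
  have h3 : e ≠ e.symm := fun h => hne (congrArg (·.fst) h)
  rw [eraseRot, Equiv.Perm.bypass_of_ne (by rwa [Equiv.Perm.bypass_self]) h3,
    Equiv.Perm.bypass_self]

theorem eraseRot_symm : R.eraseRot e e.symm = e.symm := by
  classical
  rw [eraseRot, Equiv.Perm.bypass_self]

theorem fst_eraseRot (d : G.Dart) : (R.eraseRot e d).fst = d.fst := by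
  by_cases hd : d = e
  · rw [hd, eraseRot_self]
  by_cases hd' : d = e.symm
  · rw [hd', eraseRot_symm]
  rcases eraseRot_apply (R := R) hd hd' with ⟨_, _, h⟩ | ⟨h', h⟩ | ⟨h', h⟩
  · rw [h, R.fst_rot]
  · rw [h, R.fst_rot, ← h', R.fst_rot]
  · rw [h, R.fst_rot, ← h', R.fst_rot]

theorem eraseRot_eq_self_iff : R.eraseRot e d = e ↔ d = e :=
  ⟨fun h => (R.eraseRot e).injective (h.trans eraseRot_self.symm), fun h => by
    rw [h, eraseRot_self]⟩

theorem eraseRot_eq_symm_iff : R.eraseRot e d = e.symm ↔ d = e.symm :=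
  ⟨fun h => (R.eraseRot e).injective (h.trans eraseRot_symm.symm), fun h => by
    rw [h, eraseRot_symm]⟩

theorem sameCycle_eraseRot [Finite V] {d d' : G.Dart} (h : d.fst = d'.fst) (hd : d ≠ e)
    (hd' : d' ≠ e) (hs : d ≠ e.symm) (hs' : d' ≠ e.symm) : (R.eraseRot e).SameCycle d d' := by
  classical exact ((R.sameCycle d d' h).bypass hd hd').bypass hs hs'

/-- A function that is constant on faces and does not separate the two sides of the deleted edge
is constant on the faces that result from the deletion. -/
theorem apply_eraseRot {X : Type*} {c : G.Dart → X} (hc : ∀ d, c (R.rot d) = c d.symm)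
    (he : c e = c e.symm) (hd : d ≠ e) (hd' : d ≠ e.symm) : c (R.eraseRot e d) = c d.symm := by
  rcases eraseRot_apply (R := R) hd hd' with ⟨_, _, h⟩ | ⟨h', h⟩ | ⟨h', h⟩
  · rw [h, hc]
  · rw [h, hc, ← he, ← h', hc]
  · rw [h, hc, SimpleGraph.Dart.symm_symm, he, ← h', hc]

end RotationSystem

/-! ### Deletion of an edge, suppression of vertices of degree two, and the Euler characteristic. -/

/-- The graph `G'` arises from `G` by the deletion of the edge `xy` and the suppression of vertices
of degree two. The vertex `vert u` of `G` corresponds to the vertex `u` of `G'`, and the edge `uw`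
of `G'`, seen from `u`, corresponds to a path whose first edge joins `vert u` to `tgt u w`. -/
structure EdgeReduction {V V' : Type u} (G : SimpleGraph V) (G' : SimpleGraph V') where
  vert : V' → V
  vert_injective : Function.Injective vert
  tgt : V' → V' → V
  x : V
  y : V
  adj_xy : G.Adj x y
  adj_tgt : ∀ {u w}, G'.Adj u w → G.Adj (vert u) (tgt u w)
  tgt_inj : ∀ {u w w'}, G'.Adj u w → G'.Adj u w' → tgt u w = tgt u w' → w = w'
  tgt_ne : ∀ {u w}, G'.Adj u w → s(vert u, tgt u w) ≠ s(x, y)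
  exists_tgt : ∀ {u t}, G.Adj (vert u) t → s(vert u, t) ≠ s(x, y) →
    ∃ w, G'.Adj u w ∧ tgt u w = t
  -- Either the edge is kept, or it becomes a path of length two whose middle vertex has no further
  -- edges once `xy` is deleted.
  link : ∀ {u w}, G'.Adj u w → (tgt u w = vert w ∧ tgt w u = vert u) ∨
    (tgt u w = tgt w u ∧ ∀ t, G.Adj (tgt u w) t → s(tgt u w, t) ≠ s(x, y) →
      t = vert u ∨ t = vert w)
  cover : ∀ {z t}, G.Adj z t → s(z, t) ≠ s(x, y) →
    ∃ u w, G'.Adj u w ∧ ((z = vert u ∧ t = tgt u w) ∨ (t = vert u ∧ z = tgt u w))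
  other : ∃ t, G.Adj x t ∧ t ≠ y
  -- Suppression preserves `|V| - |E|`, while the deletion of `xy` raises it by one.
  card_add : Nat.card V + G'.edgeSet.ncard + 1 = Nat.card V' + G.edgeSet.ncard

namespace EdgeReduction

variable {V V' : Type u} {G : SimpleGraph V} {G' : SimpleGraph V'} (E : EdgeReduction G G')

/-- The deleted edge as a dart. -/
def erased : G.Dart := ⟨(E.x, E.y), E.adj_xy⟩

/-- The first dart of the path that corresponds to a dart of the reduced graph. -/
def dart (d : G'.Dart) : G.Dart := ⟨(E.vert d.fst, E.tgt d.fst d.snd), E.adj_tgt d.adj⟩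

theorem dart_injective : Function.Injective E.dart := by
  rintro ⟨⟨u, w⟩, h⟩ ⟨⟨u', w'⟩, h'⟩ hd
  have h1 : E.vert u = E.vert u' := congrArg (fun d : G.Dart => d.fst) hd
  have h2 : E.tgt u w = E.tgt u' w' := congrArg (fun d : G.Dart => d.snd) hd
  obtain rfl := E.vert_injective h1
  obtain rfl := E.tgt_inj h h' h2
  rfl

theorem mk_eq_iff (d : G.Dart) :
    s(d.fst, d.snd) = s(E.x, E.y) ↔ d = E.erased ∨ d = E.erased.symm := by
  obtain ⟨⟨a, b⟩, h⟩ := d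
  simp [erased, SimpleGraph.Dart.ext_iff, SimpleGraph.Dart.symm]

theorem mem_range_dart {d : G.Dart} : d ∈ Set.range E.dart ↔
    d.fst ∈ Set.range E.vert ∧ d ≠ E.erased ∧ d ≠ E.erased.symm := by
  rw [← not_or, ← mk_eq_iff]
  constructor
  · rintro ⟨d, rfl⟩
    exact ⟨⟨_, rfl⟩, E.tgt_ne d.adj⟩
  · rintro ⟨⟨u, hu⟩, h⟩
    obtain ⟨⟨a, b⟩, hd⟩ := d
    obtain rfl : E.vert u = a := hu
    obtain ⟨w, hw, rfl⟩ := E.exists_tgt hd h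
    exact ⟨⟨(u, w), hw⟩, rfl⟩

/-- The erased rotation preserves the starting vertex and fixes both darts of the deleted edge.
Hence it restricts to the range of `E.dart` and can be transported to `G'`. -/
theorem exists_rotation [Finite V] (R : RotationSystem G) :
    ∃ R' : RotationSystem G', ∀ d, E.dart (R'.rot d) = R.eraseRot E.erased (E.dart d) := by
  have hmem : ∀ d, d ∈ Set.range E.dart ↔ R.eraseRot E.erased d ∈ Set.range E.dart := fun d => by
    rw [mem_range_dart, mem_range_dart, RotationSystem.fst_eraseRot, ne_eq, ne_eq, ne_eq, ne_eq,
      RotationSystem.eraseRot_eq_self_iff, RotationSystem.eraseRot_eq_symm_iff]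
  let σ : Equiv.Perm G'.Dart := (Equiv.ofInjective _ E.dart_injective).symm.permCongr
    ((R.eraseRot E.erased).subtypePerm fun d => (hmem d).symm)
  have hσ : ∀ d, E.dart (σ d) = R.eraseRot E.erased (E.dart d) := fun d => by
    simp only [σ, Equiv.permCongr_apply, Equiv.symm_symm, Equiv.apply_ofInjective_symm]
    rfl
  have hfst : ∀ d, (σ d).fst = d.fst := fun d => by
    have := RotationSystem.fst_eraseRot (R := R) (e := E.erased) (E.dart d)
    rw [← hσ] at this
    exact E.vert_injective this
  refine ⟨⟨σ, hfst, fun d d' h => ?_⟩, hσ⟩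
  have hd := (E.mem_range_dart.mp ⟨d, rfl⟩).2
  have hd' := (E.mem_range_dart.mp ⟨d', rfl⟩).2
  obtain ⟨n, hn⟩ := (RotationSystem.sameCycle_eraseRot (R := R) (congrArg E.vert h) hd.1 hd'.1
    hd.2 hd'.2).exists_nat_pow_eq
  have key : ∀ n : ℕ, E.dart ((σ ^ n) d) = (R.eraseRot E.erased ^ n) (E.dart d) := by
    intro n
    induction n with
    | zero => rfl
    | succ n ih => rw [pow_succ', pow_succ', Equiv.Perm.mul_apply, hσ, ih, Equiv.Perm.mul_apply]
  refine ⟨n, E.dart_injective ?_⟩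
  rw [zpow_natCast, key, hn]

variable {E} {R : RotationSystem G} {R' : RotationSystem G'}

/-- The rotation system `R'` induced on the reduced graph, in terms of successive neighbours. -/
def TurnRel (E : EdgeReduction G G') (R : RotationSystem G) (R' : RotationSystem G') : Prop :=
  ∀ u w w', R'.Turn u w w' → R.Turn (E.vert u) (E.tgt u w) (E.tgt u w') ∨
    ∃ z, s(E.vert u, z) = s(E.x, E.y) ∧ R.Turn (E.vert u) (E.tgt u w) z ∧
      R.Turn (E.vert u) z (E.tgt u w')

theorem TurnRel.mirror (h : E.TurnRel R R') : E.TurnRel R.mirror R'.mirror := by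
  intro u w w' ht
  rcases h u w' w (RotationSystem.turn_mirror.mp ht) with h1 | ⟨z, hz, h1, h2⟩
  · exact Or.inl (RotationSystem.turn_mirror.mpr h1)
  · exact Or.inr ⟨z, hz, RotationSystem.turn_mirror.mpr h2, RotationSystem.turn_mirror.mpr h1⟩

theorem turnRel_of_dart_rot (h : ∀ d, E.dart (R'.rot d) = R.eraseRot E.erased (E.dart d)) :
    E.TurnRel R R' := by
  rintro u w w' ⟨h1, h2, h3⟩
  have hd := h ⟨(u, w), h1⟩
  rw [h3] at hd
  have hne := (E.mem_range_dart.mp ⟨⟨(u, w), h1⟩, rfl⟩).2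
  rcases RotationSystem.eraseRot_apply (R := R) hne.1 hne.2 with ⟨_, _, h4⟩ | ⟨h4, h5⟩ | ⟨h4, h5⟩
  · exact Or.inl (RotationSystem.turn_of_rot_eq (h4.symm.trans hd.symm))
  all_goals
    have hf := (RotationSystem.turn_of_rot_eq h4)
    have hg := (RotationSystem.turn_of_rot_eq (h5.symm.trans hd.symm))
    have hx := R.fst_rot (E.dart ⟨(u, w), h1⟩)
    rw [h4] at hx
    rw [hx] at hg
    refine Or.inr ⟨_, ?_, hf, hg⟩
    change s((E.dart ⟨(u, w), h1⟩).fst, _) = _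
    rw [← hx]
  · rfl
  · exact Sym2.eq_swap

/-- A suppressed vertex retains two darts, and the erased rotation takes one to the other; so a face
label passes unchanged along the whole path. -/
theorem apply_dart_symm {X : Type*} [Finite V] {c : G.Dart → X} (hc : ∀ d, c (R.rot d) = c d.symm)
    (he : c E.erased = c E.erased.symm) (d : G'.Dart) :
    c (E.dart d).symm = c (E.dart d.symm) := by
  obtain ⟨⟨u, w⟩, h⟩ := d
  rcases E.link h with ⟨h1, h2⟩ | ⟨h1, h2⟩
  · congr 1
    simp [dart, SimpleGraph.Dart.symm, h1, h2]
  · set y := (E.dart ⟨(u, w), h⟩).symm with hy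
    set z := (E.dart (SimpleGraph.Dart.symm ⟨(u, w), h⟩)).symm with hz
    have hyf : y.fst = E.tgt u w := rfl
    have hzf : z.fst = E.tgt u w := h1.symm
    have hyz : z ≠ y := fun h' => by
      have := congrArg (fun d : G.Dart => d.snd) h'
      exact h.ne' (E.vert_injective this)
    have hy' := (E.mem_range_dart.mp ⟨⟨(u, w), h⟩, rfl⟩).2
    have hz' := (E.mem_range_dart.mp ⟨SimpleGraph.Dart.symm ⟨(u, w), h⟩, rfl⟩).2
    have aux : ∀ d : G.Dart, d ≠ E.erased → d ≠ E.erased.symm →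
        d.symm ≠ E.erased ∧ d.symm ≠ E.erased.symm := fun d h3 h4 => by
      refine ⟨fun h' => h4 ?_, fun h' => h3 (SimpleGraph.Dart.symm_involutive.injective h')⟩
      rw [← h', SimpleGraph.Dart.symm_symm]
    replace hy' := aux _ hy'.1 hy'.2
    replace hz' := aux _ hz'.1 hz'.2
    rw [← hy] at hy'
    rw [← hz] at hz'
    have hzs : c (E.dart (SimpleGraph.Dart.symm ⟨(u, w), h⟩)) = c z.symm := by
      rw [hz, SimpleGraph.Dart.symm_symm]
    rw [hzs, ← RotationSystem.apply_eraseRot hc he hz'.1 hz'.2]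
    congr 1
    have hρ := E.mk_eq_iff (R.eraseRot E.erased z)
    rw [RotationSystem.eraseRot_eq_self_iff, RotationSystem.eraseRot_eq_symm_iff,
      RotationSystem.fst_eraseRot, hzf] at hρ
    have hadj := (R.eraseRot E.erased z).adj
    rw [RotationSystem.fst_eraseRot, hzf] at hadj
    have hfst := (RotationSystem.fst_eraseRot (R := R) (e := E.erased) z).trans hzf
    rcases h2 _ hadj (fun h' => by tauto) with h3 | h3
    · exact (SimpleGraph.Dart.ext _ _ (Prod.ext (hfst.trans hyf.symm) h3)).symm
    · exfalso
      -- A fixed dart would be alone in its cycle, but `y` is a different dart at the same vertex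
      -- that also survives the deletion.
      have hfix : R.eraseRot E.erased z = z :=
        SimpleGraph.Dart.ext _ _ (Prod.ext (hfst.trans hzf.symm) h3)
      have := RotationSystem.sameCycle_eraseRot (R := R) (hzf.trans hyf.symm) hz'.1 hy'.1 hz'.2
        hy'.2
      exact hyz (Equiv.Perm.SameCycle.eq_of_left this hfix)

/-- No label is lost in passing to `G'`. The label of the deleted edge also occurs on the dart that
precedes it in its face; `other` makes this a dart of a different edge. -/
theorem exists_apply_dart_eq {X : Type*} [Finite V] {c : G.Dart → X}
    (hc : ∀ d, c (R.rot d) = c d.symm) (he : c E.erased = c E.erased.symm) (d : G.Dart) :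
    ∃ d', c (E.dart d') = c d := by
  have key : ∀ d : G.Dart, s(d.fst, d.snd) ≠ s(E.x, E.y) → ∃ d', c (E.dart d') = c d := by
    rintro ⟨⟨z, t⟩, h⟩ hd
    obtain ⟨u, w, huw, ⟨rfl, rfl⟩ | ⟨rfl, rfl⟩⟩ := E.cover h hd
    · exact ⟨⟨(u, w), huw⟩, rfl⟩
    · refine ⟨SimpleGraph.Dart.symm ⟨(u, w), huw⟩, ?_⟩
      rw [← apply_dart_symm hc he]
      rfl
  have hE : ∃ d', c (E.dart d') = c E.erased := by
    obtain ⟨z, hz⟩ := R.exists_turn_left E.adj_xy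
    have hzy : z ≠ E.y := by
      rintro rfl
      obtain ⟨t, ht, hty⟩ := E.other
      exact hty (RotationSystem.eq_of_turn_self hz ht)
    obtain ⟨h1, h2, h3⟩ := hz
    obtain ⟨d', hd'⟩ := key ⟨(z, E.x), h1.symm⟩ (by
      intro h'
      rcases Sym2.eq_iff.mp h' with ⟨_, h5⟩ | ⟨h4, _⟩
      · exact E.adj_xy.ne h5
      · exact hzy h4)
    refine ⟨d', hd'.trans ?_⟩
    change c (SimpleGraph.Dart.symm ⟨(E.x, z), h1⟩) = _
    rw [← hc, h3]
    rfl
  by_cases hd : s(d.fst, d.snd) = s(E.x, E.y)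
  · rcases (E.mk_eq_iff d).mp hd with rfl | rfl
    · exact hE
    · rwa [← he]
  · exact key d hd

theorem card_range_le_faceCount {X : Type*} [Finite V] [Finite V'] {c : G.Dart → X}
    (h : ∀ d, E.dart (R'.rot d) = R.eraseRot E.erased (E.dart d))
    (hc : ∀ d, c (R.rot d) = c d.symm) (he : c E.erased = c E.erased.symm) :
    (Set.range c).ncard ≤ R'.faceCount := by
  refine R'.card_le_faceCount (fun d => Set.rangeFactorization c (E.dart d)) (fun d => ?_) ?_
  · refine Subtype.ext ?_
    change c (E.dart (R'.rot d)) = c (E.dart d.symm)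
    have hne := (E.mem_range_dart.mp ⟨d, rfl⟩).2
    rw [h, RotationSystem.apply_eraseRot hc he hne.1 hne.2, apply_dart_symm hc he]
  · rintro ⟨_, d, rfl⟩
    obtain ⟨d', hd'⟩ := exists_apply_dart_eq hc he d
    exact ⟨d', Subtype.ext hd'⟩

/-- A labelling of the darts of `G` by faces descends to `G'` once the two sides of the deleted edge
have equal labels. Identifying these two labels, through `g`, costs at most one value, and nothing
if they already agree. -/
theorem faceCount_le [Finite V] [Finite V']
    (h : ∀ d, E.dart (R'.rot d) = R.eraseRot E.erased (E.dart d)) :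
    R.faceCount ≤ R'.faceCount + 1 ∧
      (R.faceOf E.erased = R.faceOf E.erased.symm → R.faceCount ≤ R'.faceCount) := by
  classical
  refine ⟨?_, fun he => card_range_le_faceCount h R.faceOf_rot he⟩
  let g : Set G.Dart → Set G.Dart := fun F =>
    if F = R.faceOf E.erased.symm then R.faceOf E.erased else F
  have hg := card_range_le_faceCount (c := fun d => g (R.faceOf d)) h
    (fun d => congrArg g (R.faceOf_rot d)) (by simp [g])
  have hsub : Set.range R.faceOf ⊆
      insert (R.faceOf E.erased.symm) (Set.range fun d => g (R.faceOf d)) := by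
    rintro _ ⟨d, rfl⟩
    by_cases hd : R.faceOf d = R.faceOf E.erased.symm
    · exact Or.inl hd
    · exact Or.inr ⟨d, by simp [g, hd]⟩
  calc R.faceCount ≤ _ := Set.ncard_le_ncard hsub (Set.toFinite _)
    _ ≤ _ := Set.ncard_insert_le _ _
    _ ≤ _ := by omega

/-- The Euler characteristic is at most that of the sphere. -/
def _root_.EulerBound {V : Type u} (G : SimpleGraph V) : Prop :=
  ∀ R : RotationSystem G, Nat.card V + R.faceCount ≤ G.edgeSet.ncard + 2

/-- The gain of at most one face is balanced by the one in `card_add`. -/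
theorem eulerBound [Finite V] [Finite V'] (E : EdgeReduction G G') (h : EulerBound G') :
    EulerBound G := by
  intro R
  obtain ⟨R', hR'⟩ := E.exists_rotation R
  have := (faceCount_le hR').1
  have := E.card_add
  have := h R'
  omega

/-- A planar embedding of `G` induces a planar embedding of the reduced graph, and the deleted edge
lies on two different faces. -/
theorem exists_isPlanar [Finite V] [Finite V'] (E : EdgeReduction G G') (hb : EulerBound G')
    (hc : G'.Connected) (hR : R.IsPlanar) : ∃ R' : RotationSystem G', R'.IsPlanar ∧
      E.TurnRel R R' ∧ R.faceOf E.erased ≠ R.faceOf E.erased.symm := by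
  obtain ⟨R', hR'⟩ := E.exists_rotation R
  have h1 := faceCount_le hR'
  have h2 := E.card_add
  have h3 := hb R'
  have h4 := (R.isPlanar_iff.mp hR).2
  refine ⟨R', R'.isPlanar_iff.mpr ⟨hc, by omega⟩, turnRel_of_dart_rot hR', fun h => ?_⟩
  have := h1.2 h
  omega

end EdgeReduction

/-! ### The inverse path reduction as the addition of an edge. -/

/-- The edges of `G` split into a copy of `H` and an explicit list `B`. Comparing `G` and `G'` with
a common part `H` yields the edge counts for both reductions. -/
theorem ncard_edgeSet_eq_add {X V : Type u} [Finite X] [Finite V] {H : SimpleGraph X}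
    {G : SimpleGraph V} {f : X → V} (hf : Function.Injective f)
    (hadj : ∀ {x y}, G.Adj (f x) (f y) ↔ H.Adj x y) {B : Set (Sym2 V)}
    (hB : B ⊆ G.edgeSet) (hf' : ∀ x y, s(f x, f y) ∉ B)
    (hc : ∀ z t, G.Adj z t → (∃ x y, f x = z ∧ f y = t) ∨ s(z, t) ∈ B) :
    G.edgeSet.ncard = H.edgeSet.ncard + B.ncard := by
  have h1 : G.edgeSet = Sym2.map f '' H.edgeSet ∪ B := by
    ext e
    induction e with | _ z t
    constructor
    · intro h
      rcases hc z t h with ⟨x, y, rfl, rfl⟩ | h'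
      · exact Or.inl ⟨s(x, y), hadj.mp h, rfl⟩
      · exact Or.inr h'
    · rintro (⟨e, he, h⟩ | h)
      · induction e with | _ x y
        rw [← h]
        exact hadj.mpr he
      · exact hB h
  have h2 : Disjoint (Sym2.map f '' H.edgeSet) B := by
    rw [Set.disjoint_left]
    rintro _ ⟨e, he, rfl⟩
    induction e with | _ x y
    exact hf' x y
  rw [h1, Set.ncard_union_eq h2 (Set.toFinite _) (Set.toFinite _),
    Set.ncard_image_of_injective _ (Sym2.map.injective hf)]

/-- The graph `G` arises from `G'` by the subdivision of the edge `ab` with a new vertex `m` and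
the addition of an edge from `m` to `s`. -/
structure SubdividedChord {V V' : Type u} (G : SimpleGraph V) (G' : SimpleGraph V') where
  vert : V' → V
  vert_injective : Function.Injective vert
  m : V
  vert_ne : ∀ u, vert u ≠ m
  eq_or : ∀ z, z = m ∨ ∃ u, vert u = z
  a : V'
  b : V'
  s : V'
  adj_ab : G'.Adj a b
  s_ne_a : s ≠ a
  s_ne_b : s ≠ b
  adj_iff : ∀ {u w}, G.Adj (vert u) (vert w) ↔ G'.Adj u w ∧ s(u, w) ≠ s(a, b)
  adj_m : ∀ {u}, G.Adj m (vert u) ↔ u = a ∨ u = b ∨ u = s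

namespace SubdividedChord

variable {V V' : Type u} {G : SimpleGraph V} {G' : SimpleGraph V'} (C : SubdividedChord G G')

open Classical in
/-- The first vertex after `u` on the path that corresponds to the edge `uw`. -/
noncomputable def tgt (u w : V') : V := if s(u, w) = s(C.a, C.b) then C.m else C.vert w

theorem tgt_of_eq {u w : V'} (h : s(u, w) = s(C.a, C.b)) : C.tgt u w = C.m := if_pos h

theorem tgt_of_ne {u w : V'} (h : s(u, w) ≠ s(C.a, C.b)) : C.tgt u w = C.vert w := if_neg h

theorem tgt_ab : C.tgt C.a C.b = C.m := C.tgt_of_eq rfl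

theorem tgt_ba : C.tgt C.b C.a = C.m := C.tgt_of_eq Sym2.eq_swap

theorem tgt_left_s (w : V') : C.tgt C.s w = C.vert w := C.tgt_of_ne fun h => by
  rcases Sym2.eq_iff.mp h with ⟨h, _⟩ | ⟨h, _⟩
  · exact C.s_ne_a h
  · exact C.s_ne_b h

theorem tgt_right_s (u : V') : C.tgt u C.s = C.vert C.s := C.tgt_of_ne fun h => by
  rcases Sym2.eq_iff.mp h with ⟨_, h⟩ | ⟨_, h⟩
  · exact C.s_ne_b h
  · exact C.s_ne_a h

theorem adj_m_iff {z : V} : G.Adj C.m z ↔ z = C.vert C.a ∨ z = C.vert C.b ∨ z = C.vert C.s := by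
  rcases C.eq_or z with rfl | ⟨u, rfl⟩
  · simp [(C.vert_ne _).symm]
  · simp [C.adj_m, C.vert_injective.eq_iff]

theorem adj_tgt {u w : V'} (h : G'.Adj u w) : G.Adj (C.vert u) (C.tgt u w) := by
  by_cases h' : s(u, w) = s(C.a, C.b)
  · rw [C.tgt_of_eq h', SimpleGraph.adj_comm, C.adj_m]
    rcases Sym2.eq_iff.mp h' with ⟨h, _⟩ | ⟨h, _⟩ <;> simp [h]
  · rw [C.tgt_of_ne h', C.adj_iff]
    exact ⟨h, h'⟩

theorem mk_vert_eq {u : V'} {t : V} (h : s(C.vert u, t) = s(C.m, C.vert C.s)) :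
    u = C.s ∧ t = C.m := by
  rcases Sym2.eq_iff.mp h with ⟨h, _⟩ | ⟨h, h'⟩
  · exact absurd h (C.vert_ne u)
  · exact ⟨C.vert_injective h, h'⟩

theorem card_vertices (C : SubdividedChord G G') [Finite V'] : Nat.card V = Nat.card V' + 1 := by
  have : Function.Bijective (fun o : Option V' => o.elim C.m C.vert) := by
    constructor
    · rintro (_ | u) (_ | w) h
      · rfl
      · exact absurd h.symm (C.vert_ne w)
      · exact absurd h (C.vert_ne u)
      · exact congrArg some (C.vert_injective h)
    · intro z
      rcases C.eq_or z with rfl | ⟨u, rfl⟩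
      · exact ⟨none, rfl⟩
      · exact ⟨some u, rfl⟩
  rw [← Nat.card_eq_of_bijective _ this, Finite.card_option]

theorem ncard_edges (C : SubdividedChord G G') [Finite V] [Finite V'] :
    G.edgeSet.ncard = G'.edgeSet.ncard + 2 := by
  have h1 : G'.edgeSet.ncard = (G'.deleteEdges {s(C.a, C.b)}).edgeSet.ncard + 1 := by
    rw [SimpleGraph.edgeSet_deleteEdges]
    exact (Set.ncard_sdiff_singleton_add_one (a := s(C.a, C.b)) (s := G'.edgeSet) C.adj_ab
      (Set.toFinite _)).symm
  have hm := fun u => C.vert_ne u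
  have h2 : G.edgeSet.ncard = (G'.deleteEdges {s(C.a, C.b)}).edgeSet.ncard +
      ({s(C.m, C.vert C.a), s(C.m, C.vert C.b), s(C.m, C.vert C.s)} : Set (Sym2 V)).ncard := by
    refine ncard_edgeSet_eq_add C.vert_injective (by simp [C.adj_iff]) ?_ ?_ ?_
    · rintro e (rfl | rfl | rfl) <;> simp [C.adj_m]
    · intro x y
      simp [hm]
    · intro z t h
      rcases C.eq_or z with rfl | ⟨u, rfl⟩
      · rcases C.adj_m_iff.mp h with rfl | rfl | rfl <;> simp
      · rcases C.eq_or t with rfl | ⟨w, rfl⟩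
        · rcases C.adj_m_iff.mp h.symm with h | h | h <;> simp [h]
        · exact Or.inl ⟨u, w, rfl, rfl⟩
  have h3 : ({s(C.m, C.vert C.a), s(C.m, C.vert C.b), s(C.m, C.vert C.s)} : Set (Sym2 V)).ncard
      = 3 := by
    refine Set.ncard_eq_three.mpr ⟨_, _, _, ?_, ?_, ?_, rfl⟩ <;>
      simp [(hm _).symm, C.vert_injective.eq_iff, C.adj_ab.ne, C.s_ne_a.symm, C.s_ne_b.symm]
  omega

/-- The deletion of the edge `ms` and the suppression of `m`. -/
noncomputable def edgeReduction [Finite V] [Finite V'] : EdgeReduction G G' where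
  vert := C.vert
  vert_injective := C.vert_injective
  tgt := C.tgt
  x := C.m
  y := C.vert C.s
  adj_xy := C.adj_m.mpr (by simp)
  adj_tgt := C.adj_tgt
  tgt_inj := by
    intro u w w' h h' he
    by_cases h1 : s(u, w) = s(C.a, C.b) <;> by_cases h2 : s(u, w') = s(C.a, C.b)
    · exact Sym2.congr_right.mp (h1.trans h2.symm)
    · rw [C.tgt_of_eq h1, C.tgt_of_ne h2] at he
      exact absurd he.symm (C.vert_ne w')
    · rw [C.tgt_of_ne h1, C.tgt_of_eq h2] at he
      exact absurd he (C.vert_ne w)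
    · rw [C.tgt_of_ne h1, C.tgt_of_ne h2] at he
      exact C.vert_injective he
  tgt_ne := by
    intro u w h he
    obtain ⟨rfl, h2⟩ := C.mk_vert_eq he
    rw [tgt_left_s] at h2
    exact C.vert_ne w h2
  exists_tgt := by
    intro u t h he
    rcases C.eq_or t with rfl | ⟨w, rfl⟩
    · rcases C.adj_m.mp h.symm with rfl | rfl | rfl
      · exact ⟨C.b, C.adj_ab, C.tgt_ab⟩
      · exact ⟨C.a, C.adj_ab.symm, C.tgt_ba⟩
      · exact absurd Sym2.eq_swap he
    · exact ⟨w, (C.adj_iff.mp h).1, C.tgt_of_ne (C.adj_iff.mp h).2⟩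
  link := by
    intro u w h
    by_cases h1 : s(u, w) = s(C.a, C.b)
    · refine Or.inr ⟨by rw [C.tgt_of_eq h1, C.tgt_of_eq (Sym2.eq_swap.trans h1)], ?_⟩
      rw [C.tgt_of_eq h1]
      intro t ht hne
      rcases C.adj_m_iff.mp ht with rfl | rfl | rfl
      · rcases Sym2.eq_iff.mp h1 with ⟨rfl, rfl⟩ | ⟨rfl, rfl⟩ <;> simp
      · rcases Sym2.eq_iff.mp h1 with ⟨rfl, rfl⟩ | ⟨rfl, rfl⟩ <;> simp
      · exact absurd rfl hne
    · exact Or.inl ⟨C.tgt_of_ne h1, C.tgt_of_ne fun h2 => h1 (Sym2.eq_swap.trans h2)⟩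
  cover := by
    intro z t h he
    rcases C.eq_or z with rfl | ⟨u, rfl⟩
    · rcases C.adj_m_iff.mp h with rfl | rfl | rfl
      · exact ⟨C.a, C.b, C.adj_ab, Or.inr ⟨rfl, C.tgt_ab.symm⟩⟩
      · exact ⟨C.b, C.a, C.adj_ab.symm, Or.inr ⟨rfl, C.tgt_ba.symm⟩⟩
      · exact absurd rfl he
    · rcases C.eq_or t with rfl | ⟨w, rfl⟩
      · rcases C.adj_m.mp h.symm with rfl | rfl | rfl
        · exact ⟨C.a, C.b, C.adj_ab, Or.inl ⟨rfl, C.tgt_ab.symm⟩⟩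
        · exact ⟨C.b, C.a, C.adj_ab.symm, Or.inl ⟨rfl, C.tgt_ba.symm⟩⟩
        · exact absurd Sym2.eq_swap he
      · obtain ⟨h1, h2⟩ := C.adj_iff.mp h
        exact ⟨u, w, h1, Or.inl ⟨rfl, (C.tgt_of_ne h2).symm⟩⟩
  other := ⟨C.vert C.a, C.adj_m.mpr (by simp), fun h => C.s_ne_a (C.vert_injective h).symm⟩
  card_add := by
    have := C.ncard_edges
    have := C.card_vertices
    omega

open Classical in
/-- If `a` has degree three with neighbours `b`, `s` and `x` in `G'`, then `G` arises from `G'`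
also by the subdivision of the edge `ax`, with `m` in the role of the old vertex `a`. -/
noncomputable def slide {x : V'} (hN : ∀ w, G'.Adj C.a w ↔ w = C.b ∨ w = C.s ∨ w = x)
    (hxb : x ≠ C.b) (hxs : x ≠ C.s) : SubdividedChord G G' where
  vert u := if u = C.a then C.m else C.vert u
  vert_injective := by
    intro u w h
    dsimp only at h
    split_ifs at h with h1 h2 h2
    · rw [h1, h2]
    · exact absurd h.symm (C.vert_ne w)
    · exact absurd h (C.vert_ne u)
    · exact C.vert_injective h
  m := C.vert C.a
  vert_ne u h := by
    split_ifs at h with h1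
    · exact C.vert_ne _ h.symm
    · exact h1 (C.vert_injective h)
  eq_or z := by
    rcases C.eq_or z with rfl | ⟨u, rfl⟩
    · exact Or.inr ⟨C.a, if_pos rfl⟩
    · by_cases h : u = C.a
      · exact Or.inl (by rw [h])
      · exact Or.inr ⟨u, if_neg h⟩
  a := C.a
  b := x
  s := C.s
  adj_ab := (hN x).mpr (by simp)
  s_ne_a := C.s_ne_a
  s_ne_b := hxs.symm
  adj_iff := by
    have hab := C.adj_ab.ne
    have hsa := C.s_ne_a
    have hsb := C.s_ne_b
    have hxa : x ≠ C.a := ((hN x).mpr (by simp)).ne'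
    -- Apart from the old `a`, the neighbours of `m` are `b` and `s`, and these are exactly the
    -- neighbours of `a` in `G'` other than `x`.
    have key : ∀ w, w ≠ C.a → (G.Adj C.m (C.vert w) ↔ G'.Adj C.a w ∧ s(C.a, w) ≠ s(C.a, x)) := by
      intro w hw
      rw [C.adj_m, hN, ne_eq, Sym2.congr_right]
      grind
    intro u w
    by_cases hu : u = C.a <;> by_cases hw : w = C.a
    · simp [hu, hw]
    · rw [if_pos hu, if_neg hw, key w hw, hu]
    · rw [if_neg hu, if_pos hw, SimpleGraph.adj_comm, key u hu, hw, SimpleGraph.adj_comm,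
        Sym2.eq_swap]
    · rw [if_neg hu, if_neg hw, C.adj_iff]
      simp [hu, hw]
  adj_m := by
    have hab := C.adj_ab.ne
    have hsa := C.s_ne_a
    have hsb := C.s_ne_b
    have hxa : x ≠ C.a := ((hN x).mpr (by simp)).ne'
    intro u
    by_cases hu : u = C.a
    · rw [if_pos hu, SimpleGraph.adj_comm, C.adj_m]
      simp [hu]
    · rw [if_neg hu, C.adj_iff, hN, ne_eq, Sym2.congr_right]
      grind

end SubdividedChord

/-! ### The inverse triangle reduction as the addition of an edge. -/

/-- The graph `G` arises from `G'` by the replacement of the vertex `none`, whose neighbours are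
`a`, `b` and `c`, with a triangle `pqr`. -/
structure TriangleExpansion {V X : Type u} (G : SimpleGraph V) (G' : SimpleGraph (Option X)) where
  emb : X → V
  emb_injective : Function.Injective emb
  p : V
  q : V
  r : V
  p_ne : ∀ x, p ≠ emb x
  q_ne : ∀ x, q ≠ emb x
  r_ne : ∀ x, r ≠ emb x
  eq_or : ∀ z, z = p ∨ z = q ∨ z = r ∨ ∃ x, emb x = z
  a : X
  b : X
  c : X
  a_ne_b : a ≠ b
  b_ne_c : b ≠ c
  c_ne_a : c ≠ a
  adj_pq : G.Adj p q
  adj_qr : G.Adj q r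
  adj_rp : G.Adj r p
  adj_p : ∀ {x}, G.Adj p (emb x) ↔ x = a
  adj_q : ∀ {x}, G.Adj q (emb x) ↔ x = b
  adj_r : ∀ {x}, G.Adj r (emb x) ↔ x = c
  adj_none : ∀ {x}, G'.Adj none (some x) ↔ x = a ∨ x = b ∨ x = c
  adj_iff : ∀ {x y}, G'.Adj (some x) (some y) ↔ G.Adj (emb x) (emb y)

namespace TriangleExpansion

variable {V X : Type u} {G : SimpleGraph V} {G' : SimpleGraph (Option X)}
  (T : TriangleExpansion G G')

/-- Cyclic relabelling of the triangle. -/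
def rotate : TriangleExpansion G G' where
  emb := T.emb
  emb_injective := T.emb_injective
  p := T.q
  q := T.r
  r := T.p
  p_ne := T.q_ne
  q_ne := T.r_ne
  r_ne := T.p_ne
  eq_or z := by have := T.eq_or z; tauto
  a := T.b
  b := T.c
  c := T.a
  a_ne_b := T.b_ne_c
  b_ne_c := T.c_ne_a
  c_ne_a := T.a_ne_b
  adj_pq := T.adj_qr
  adj_qr := T.adj_rp
  adj_rp := T.adj_pq
  adj_p := T.adj_q
  adj_q := T.adj_r
  adj_r := T.adj_p
  adj_none := by intro x; rw [T.adj_none]; tauto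
  adj_iff := T.adj_iff

theorem adj_p_iff {z : V} : G.Adj T.p z ↔ z = T.emb T.a ∨ z = T.q ∨ z = T.r := by
  have := T.adj_pq
  have := T.adj_rp.symm
  rcases T.eq_or z with rfl | rfl | rfl | ⟨u, rfl⟩
  · simp [T.p_ne, T.adj_pq.ne, T.adj_rp.ne']
  · simpa
  · simpa
  · simp [T.adj_p, T.emb_injective.eq_iff, (T.q_ne _).symm, (T.r_ne _).symm]

theorem adj_q_iff {z : V} : G.Adj T.q z ↔ z = T.emb T.b ∨ z = T.r ∨ z = T.p := T.rotate.adj_p_iff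

theorem adj_r_iff {z : V} : G.Adj T.r z ↔ z = T.emb T.c ∨ z = T.p ∨ z = T.q :=
  T.rotate.rotate.adj_p_iff

open Classical in
/-- The neighbour of `emb x` that corresponds to the neighbour `o` of `x` in `G'`. -/
noncomputable def out (x : X) (o : Option X) : V :=
  -- For `o = none` the value is meaningful only if `x` is `a`, `b` or `c`; elsewhere `T.r` is a
  -- default.
  o.elim (if x = T.a then T.p else if x = T.b then T.q else T.r) T.emb

@[simp] theorem out_a : T.out T.a none = T.p := by simp [out]

@[simp] theorem out_b : T.out T.b none = T.q := by simp [out, T.a_ne_b.symm]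

@[simp] theorem out_c : T.out T.c none = T.r := by simp [out, T.c_ne_a, T.b_ne_c.symm]

theorem card_vertices (T : TriangleExpansion G G') [Finite X] :
    Nat.card V = Nat.card (Option X) + 2 := by
  have : Function.Bijective (fun o : Option (Option (Option X)) =>
      o.elim T.p fun o => o.elim T.q fun o => o.elim T.r T.emb) := by
    constructor
    · have := T.p_ne
      have := T.q_ne
      have := T.r_ne
      have := T.adj_pq.ne
      have := T.adj_qr.ne
      have := T.adj_rp.ne
      have := @T.emb_injective
      rintro (_ | _ | _ | u) (_ | _ | _ | w) h <;> simp only [Option.elim] at h <;> grind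
    · intro z
      rcases T.eq_or z with rfl | rfl | rfl | ⟨u, rfl⟩
      · exact ⟨none, rfl⟩
      · exact ⟨some none, rfl⟩
      · exact ⟨some (some none), rfl⟩
      · exact ⟨some (some (some u)), rfl⟩
  rw [← Nat.card_eq_of_bijective _ this, Finite.card_option, Finite.card_option]

theorem ncard_edges (T : TriangleExpansion G G') [Finite V] [Finite X] :
    G.edgeSet.ncard = G'.edgeSet.ncard + 3 := by
  have hp := fun x => (T.p_ne x).symm
  have hq := fun x => (T.q_ne x).symm
  have hr := fun x => (T.r_ne x).symm
  have hpq := T.adj_pq.ne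
  have hqr := T.adj_qr.ne
  have hrp := T.adj_rp.ne
  have h1 : G'.edgeSet.ncard = (G'.comap some).edgeSet.ncard +
      ({s(none, some T.a), s(none, some T.b), s(none, some T.c)} : Set (Sym2 (Option X))).ncard := by
    refine ncard_edgeSet_eq_add (Option.some_injective X) Iff.rfl ?_ (by simp) ?_
    · rintro e (rfl | rfl | rfl) <;> simp [T.adj_none]
    · rintro (_ | z) (_ | t) h
      · exact absurd h (G'.irrefl)
      · rcases T.adj_none.mp h with rfl | rfl | rfl <;> simp
      · rcases T.adj_none.mp h.symm with rfl | rfl | rfl <;> simp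
      · exact Or.inl ⟨z, t, rfl, rfl⟩
  have h2 : G.edgeSet.ncard = (G'.comap some).edgeSet.ncard +
      ({s(T.p, T.emb T.a), s(T.q, T.emb T.b), s(T.r, T.emb T.c), s(T.p, T.q), s(T.q, T.r),
        s(T.r, T.p)} : Set (Sym2 V)).ncard := by
    refine ncard_edgeSet_eq_add T.emb_injective T.adj_iff.symm ?_ (by simp [hp, hq, hr]) ?_
    · rintro e (rfl | rfl | rfl | rfl | rfl | rfl)
      · exact T.adj_p.mpr rfl
      · exact T.adj_q.mpr rfl
      · exact T.adj_r.mpr rfl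
      · exact T.adj_pq
      · exact T.adj_qr
      · exact T.adj_rp
    · intro z t h
      rcases T.eq_or z with rfl | rfl | rfl | ⟨u, rfl⟩
      · rcases T.adj_p_iff.mp h with rfl | rfl | rfl <;> simp
      · rcases T.adj_q_iff.mp h with rfl | rfl | rfl <;> simp
      · rcases T.adj_r_iff.mp h with rfl | rfl | rfl <;> simp
      · rcases T.eq_or t with rfl | rfl | rfl | ⟨w, rfl⟩
        · rcases T.adj_p_iff.mp h.symm with h | h | h <;> simp [h]
        · rcases T.adj_q_iff.mp h.symm with h | h | h <;> simp [h]
        · rcases T.adj_r_iff.mp h.symm with h | h | h <;> simp [h]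
        · exact Or.inl ⟨u, w, rfl, rfl⟩
  have h3 : ({s(none, some T.a), s(none, some T.b), s(none, some T.c)} :
      Set (Sym2 (Option X))).ncard = 3 := by
    refine Set.ncard_eq_three.mpr ⟨_, _, _, ?_, ?_, ?_, rfl⟩ <;>
      simp [T.a_ne_b, T.b_ne_c, T.c_ne_a.symm]
  have h4 : ({s(T.p, T.emb T.a), s(T.q, T.emb T.b), s(T.r, T.emb T.c), s(T.p, T.q), s(T.q, T.r),
        s(T.r, T.p)} : Set (Sym2 V)).ncard = 6 := by
    iterate 5 rw [Set.ncard_insert_of_notMem]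
    · simp
    all_goals simp [hp, hq, hr, T.p_ne, T.q_ne, hpq, hqr, hrp, hpq.symm, hqr.symm, hrp.symm]
  omega

open Classical in
/-- The deletion of the edge `pq` and the suppression of `p` and `q`. -/
noncomputable def edgeReduction [Finite V] [Finite X] : EdgeReduction G G' where
  vert o := o.elim T.r T.emb
  vert_injective := by
    rintro (_ | u) (_ | w) h
    · rfl
    · exact absurd h (T.r_ne w)
    · exact absurd h.symm (T.r_ne u)
    · exact congrArg some (T.emb_injective h)
  -- The corner `r` plays the role of `none`. Its edges to `a` and `b` become paths through `p` and
  -- `q`, while its edge to `c` is kept.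
  tgt o o' := o.elim (o'.elim T.r fun y => if y = T.a then T.p else if y = T.b then T.q
    else T.emb y) fun x => T.out x o'
  x := T.p
  y := T.q
  adj_xy := T.adj_pq
  adj_tgt := by
    rintro (_ | u) (_ | w) h
    · exact absurd h G'.irrefl
    · rcases T.adj_none.mp h with rfl | rfl | rfl
      · simpa using T.adj_rp
      · simpa [T.a_ne_b.symm] using T.adj_qr.symm
      · simp [T.c_ne_a, T.b_ne_c.symm, T.adj_r]
    · rcases T.adj_none.mp h.symm with rfl | rfl | rfl
      · simp [SimpleGraph.adj_comm, T.adj_p]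
      · simp [SimpleGraph.adj_comm, T.adj_q]
      · simp [SimpleGraph.adj_comm, T.adj_r]
    · exact T.adj_iff.mp h
  tgt_inj := by
    have hp := T.p_ne
    have hq := T.q_ne
    have hr := T.r_ne
    rintro (_ | u) (_ | w) (_ | w') h h' he
    · rfl
    · exact absurd h G'.irrefl
    · exact absurd h' G'.irrefl
    · have := T.adj_pq.ne
      have := T.a_ne_b
      have := T.b_ne_c
      have := T.c_ne_a
      have := T.emb_injective.eq_iff (a := w) (b := w')
      simp only [Option.elim_none, Option.elim_some] at he
      grind
    · rfl
    · simp only [Option.elim_some, out, Option.elim_none] at he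
      grind
    · simp only [Option.elim_some, out, Option.elim_none] at he
      grind
    · exact congrArg some (T.emb_injective he)
  tgt_ne := by
    rintro (_ | u) w h he
    · rcases Sym2.eq_iff.mp he with ⟨h, _⟩ | ⟨h, _⟩
      · exact T.adj_rp.ne h
      · exact T.adj_qr.ne' h
    · rcases Sym2.eq_iff.mp he with ⟨h, _⟩ | ⟨h, _⟩
      · exact T.p_ne _ h.symm
      · exact T.q_ne _ h.symm
  exists_tgt := by
    rintro (_ | u) t h he
    · rcases T.adj_r_iff.mp h with rfl | rfl | rfl
      · exact ⟨some T.c, T.adj_none.mpr (by simp), by simp [T.c_ne_a, T.b_ne_c.symm]⟩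
      · exact ⟨some T.a, T.adj_none.mpr (by simp), by simp⟩
      · exact ⟨some T.b, T.adj_none.mpr (by simp), by simp [T.a_ne_b.symm]⟩
    · rcases T.eq_or t with rfl | rfl | rfl | ⟨w, rfl⟩
      · obtain rfl := T.adj_p.mp h.symm
        exact ⟨none, (T.adj_none.mpr (by simp)).symm, by simp⟩
      · obtain rfl := T.adj_q.mp h.symm
        exact ⟨none, (T.adj_none.mpr (by simp)).symm, by simp⟩
      · obtain rfl := T.adj_r.mp h.symm
        exact ⟨none, (T.adj_none.mpr (by simp)).symm, by simp⟩
      · exact ⟨some w, T.adj_iff.mpr h, rfl⟩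
  link := by
    have hP : ∀ t, G.Adj T.p t → s(T.p, t) ≠ s(T.p, T.q) → t = T.emb T.a ∨ t = T.r := by
      intro t ht hne
      rcases T.adj_p_iff.mp ht with rfl | rfl | rfl <;> simp at hne ⊢
    have hQ : ∀ t, G.Adj T.q t → s(T.q, t) ≠ s(T.p, T.q) → t = T.emb T.b ∨ t = T.r := by
      intro t ht hne
      rcases T.adj_q_iff.mp ht with rfl | rfl | rfl <;> simp at hne ⊢
    rintro (_ | u) (_ | w) h
    · exact absurd h G'.irrefl
    · rcases T.adj_none.mp h with rfl | rfl | rfl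
      · refine Or.inr ⟨by simp, ?_⟩
        simpa using fun t h h' h'' => (hP t h (by simpa using ⟨h', h''⟩)).symm
      · refine Or.inr ⟨by simp [T.a_ne_b.symm], ?_⟩
        simpa [T.a_ne_b.symm] using fun t h h' h'' => (hQ t h (by simpa using ⟨h', h''⟩)).symm
      · exact Or.inl (by simp [T.c_ne_a, T.b_ne_c.symm])
    · rcases T.adj_none.mp h.symm with rfl | rfl | rfl
      · refine Or.inr ⟨by simp, ?_⟩
        simpa using fun t h h' h'' => (hP t h (by simpa using ⟨h', h''⟩))
      · refine Or.inr ⟨by simp [T.a_ne_b.symm], ?_⟩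
        simpa [T.a_ne_b.symm] using fun t h h' h'' => (hQ t h (by simpa using ⟨h', h''⟩))
      · exact Or.inl (by simp [T.c_ne_a, T.b_ne_c.symm])
    · exact Or.inl ⟨rfl, rfl⟩
  cover := by
    have hr : ∀ t, G.Adj T.r t → ∃ w, G'.Adj none (some w) ∧ t =
        if w = T.a then T.p else if w = T.b then T.q else T.emb w := by
      intro t h
      rcases T.adj_r_iff.mp h with rfl | rfl | rfl
      · exact ⟨T.c, T.adj_none.mpr (by simp), by simp [T.c_ne_a, T.b_ne_c.symm]⟩
      · exact ⟨T.a, T.adj_none.mpr (by simp), by simp⟩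
      · exact ⟨T.b, T.adj_none.mpr (by simp), by simp [T.a_ne_b.symm]⟩
    have hx : ∀ x t, G.Adj (T.emb x) t → ∃ w, G'.Adj (some x) w ∧ t = T.out x w := by
      intro x t h
      rcases T.eq_or t with rfl | rfl | rfl | ⟨w, rfl⟩
      · obtain rfl := T.adj_p.mp h.symm
        exact ⟨none, (T.adj_none.mpr (by simp)).symm, by simp⟩
      · obtain rfl := T.adj_q.mp h.symm
        exact ⟨none, (T.adj_none.mpr (by simp)).symm, by simp⟩
      · obtain rfl := T.adj_r.mp h.symm
        exact ⟨none, (T.adj_none.mpr (by simp)).symm, by simp⟩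
      · exact ⟨some w, T.adj_iff.mpr h, rfl⟩
    intro z t h he
    by_cases hz : z = T.r
    · obtain ⟨w, hw, ht⟩ := hr t (hz ▸ h)
      exact ⟨none, some w, hw, Or.inl ⟨hz, ht⟩⟩
    by_cases ht : t = T.r
    · obtain ⟨w, hw, hz⟩ := hr z (ht ▸ h.symm)
      exact ⟨none, some w, hw, Or.inr ⟨ht, hz⟩⟩
    by_cases hz' : ∃ x, T.emb x = z
    · obtain ⟨x, rfl⟩ := hz'
      obtain ⟨w, hw, ht⟩ := hx x t h
      exact ⟨some x, w, hw, Or.inl ⟨rfl, ht⟩⟩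
    by_cases ht' : ∃ x, T.emb x = t
    · obtain ⟨x, rfl⟩ := ht'
      obtain ⟨w, hw, hz⟩ := hx x z h.symm
      exact ⟨some x, w, hw, Or.inr ⟨rfl, hz⟩⟩
    have h1 := T.eq_or z
    have h2 := T.eq_or t
    have h3 := h.ne
    exfalso
    apply he
    rw [Sym2.eq_iff]
    grind
  other := ⟨T.r, T.adj_rp.symm, T.adj_qr.ne'⟩
  card_add := by
    have := T.ncard_edges
    have := T.card_vertices
    omega

end TriangleExpansion

/-! ### The induction hypothesis. -/

/-- A connected graph of minimum degree at least three that has a planar embedding, unique up to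
reflection, in which all triangles are faces. -/
structure UniquelyEmbedded {V : Type u} (G : SimpleGraph V) : Prop where
  connected : G.Connected
  exists_adj : ∀ v y z, ∃ w, G.Adj v w ∧ w ≠ y ∧ w ≠ z
  eulerBound : EulerBound G
  exists_planar : ∃ R : RotationSystem G, R.IsPlanar
  unique : ∀ R S : RotationSystem G, R.IsPlanar → S.IsPlanar → S = R ∨ S = R.mirror
  turnFace : ∀ R : RotationSystem G, R.IsPlanar → ∀ a b c, G.Adj a b → G.Adj b c → G.Adj c a →
    R.TurnFace a b c ∨ R.mirror.TurnFace a b c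

theorem RotationSystem.TurnFace.swap {V : Type u} {G : SimpleGraph V} {R : RotationSystem G}
    {a b c : V} (h : R.TurnFace a b c) : R.mirror.TurnFace b a c := by
  simp only [TurnFace, turn_mirror] at *
  tauto

theorem RotationSystem.TurnFace.swap' {V : Type u} {G : SimpleGraph V} {R : RotationSystem G}
    {a b c : V} (h : R.mirror.TurnFace a b c) : R.TurnFace b a c := by
  simpa [mirror_mirror] using h.swap

/-- Facts about a symmetric ternary predicate need to be checked for one order only. -/
theorem RotationSystem.turnFace_perm {V : Type u} {G : SimpleGraph V} {R : RotationSystem G}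
    {a b c : V} (h : R.TurnFace a b c ∨ R.mirror.TurnFace a b c) :
    (R.TurnFace b c a ∨ R.mirror.TurnFace b c a) ∧ (R.TurnFace c a b ∨ R.mirror.TurnFace c a b) ∧
    (R.TurnFace b a c ∨ R.mirror.TurnFace b a c) ∧ (R.TurnFace a c b ∨ R.mirror.TurnFace a c b) ∧
    (R.TurnFace c b a ∨ R.mirror.TurnFace c b a) := by
  simp only [TurnFace, turn_mirror] at *
  tauto

/-! ### Path reductions: a planar embedding is determined by the induced one. -/

namespace SubdividedChord

open RotationSystem

variable {V V' : Type u} {G : SimpleGraph V} {G' : SimpleGraph V'} {C : SubdividedChord G G'}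
  {R S : RotationSystem G} {R' : RotationSystem G'}

/-- `R` arises from `R'` by the insertion of the edge `ms` into the face `abs`. -/
structure Inserted (C : SubdividedChord G G') (R : RotationSystem G) (R' : RotationSystem G') :
    Prop where
  face : R'.TurnFace C.a C.b C.s
  turn : ∀ u w w', R'.Turn u w w' → ¬ (u = C.s ∧ w = C.b ∧ w' = C.a) →
    R.Turn (C.vert u) (C.tgt u w) (C.tgt u w')
  turn_m_a : R.Turn C.m (C.vert C.a) (C.vert C.s)
  turn_m_s : R.Turn C.m (C.vert C.s) (C.vert C.b)
  turn_m_b : R.Turn C.m (C.vert C.b) (C.vert C.a)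
  turn_s_b : R.Turn (C.vert C.s) (C.vert C.b) C.m
  turn_s_m : R.Turn (C.vert C.s) C.m (C.vert C.a)

/-- The conditions prescribe the successor of every neighbour at every vertex of `G`. -/
theorem Inserted.eq (hR : C.Inserted R R') (hS : C.Inserted S R') : S = R := by
  have key : ∀ v t, G.Adj v t → ∃ z, R.Turn v t z ∧ S.Turn v t z := by
    have old : ∀ u w, G'.Adj u w → ∃ z, R.Turn (C.vert u) (C.tgt u w) z ∧
        S.Turn (C.vert u) (C.tgt u w) z := by
      intro u w h
      obtain ⟨w', hw'⟩ := R'.exists_turn h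
      by_cases h' : u = C.s ∧ w = C.b ∧ w' = C.a
      · obtain ⟨rfl, rfl, rfl⟩ := h'
        rw [tgt_left_s]
        exact ⟨_, hR.turn_s_b, hS.turn_s_b⟩
      · exact ⟨_, hR.turn _ _ _ hw' h', hS.turn _ _ _ hw' h'⟩
    intro v t h
    rcases C.eq_or v with rfl | ⟨u, rfl⟩
    · rcases C.adj_m_iff.mp h with rfl | rfl | rfl
      · exact ⟨_, hR.turn_m_a, hS.turn_m_a⟩
      · exact ⟨_, hR.turn_m_b, hS.turn_m_b⟩
      · exact ⟨_, hR.turn_m_s, hS.turn_m_s⟩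
    · rcases C.eq_or t with rfl | ⟨w, rfl⟩
      · rcases C.adj_m.mp h.symm with rfl | rfl | rfl
        · simpa [tgt_ab] using old _ _ C.adj_ab
        · simpa [tgt_ba] using old _ _ C.adj_ab.symm
        · exact ⟨_, hR.turn_s_m, hS.turn_s_m⟩
      · obtain ⟨h1, h2⟩ := C.adj_iff.mp h
        simpa [C.tgt_of_ne h2] using old u w h1
  refine eq_of_turn fun v u w h => ?_
  obtain ⟨z, hz, hz'⟩ := key v u h.adj_left
  rwa [h.right_unique hz]


/-- The common analysis for a planar embedding of `G` whose reduction has the oriented face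
`abs`. -/
theorem inserted_of_turnFace [Finite V] [Finite V'] (hG : UniquelyEmbedded G') {x y : V'}
    (ha : ∀ w, G'.Adj C.a w ↔ w = C.b ∨ w = C.s ∨ w = x) (hxb : x ≠ C.b) (hxs : x ≠ C.s)
    (hb : ∀ w, G'.Adj C.b w ↔ w = C.a ∨ w = C.s ∨ w = y) (hya : y ≠ C.a) (hys : y ≠ C.s)
    (hR : R.IsPlanar) (hrel : C.edgeReduction.TurnRel R R') (hf : R'.TurnFace C.a C.b C.s) :
    C.Inserted R R' := by
  have hab := C.adj_ab.ne
  have hsa := C.s_ne_a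
  have hsb := C.s_ne_b
  have hv : ∀ {u w}, C.vert u = C.vert w ↔ u = w := C.vert_injective.eq_iff
  -- Of the ends of the deleted edge only `s` corresponds to a vertex of `G'`, so only a turn at `s`
  -- can be interrupted by `m`.
  have old : ∀ u w w', R'.Turn u w w' → R.Turn (C.vert u) (C.tgt u w) (C.tgt u w') ∨
      (u = C.s ∧ R.Turn (C.vert C.s) (C.vert w) C.m ∧ R.Turn (C.vert C.s) C.m (C.vert w')) := by
    intro u w w' h
    rcases hrel u w w' h with h' | ⟨z, hz, h1, h2⟩
    · exact Or.inl h'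
    · obtain ⟨rfl, rfl⟩ := C.mk_vert_eq hz
      have h1' : R.Turn (C.vert C.s) (C.tgt C.s w) C.m := h1
      have h2' : R.Turn (C.vert C.s) C.m (C.tgt C.s w') := h2
      rw [tgt_left_s] at h1' h2'
      exact Or.inr ⟨rfl, h1', h2'⟩
  have hbms : R.Turn (C.vert C.b) C.m (C.vert C.s) := by
    rcases old _ _ _ hf.1 with h | ⟨h, _⟩
    · rwa [tgt_ba, tgt_right_s] at h
    · exact absurd h.symm hsb
  have hasm : R.Turn (C.vert C.a) (C.vert C.s) C.m := by
    rcases old _ _ _ hf.2.2 with h | ⟨h, _⟩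
    · rwa [tgt_ab, tgt_right_s] at h
    · exact absurd h.symm hsa
  have hsides : ∀ h : G.Adj C.m (C.vert C.s),
      R.faceOf ⟨(C.m, C.vert C.s), h⟩ ≠ R.faceOf ⟨(C.vert C.s, C.m), h.symm⟩ := fun _ =>
    (C.edgeReduction.exists_isPlanar hG.eulerBound hG.connected hR).choose_spec.2.2
  have hm := R.turn_three (v := C.m) (x := C.vert C.a) (y := C.vert C.s) (z := C.vert C.b)
    (fun t ht => by have := C.adj_m_iff.mp ht; tauto) (C.adj_m.mpr (by simp))
    (C.adj_m.mpr (by simp)) (C.adj_m.mpr (by simp)) (by rw [ne_eq, hv]; exact hsa.symm)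
    (by rwa [ne_eq, hv]) (by rwa [ne_eq, hv])
  have hs : R.Turn (C.vert C.s) (C.vert C.b) (C.vert C.a) ∨
      (R.Turn (C.vert C.s) (C.vert C.b) C.m ∧ R.Turn (C.vert C.s) C.m (C.vert C.a)) := by
    rcases old _ _ _ hf.2.1 with h | ⟨_, h⟩
    · rw [tgt_left_s, tgt_left_s] at h
      exact Or.inl h
    · exact Or.inr h
  -- The rotation at `m` tells whether `ms` leaves `m` into the face `abs`, and `hs` tells whether
  -- it arrives at `s` from inside this face. If only one of the two holds, following the face
  -- boundaries leads from one side of `ms` to the other, contrary to `hsides`.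
  rcases hm with ⟨m1, m2, m3⟩ | ⟨m1, m2, m3⟩
  · rcases hs with s1 | ⟨s1, s2⟩
    · exact absurd (m1.faceOf_eq.symm.trans (hasm.faceOf_eq.symm.trans (s1.faceOf_eq.symm.trans
        (hbms.faceOf_eq.symm.trans m2.faceOf_eq.symm)))) (hsides _)
    · refine ⟨hf, ?_, m1, m2, m3, s1, s2⟩
      intro u w w' h hne
      rcases old u w w' h with h' | ⟨rfl, h1, h2⟩
      · exact h'
      · exact absurd ⟨rfl, hv.mp (h1.left_unique s1), hv.mp (h2.right_unique s2)⟩ hne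
  · exfalso
    rcases hs with s1 | ⟨s1, s2⟩
    · let D := C.slide ha hxb hxs
      have hDa : D.vert C.a = C.m := if_pos rfl
      have hDs : D.vert C.s = C.vert C.s := if_neg hsa
      have hDb : D.vert C.b = C.vert C.b := if_neg hab.symm
      obtain ⟨Q, hQ, hrelQ, -⟩ :=
        D.edgeReduction.exists_isPlanar hG.eulerBound hG.connected hR
      have oldQ : ∀ u w w', u ≠ C.s → Q.Turn u w w' →
          R.Turn (D.vert u) (D.tgt u w) (D.tgt u w') := by
        intro u w w' hu h
        rcases hrelQ u w w' h with h' | ⟨z, hz, h1, h2⟩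
        · exact h'
        · exact absurd (D.mk_vert_eq hz).1 hu
      rcases hG.turnFace Q hQ _ _ _ C.adj_ab ((hb C.s).mpr (by simp))
          ((ha C.s).mpr (by simp)).symm
        with h | h
      · have h1 := oldQ _ _ _ hsa.symm h.2.2
        have e1 : D.tgt C.a C.s = C.vert C.s := (D.tgt_right_s C.a).trans hDs
        have e2 : D.tgt C.a C.b = C.vert C.b := (D.tgt_of_ne fun h => by
          have h3 : C.b = x := Sym2.congr_right.mp h
          exact hxb h3.symm).trans hDb
        rw [e1, e2, hDa] at h1
        exact hab (hv.mp (m3.right_unique h1))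
      · have h1 := oldQ _ _ _ hsb.symm (turn_mirror.mp h.1)
        have e1 : D.tgt C.b C.s = C.vert C.s := (D.tgt_right_s C.b).trans hDs
        have e2 : D.tgt C.b C.a = C.m := (D.tgt_of_ne fun h => by
          rcases Sym2.eq_iff.mp h with ⟨h3, _⟩ | ⟨h3, _⟩
          · exact hab h3.symm
          · exact hxb h3.symm).trans hDa
        rw [e1, e2, hDb] at h1
        have hyb : y ≠ C.b := ((hb y).mpr (by simp)).ne'
        rcases eq_or_eq_of_turn_turn h1 hbms (z := C.vert y)
          (C.adj_iff.mpr ⟨(hb y).mpr (by simp), fun h => by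
            rcases Sym2.eq_iff.mp h with ⟨h3, _⟩ | ⟨_, h3⟩
            · exact hab h3.symm
            · exact hya h3⟩) with h | h
        · exact hys (hv.mp h)
        · exact C.vert_ne _ h
    · exact hsides _ (s2.faceOf_eq.trans (hasm.faceOf_eq.trans (m1.faceOf_eq.trans
        (hbms.faceOf_eq.trans s1.faceOf_eq))))

theorem exists_inserted [Finite V] [Finite V'] (hG : UniquelyEmbedded G') {x y : V'}
    (ha : ∀ w, G'.Adj C.a w ↔ w = C.b ∨ w = C.s ∨ w = x) (hxb : x ≠ C.b) (hxs : x ≠ C.s)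
    (hb : ∀ w, G'.Adj C.b w ↔ w = C.a ∨ w = C.s ∨ w = y) (hya : y ≠ C.a) (hys : y ≠ C.s)
    (hR : R.IsPlanar) : ∃ R' : RotationSystem G', R'.IsPlanar ∧
      (C.Inserted R R' ∨ C.Inserted R.mirror R'.mirror) := by
  obtain ⟨R', hR', hrel, -⟩ :=
    C.edgeReduction.exists_isPlanar hG.eulerBound hG.connected hR
  refine ⟨R', hR', ?_⟩
  rcases hG.turnFace R' hR' _ _ _ C.adj_ab ((hb C.s).mpr (by simp))
    ((ha C.s).mpr (by simp)).symm with h | h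
  · exact Or.inl (inserted_of_turnFace hG ha hxb hxs hb hya hys hR hrel h)
  · exact Or.inr (inserted_of_turnFace hG ha hxb hxs hb hya hys hR.mirror hrel.mirror h)

/-- Minimum degree three allows the closed walk `abs` to be a face in one direction only, so both
embeddings are compared with `R'` in the same orientation. -/
theorem eq_of_inserted [Finite V] [Finite V'] (hG : UniquelyEmbedded G')
    (hR : C.Inserted R R' ∨ C.Inserted R.mirror R'.mirror)
    (hS : C.Inserted S R' ∨ C.Inserted S.mirror R'.mirror) : S = R := by
  have key : R'.TurnFace C.a C.b C.s → ¬ R'.mirror.TurnFace C.a C.b C.s := by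
    intro h h'
    obtain ⟨w, hw, h1, h2⟩ := hG.exists_adj C.a C.b C.s
    rcases eq_or_eq_of_turn_turn h.2.2 (turn_mirror.mp h'.2.2) hw with h3 | h3
    · exact h2 h3
    · exact h1 h3
  rcases hR with hR | hR <;> rcases hS with hS | hS
  · exact hR.eq hS
  · exact absurd hS.face (key hR.face)
  · exact absurd hR.face (key hS.face)
  · rw [← S.mirror_mirror, hR.eq hS, mirror_mirror]

/-- Since `a` and `b` are not adjacent in `G`, the triangles through `m` are `msa` and `mbs`, the
two halves of the split face. All other triangles come from `G'` and avoid the edge `ab`, so the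
insertion does not affect them. -/
theorem Inserted.turnFace [Finite V] [Finite V'] (hG : UniquelyEmbedded G')
    (hR' : R'.IsPlanar) (hR : C.Inserted R R') {z t v : V} (hzt : G.Adj z t) (htv : G.Adj t v)
    (hvz : G.Adj v z) : R.TurnFace z t v ∨ R.mirror.TurnFace z t v := by
  have old : ∀ u w t, G.Adj (C.vert u) (C.vert w) → G.Adj (C.vert w) (C.vert t) →
      G.Adj (C.vert t) (C.vert u) → R'.TurnFace u w t →
      R.TurnFace (C.vert u) (C.vert w) (C.vert t) := by
    intro u w t h1 h2 h3 h
    have aux : ∀ u w t, G.Adj (C.vert u) (C.vert w) → G.Adj (C.vert u) (C.vert t) →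
        G.Adj (C.vert w) (C.vert t) → R'.Turn u w t →
        R.Turn (C.vert u) (C.vert w) (C.vert t) := by
      intro u w t h1 h2 h3 h
      have := hR.turn u w t h (by
        rintro ⟨rfl, rfl, rfl⟩
        exact (C.adj_iff.mp h3).2 Sym2.eq_swap)
      rwa [C.tgt_of_ne (C.adj_iff.mp h1).2, C.tgt_of_ne (C.adj_iff.mp h2).2] at this
    exact ⟨aux _ _ _ h1.symm h2 h3.symm h.1, aux _ _ _ h2.symm h3 h1.symm h.2.1,
      aux _ _ _ h3.symm h1 h2.symm h.2.2⟩
  have hf1 : R.TurnFace C.m (C.vert C.s) (C.vert C.a) := by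
    refine ⟨hR.turn_s_m, ?_, hR.turn_m_a⟩
    have := hR.turn _ _ _ hR.face.2.2 (by simp [C.s_ne_a.symm])
    rwa [tgt_right_s, tgt_ab] at this
  have hf2 : R.TurnFace C.m (C.vert C.b) (C.vert C.s) := by
    refine ⟨?_, hR.turn_s_b, hR.turn_m_s⟩
    have := hR.turn _ _ _ hR.face.1 (by simp [C.s_ne_b.symm])
    rwa [tgt_right_s, tgt_ba] at this
  have hm : ∀ t v, G.Adj C.m t → G.Adj t v → G.Adj C.m v →
      R.TurnFace C.m t v ∨ R.mirror.TurnFace C.m t v := by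
    intro t v ht htv hv
    have hnab : ¬ G.Adj (C.vert C.a) (C.vert C.b) := fun h => (C.adj_iff.mp h).2 rfl
    rcases C.adj_m_iff.mp ht with rfl | rfl | rfl <;>
      rcases C.adj_m_iff.mp hv with rfl | rfl | rfl
    · exact absurd htv G.irrefl
    · exact absurd htv hnab
    · exact (turnFace_perm (Or.inl hf1)).2.2.2.1
    · exact absurd htv.symm hnab
    · exact absurd htv G.irrefl
    · exact Or.inl hf2
    · exact Or.inl hf1
    · exact (turnFace_perm (Or.inl hf2)).2.2.2.1
    · exact absurd htv G.irrefl
  rcases C.eq_or z with rfl | ⟨z, rfl⟩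
  · exact hm _ _ hzt htv hvz.symm
  rcases C.eq_or t with rfl | ⟨t, rfl⟩
  · exact (turnFace_perm (hm _ _ htv hvz hzt.symm)).2.1
  rcases C.eq_or v with rfl | ⟨v, rfl⟩
  · exact (turnFace_perm (hm _ _ hvz hzt htv.symm)).1
  rcases hG.turnFace R' hR' _ _ _ (C.adj_iff.mp hzt).1 (C.adj_iff.mp htv).1
    (C.adj_iff.mp hvz).1 with h | h
  · exact Or.inl (old _ _ _ hzt htv hvz h)
  · exact Or.inr (old _ _ _ hzt.symm hvz.symm htv.symm h.swap').swap

end SubdividedChord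

/-! ### Construction of rotation systems from successor relations. -/

namespace RotationSystem

variable {V : Type u} {G : SimpleGraph V} {R : RotationSystem G}

theorem Turn.rot_eq {v u w : V} (h : R.Turn v u w) :
    R.rot ⟨(v, u), h.adj_left⟩ = ⟨(v, w), h.adj_right⟩ := h.2.2

/-- A rotation system may be given by the relation "`u` is followed by `w` around `v`". -/
theorem exists_of_relation [Finite V] {T : V → V → V → Prop}
    (hadj : ∀ v u w, T v u w → G.Adj v w)
    (hex : ∀ v u, G.Adj v u → ∃ w, T v u w) (hright : ∀ v u w w', T v u w → T v u w' → w = w')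
    (hleft : ∀ v u u' w, T v u w → T v u' w → u = u')
    (hcyc : ∀ v u w, G.Adj v u → G.Adj v w → Relation.ReflTransGen (T v) u w) :
    ∃ R : RotationSystem G, ∀ v u w, G.Adj v u → T v u w → R.Turn v u w := by
  choose! nx hnx using hex
  let f : G.Dart → G.Dart := fun d =>
    ⟨(d.fst, nx d.fst d.snd), hadj _ _ _ (hnx _ _ d.adj)⟩
  have hf : Function.Injective f := by
    rintro ⟨⟨v, u⟩, h⟩ ⟨⟨v', u'⟩, h'⟩ he
    obtain rfl : v = v' := congrArg (fun d : G.Dart => d.fst) he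
    have h2 : nx v u = nx v u' := congrArg (fun d : G.Dart => d.snd) he
    have h3 := hnx v u h
    rw [h2] at h3
    obtain rfl := hleft _ _ _ _ h3 (hnx v u' h')
    rfl
  let σ : Equiv.Perm G.Dart := Equiv.ofBijective f (Finite.injective_iff_bijective.mp hf)
  have hσ : ∀ v u w (h : G.Adj v u) (ht : T v u w), σ ⟨(v, u), h⟩ = ⟨(v, w), hadj _ _ _ ht⟩ := by
    intro v u w h ht
    exact SimpleGraph.Dart.ext _ _ (Prod.ext rfl (hright _ _ _ _ (hnx v u h) ht))
  refine ⟨⟨σ, fun d => rfl, ?_⟩, fun v u w h ht => ⟨h, _, hσ v u w h ht⟩⟩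
  rintro ⟨⟨v, u⟩, h⟩ ⟨⟨v', w⟩, h'⟩ he
  obtain rfl : v = v' := he
  induction hcyc v u w h h' with
  | refl => exact Equiv.Perm.SameCycle.refl _ _
  | tail h1 h2 ih =>
    rename_i b c
    have hb : G.Adj v b := by
      rcases Relation.ReflTransGen.cases_tail h1 with rfl | ⟨_, _, h3⟩
      · exact h
      · exact hadj _ _ _ h3
    rw [← hσ v b c hb h2]
    exact Equiv.Perm.sameCycle_apply_right.mpr (ih hb)

theorem reflTransGen_turn [Finite V] (R : RotationSystem G) {v u w : V} (hu : G.Adj v u)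
    (hw : G.Adj v w) : Relation.ReflTransGen (R.Turn v) u w :=
  R.mem_of_turn_closed {w | Relation.ReflTransGen (R.Turn v) u w} hu Relation.ReflTransGen.refl
    (fun _ _ h h' => Relation.ReflTransGen.tail h h') hw

theorem ncard_range_le_faceCount [Finite V] (R : RotationSystem G) {X : Type*} {f : G.Dart → X}
    (hf : ∀ v t z (h : R.Turn v t z), f ⟨(v, z), h.adj_right⟩ = f ⟨(t, v), h.adj_left.symm⟩) :
    (Set.range f).ncard ≤ R.faceCount := by
  refine R.card_le_faceCount (Set.rangeFactorization f) (fun d => Subtype.ext ?_)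
    Set.rangeFactorization_surjective
  obtain ⟨⟨v, u⟩, h⟩ := d
  obtain ⟨w, hw⟩ := R.exists_turn h
  change f (R.rot ⟨(v, u), h⟩) = _
  rw [hw.rot_eq]
  exact hf _ _ _ hw

end RotationSystem

theorem EdgeReduction.reachable {V V' : Type u} {G : SimpleGraph V} {G' : SimpleGraph V'}
    (E : EdgeReduction G G') {u w : V'} (h : G'.Reachable u w) :
    G.Reachable (E.vert u) (E.vert w) := by
  obtain ⟨p⟩ := h
  induction p with
  | nil => exact SimpleGraph.Reachable.refl _
  | cons h _ ih =>
    refine SimpleGraph.Reachable.trans ?_ ih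
    have h1 := (E.adj_tgt h).reachable
    rcases E.link h with ⟨h2, _⟩ | ⟨h2, _⟩
    · rwa [h2] at h1
    · have h3 := (E.adj_tgt h.symm).reachable
      rw [← h2] at h3
      exact h1.trans h3.symm

theorem EdgeReduction.connected {V V' : Type u} {G : SimpleGraph V} {G' : SimpleGraph V'}
    (E : EdgeReduction G G') (h : G'.Connected)
    (hE : ∀ z, ∃ u, G.Reachable z (E.vert u)) : G.Connected := by
  obtain ⟨u⟩ := h.nonempty
  refine SimpleGraph.connected_iff_exists_forall_reachable _ |>.mpr ⟨E.vert u, fun z => ?_⟩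
  obtain ⟨w, hw⟩ := hE z
  exact (E.reachable (h.preconnected u w)).trans hw.symm

/-! ### Path reductions: insertion of the edge, and the induction step. -/

namespace SubdividedChord

open RotationSystem

variable {V V' : Type u} {G : SimpleGraph V} {G' : SimpleGraph V'} {C : SubdividedChord G G'}
  {R : RotationSystem G} {R' : RotationSystem G'}

/-- The relation `T` lists all turns of the new rotation system: those of `R'` except the turn from
`b` to `a` at `s`, the three turns at `m`, and the two turns through `m` that replace the exception.
-/
theorem exists_rotation_inserted [Finite V] [Finite V'] (hf : R'.TurnFace C.a C.b C.s) :
    ∃ R : RotationSystem G, C.Inserted R R' := by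
  have hab := C.adj_ab.ne
  have hsa := C.s_ne_a
  have hsb := C.s_ne_b
  have hv : ∀ {u w}, C.vert u = C.vert w ↔ u = w := C.vert_injective.eq_iff
  have hvm := C.vert_ne
  let T : V → V → V → Prop := fun v t z =>
    (∃ u w w', R'.Turn u w w' ∧ ¬ (u = C.s ∧ w = C.b ∧ w' = C.a) ∧ v = C.vert u ∧ t = C.tgt u w ∧
      z = C.tgt u w') ∨
    (v = C.m ∧ ((t = C.vert C.a ∧ z = C.vert C.s) ∨ (t = C.vert C.s ∧ z = C.vert C.b) ∨
      (t = C.vert C.b ∧ z = C.vert C.a))) ∨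
    (v = C.vert C.s ∧ ((t = C.vert C.b ∧ z = C.m) ∨ (t = C.m ∧ z = C.vert C.a)))
  have htinj : ∀ {u w w'}, G'.Adj u w → G'.Adj u w' → C.tgt u w = C.tgt u w' → w = w' :=
    C.edgeReduction.tgt_inj
  have hT1 : ∀ u w w', R'.Turn u w w' → ¬ (u = C.s ∧ w = C.b ∧ w' = C.a) →
      T (C.vert u) (C.tgt u w) (C.tgt u w') :=
    fun u w w' h h' => Or.inl ⟨u, w, w', h, h', rfl, rfl, rfl⟩
  have hTm : ∀ t z, T C.m t z ↔ ((t = C.vert C.a ∧ z = C.vert C.s) ∨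
      (t = C.vert C.s ∧ z = C.vert C.b) ∨ (t = C.vert C.b ∧ z = C.vert C.a)) := by
    intro t z
    simp only [T, (hvm _).symm, false_and, and_false, exists_false, false_or, true_and, or_false]
  have hTv : ∀ u t z, T (C.vert u) t z ↔
      ((∃ w w', R'.Turn u w w' ∧ ¬ (u = C.s ∧ w = C.b ∧ w' = C.a) ∧ t = C.tgt u w ∧
        z = C.tgt u w') ∨
      (u = C.s ∧ ((t = C.vert C.b ∧ z = C.m) ∨ (t = C.m ∧ z = C.vert C.a)))) := by
    intro u t z
    simp only [T, hvm, false_and, false_or, hv]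
    constructor
    · rintro (⟨u', w, w', h1, h2, rfl, h3⟩ | h)
      · exact Or.inl ⟨w, w', h1, h2, h3⟩
      · exact Or.inr h
    · rintro (⟨w, w', h1, h2, h3⟩ | h)
      · exact Or.inl ⟨u, w, w', h1, h2, rfl, h3⟩
      · exact Or.inr h
  have hexv : ∀ u t, G.Adj (C.vert u) t → (∃ w, G'.Adj u w ∧ t = C.tgt u w) ∨
      (u = C.s ∧ t = C.m) := by
    intro u t h
    by_cases h' : s(C.vert u, t) = s(C.m, C.vert C.s)
    · exact Or.inr (C.mk_vert_eq h')
    · obtain ⟨w, hw, hw'⟩ := C.edgeReduction.exists_tgt h h'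
      exact Or.inl ⟨w, hw, hw'.symm⟩
  have hsm : T (C.vert C.s) (C.vert C.b) C.m ∧ T (C.vert C.s) C.m (C.vert C.a) := by
    simp [hTv]
  suffices h : ∃ R : RotationSystem G, ∀ v u w, G.Adj v u → T v u w → R.Turn v u w by
    obtain ⟨R, hR⟩ := h
    refine ⟨R, hf, fun u w w' h h' => hR _ _ _ (C.adj_tgt h.adj_left) (hT1 u w w' h h'), ?_, ?_,
      ?_, ?_, ?_⟩
    · exact hR _ _ _ (C.adj_m.mpr (by simp)) ((hTm _ _).mpr (by simp))
    · exact hR _ _ _ (C.adj_m.mpr (by simp)) ((hTm _ _).mpr (by simp))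
    · exact hR _ _ _ (C.adj_m.mpr (by simp)) ((hTm _ _).mpr (by simp))
    · refine hR _ _ _ ?_ hsm.1
      simpa [tgt_left_s] using C.adj_tgt hf.2.1.adj_left
    · exact hR _ _ _ (C.adj_m.mpr (by simp)).symm hsm.2
  refine exists_of_relation ?_ ?_ ?_ ?_ ?_
  · rintro v t z h
    rcases C.eq_or v with rfl | ⟨u, rfl⟩
    · rcases (hTm _ _).mp h with ⟨rfl, rfl⟩ | ⟨rfl, rfl⟩ | ⟨rfl, rfl⟩ <;> simp [C.adj_m]
    · rcases (hTv _ _ _).mp h with ⟨w, w', h1, -, rfl, rfl⟩ | ⟨rfl, ⟨rfl, rfl⟩ | ⟨rfl, rfl⟩⟩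
      · exact C.adj_tgt h1.adj_right
      · exact (C.adj_m.mpr (by simp)).symm
      · simpa [tgt_left_s] using C.adj_tgt hf.2.1.adj_right
  · rintro v t h
    rcases C.eq_or v with rfl | ⟨u, rfl⟩
    · rcases C.adj_m_iff.mp h with rfl | rfl | rfl <;> simp [hTm, hv, hab, hsa, hsb, hsa.symm,
        hsb.symm, hab.symm]
    · rcases hexv u t h with ⟨w, hw, rfl⟩ | ⟨rfl, rfl⟩
      · obtain ⟨w', hw'⟩ := R'.exists_turn hw
        by_cases h' : u = C.s ∧ w = C.b ∧ w' = C.a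
        · obtain ⟨rfl, rfl, rfl⟩ := h'
          rw [tgt_left_s]
          exact ⟨_, hsm.1⟩
        · exact ⟨_, hT1 _ _ _ hw' h'⟩
      · exact ⟨_, hsm.2⟩
  · rintro v t z z' h h'
    rcases C.eq_or v with rfl | ⟨u, rfl⟩
    · rw [hTm] at h h'
      have := @hv C.a C.b
      have := @hv C.s C.b
      have := @hv C.s C.a
      grind
    · rcases (hTv _ _ _).mp h with ⟨w1, w1', h1, h2, h3, h4⟩ | ⟨rfl, ⟨h3, h4⟩ | ⟨h3, h4⟩⟩ <;>
        rcases (hTv _ _ _).mp h' with ⟨w5, w5', h5, h6, h7, h8⟩ | ⟨h6, ⟨h7, h8⟩ | ⟨h7, h8⟩⟩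
      · obtain rfl := htinj h1.adj_left h5.adj_left (h3.symm.trans h7)
        rw [h4, h8, h1.right_unique h5]
      · subst h6
        rw [tgt_left_s] at h3
        obtain rfl := hv.mp (h3.symm.trans h7)
        exact absurd ⟨rfl, rfl, h1.right_unique hf.2.1⟩ h2
      · subst h6
        rw [tgt_left_s] at h3
        exact absurd (h3.symm.trans h7) (hvm _)
      · rw [tgt_left_s] at h7
        obtain rfl := hv.mp (h3.symm.trans h7)
        exact absurd ⟨rfl, rfl, h5.right_unique hf.2.1⟩ h6
      · rw [h4, h8]
      · exact absurd (h3.symm.trans h7) (hvm _)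
      · rw [tgt_left_s] at h7
        exact absurd (h7.symm.trans h3) (hvm _)
      · exact absurd (h7.symm.trans h3) (hvm _)
      · rw [h4, h8]
  · rintro v t t' z h h'
    rcases C.eq_or v with rfl | ⟨u, rfl⟩
    · rw [hTm] at h h'
      have := @hv C.a C.b
      have := @hv C.s C.b
      have := @hv C.s C.a
      grind
    · rcases (hTv _ _ _).mp h with ⟨w1, w1', h1, h2, h3, h4⟩ | ⟨rfl, ⟨h3, h4⟩ | ⟨h3, h4⟩⟩ <;>
        rcases (hTv _ _ _).mp h' with ⟨w5, w5', h5, h6, h7, h8⟩ | ⟨h6, ⟨h7, h8⟩ | ⟨h7, h8⟩⟩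
      · obtain rfl := htinj h1.adj_right h5.adj_right (h4.symm.trans h8)
        rw [h3, h7, h1.left_unique h5]
      · subst h6
        rw [tgt_left_s] at h4
        exact absurd (h4.symm.trans h8) (hvm _)
      · subst h6
        rw [tgt_left_s] at h4
        obtain rfl := hv.mp (h4.symm.trans h8)
        exact absurd ⟨rfl, h1.left_unique hf.2.1, rfl⟩ h2
      · rw [tgt_left_s] at h8
        exact absurd (h8.symm.trans h4) (hvm _)
      · rw [h3, h7]
      · exact absurd (h8.symm.trans h4) (hvm _)
      · rw [tgt_left_s] at h8
        obtain rfl := hv.mp (h4.symm.trans h8)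
        exact absurd ⟨rfl, h5.left_unique hf.2.1, rfl⟩ h6
      · exact absurd (h4.symm.trans h8) (hvm _)
      · rw [h3, h7]
  · have old : ∀ u w w', G'.Adj u w → G'.Adj u w' →
        Relation.ReflTransGen (T (C.vert u)) (C.tgt u w) (C.tgt u w') := by
      intro u w w' hw hw'
      induction R'.reflTransGen_turn hw hw' with
      | refl => exact Relation.ReflTransGen.refl
      | tail h1 h2 ih =>
        rename_i y z
        refine (ih h2.adj_left).trans ?_
        by_cases h' : u = C.s ∧ y = C.b ∧ z = C.a
        · obtain ⟨rfl, rfl, rfl⟩ := h'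
          rw [tgt_left_s, tgt_left_s]
          exact (Relation.ReflTransGen.single hsm.1).tail hsm.2
        · exact Relation.ReflTransGen.single (hT1 _ _ _ h2 h')
    rintro v t z h h'
    rcases C.eq_or v with rfl | ⟨u, rfl⟩
    · have h1 : T C.m (C.vert C.a) (C.vert C.s) := (hTm _ _).mpr (by simp)
      have h2 : T C.m (C.vert C.s) (C.vert C.b) := (hTm _ _).mpr (by simp)
      have h3 : T C.m (C.vert C.b) (C.vert C.a) := (hTm _ _).mpr (by simp)
      have h1' := Relation.ReflTransGen.single h1
      have h2' := Relation.ReflTransGen.single h2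
      have h3' := Relation.ReflTransGen.single h3
      rcases C.adj_m_iff.mp h with rfl | rfl | rfl <;>
        rcases C.adj_m_iff.mp h' with rfl | rfl | rfl
      exacts [.refl, h1'.trans h2', h1', h3', .refl, h3'.trans h1', h2'.trans h3', h2', .refl]
    · have hb := hf.2.1.adj_left
      have ha := hf.2.1.adj_right
      rcases hexv u t h with ⟨w, hw, rfl⟩ | ⟨rfl, rfl⟩ <;>
        rcases hexv _ z h' with ⟨w', hw', rfl⟩ | ⟨hu, rfl⟩
      · exact old _ _ _ hw hw'
      · subst hu
        have := old _ _ _ hw hb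
        rw [C.tgt_left_s C.b] at this
        exact this.tail hsm.1
      · have := old _ _ _ ha hw'
        rw [C.tgt_left_s C.a] at this
        exact this.head hsm.2
      · exact .refl

/-- The darts are labelled with the faces of `R'`, and the new face `bsm` receives the label `none`.
The darts `ma` and `ms` take over the faces of `ba` and `ab`. As all these labels occur, there is at
least one additional face. -/
theorem Inserted.faceCount_lt [Finite V] [Finite V'] (hR : C.Inserted R R') :
    R'.faceCount + 1 ≤ R.faceCount := by
  classical
  let E := C.edgeReduction
  have hvm := C.vert_ne
  have hv : ∀ {u w}, C.vert u = C.vert w ↔ u = w := C.vert_injective.eq_iff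
  let bs : G'.Dart := ⟨(C.b, C.s), hR.face.1.adj_right⟩
  let f : G.Dart → Option (Set G'.Dart) := Function.extend E.dart
    (fun d => if d = bs then none else some (R'.faceOf d))
    (fun d => if d.fst = C.m ∧ d.snd = C.vert C.a then some (R'.faceOf ⟨(C.b, C.a), C.adj_ab.symm⟩)
      else if d.fst = C.m ∧ d.snd = C.vert C.s then some (R'.faceOf ⟨(C.a, C.b), C.adj_ab⟩)
      else none)
  have f_dart : ∀ {u w} (h : G'.Adj u w), ¬ (u = C.b ∧ w = C.s) →
      f ⟨(C.vert u, C.tgt u w), C.adj_tgt h⟩ = some (R'.faceOf ⟨(u, w), h⟩) := by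
    intro u w h hne
    refine (E.dart_injective.extend_apply _ _ ⟨(u, w), h⟩).trans (if_neg ?_)
    rintro h'
    exact hne ⟨congrArg (fun d : G'.Dart => d.fst) h', congrArg (fun d : G'.Dart => d.snd) h'⟩
  have f_bs : f ⟨(C.vert C.b, C.tgt C.b C.s), C.adj_tgt hR.face.1.adj_right⟩ = none :=
    (E.dart_injective.extend_apply _ _ bs).trans (if_pos rfl)
  have f_m : ∀ t (h : G.Adj C.m t), f ⟨(C.m, t), h⟩ = if t = C.vert C.a then
      some (R'.faceOf ⟨(C.b, C.a), C.adj_ab.symm⟩) else if t = C.vert C.s then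
      some (R'.faceOf ⟨(C.a, C.b), C.adj_ab⟩) else none := by
    intro t h
    refine (Function.extend_apply' _ _ _ ?_).trans (by simp)
    rintro ⟨d, hd⟩
    exact hvm _ (congrArg (fun d : G.Dart => d.fst) hd)
  have f_sm : ∀ (h : G.Adj (C.vert C.s) C.m), f ⟨(C.vert C.s, C.m), h⟩ = none := by
    intro h
    refine (Function.extend_apply' _ _ _ ?_).trans (by simp [hvm])
    rintro ⟨d, hd⟩
    have h1 : C.vert d.fst = C.vert C.s := congrArg (fun d : G.Dart => d.fst) hd
    have h2 : C.tgt d.fst d.snd = C.m := congrArg (fun d : G.Dart => d.snd) hd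
    rw [hv.mp h1, tgt_left_s] at h2
    exact hvm _ h2
  have hcount := R.ncard_range_le_faceCount (f := f) ?_
  · refine le_trans ?_ hcount
    have hsub : insert none (some '' Set.range R'.faceOf) ⊆ Set.range f := by
      rintro o (rfl | ⟨_, ⟨d, rfl⟩, rfl⟩)
      · exact ⟨_, f_bs⟩
      · by_cases hd : d = bs
        · rw [hd, hR.face.1.faceOf_eq.symm]
          exact ⟨_, f_dart C.adj_ab (by simp [C.adj_ab.ne])⟩
        · refine ⟨_, f_dart d.adj ?_⟩
          rintro ⟨h1, h2⟩
          exact hd (SimpleGraph.Dart.ext _ _ (Prod.ext h1 h2))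
    have h1 := Set.ncard_le_ncard hsub (Set.toFinite _)
    rw [Set.ncard_insert_of_notMem (by simp) (Set.toFinite _),
      Set.ncard_image_of_injective _ (Option.some_injective _)] at h1
    exact h1
  · have hab := C.adj_ab.ne
    have hsa := C.s_ne_a
    have hsb := C.s_ne_b
    have key : ∀ v t (h : G.Adj v t), ∃ z, ∃ h' : R.Turn v t z,
        f ⟨(v, z), h'.adj_right⟩ = f ⟨(t, v), h.symm⟩ := by
      have f_sb := f_dart hR.face.1.adj_right.symm (by simp [hsb])
      have f_as := f_dart hR.face.2.2.adj_left (by simp [hab])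
      have f_sa := f_dart hR.face.2.2.adj_left.symm (by simp [hsb])
      have f_ab := f_dart C.adj_ab (by simp [hab])
      have f_ba := f_dart C.adj_ab.symm (by simp [hsa.symm])
      have f_sym : ∀ u w (h : G'.Adj u w), s(u, w) ≠ s(C.a, C.b) → ¬ (u = C.s ∧ w = C.b) →
          f ⟨(C.tgt u w, C.vert u), (C.adj_tgt h).symm⟩ = some (R'.faceOf ⟨(w, u), h.symm⟩) := by
        intro u w h h1 h2
        have h3 := f_dart h.symm (by tauto)
        rw [← h3]
        congr 1
        refine SimpleGraph.Dart.ext _ _ (Prod.ext (C.tgt_of_ne h1) ?_)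
        exact (C.tgt_of_ne fun h4 => h1 (Sym2.eq_swap.trans h4)).symm
      have old : ∀ u w (h : G'.Adj u w), ∃ z, ∃ h' : R.Turn (C.vert u) (C.tgt u w) z,
          f ⟨(C.vert u, z), h'.adj_right⟩ = f ⟨(C.tgt u w, C.vert u), (C.adj_tgt h).symm⟩ := by
        intro u w h
        by_cases h1 : u = C.s ∧ w = C.b
        · obtain ⟨rfl, rfl⟩ := h1
          have := hR.turn_s_b
          rw [← C.tgt_left_s C.b] at this
          refine ⟨_, this, (f_sm _).trans (Eq.symm ?_)⟩
          rw [← f_bs]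
          congr 1
          simp [tgt_left_s, tgt_right_s]
        · obtain ⟨w', hw'⟩ := R'.exists_turn h
          refine ⟨_, hR.turn u w w' hw' (by tauto), ?_⟩
          by_cases h2 : u = C.b ∧ w' = C.s
          · obtain ⟨rfl, rfl⟩ := h2
            obtain rfl := hw'.left_unique hR.face.1
            refine f_bs.trans (Eq.symm ?_)
            have := f_m (C.vert C.b) (C.adj_m.mpr (by simp))
            rw [if_neg (by rwa [hv, eq_comm]), if_neg (by rwa [hv, eq_comm])] at this
            rw [← this]
            congr 1
            simp [tgt_ba]
          rw [f_dart hw'.adj_right h2, ← hw'.faceOf_eq]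
          by_cases h3 : s(u, w) = s(C.a, C.b)
          · rcases Sym2.eq_iff.mp h3 with ⟨rfl, rfl⟩ | ⟨rfl, rfl⟩
            · have := f_m (C.vert C.a) (C.adj_m.mpr (by simp))
              rw [if_pos rfl] at this
              rw [← this]
              congr 1
              simp [tgt_ab]
            · exact absurd ⟨rfl, hw'.right_unique hR.face.1⟩ h2
          · exact (f_sym u w h h3 h1).symm
      intro v t h
      rcases C.eq_or v with rfl | ⟨u, rfl⟩
      · rcases C.adj_m_iff.mp h with rfl | rfl | rfl
        · refine ⟨_, hR.turn_m_a, ?_⟩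
          rw [f_m, if_neg (by rwa [hv]), if_pos rfl, ← f_ab]
          congr 1
          simp [tgt_ab]
        · refine ⟨_, hR.turn_m_b, ?_⟩
          rw [f_m, if_pos rfl, ← f_ba]
          congr 1
          simp [tgt_ba]
        · refine ⟨_, hR.turn_m_s, ?_⟩
          rw [f_m, if_neg (by rw [hv]; exact hab.symm), if_neg (by rw [hv]; exact hsb.symm), f_sm]
      · by_cases h' : s(C.vert u, t) = s(C.m, C.vert C.s)
        · obtain ⟨rfl, rfl⟩ := C.mk_vert_eq h'
          refine ⟨_, hR.turn_s_m, ?_⟩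
          rw [f_m, if_neg (by rwa [hv]), if_pos rfl, hR.face.2.2.faceOf_eq.symm, ← f_sa]
          congr 1
          simp [tgt_left_s]
        · obtain ⟨w, hw, rfl⟩ := C.edgeReduction.exists_tgt h h'
          exact old u w hw
    intro v t z h
    obtain ⟨z', hz', he⟩ := key v t h.adj_left
    obtain rfl := h.right_unique hz'
    exact he

/-- For existence, the additional face and the Euler bound force equality in Euler's formula. For
uniqueness, both embeddings are recovered from induced embeddings that are equal or mirror images.
-/
theorem uniquelyEmbedded [Finite V] [Finite V'] (C : SubdividedChord G G')
    (hG : UniquelyEmbedded G') {x y : V'}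
    (ha : ∀ w, G'.Adj C.a w ↔ w = C.b ∨ w = C.s ∨ w = x) (hxb : x ≠ C.b) (hxs : x ≠ C.s)
    (hb : ∀ w, G'.Adj C.b w ↔ w = C.a ∨ w = C.s ∨ w = y) (hya : y ≠ C.a) (hys : y ≠ C.s) :
    UniquelyEmbedded G where
  connected := C.edgeReduction.connected hG.connected fun z => by
    rcases C.eq_or z with rfl | ⟨u, rfl⟩
    · exact ⟨C.a, (C.adj_m.mpr (by simp)).reachable⟩
    · exact ⟨u, SimpleGraph.Reachable.refl _⟩
  exists_adj := by
    have hv : ∀ {u w}, C.vert u = C.vert w ↔ u = w := C.vert_injective.eq_iff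
    intro v z t
    rcases C.eq_or v with rfl | ⟨u, rfl⟩
    · have h1 := C.adj_m_iff (z := C.vert C.a)
      have h2 := C.adj_m_iff (z := C.vert C.b)
      have h3 := C.adj_m_iff (z := C.vert C.s)
      have := @hv C.a C.b
      have := @hv C.s C.b
      have := @hv C.s C.a
      have := C.s_ne_a
      have := C.s_ne_b
      have := C.adj_ab.ne
      by_contra! hcon
      have := or_iff_not_imp_left.mpr (hcon _ (h1.mpr (by simp)))
      have := or_iff_not_imp_left.mpr (hcon _ (h2.mpr (by simp)))
      have := or_iff_not_imp_left.mpr (hcon _ (h3.mpr (by simp)))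
      grind
    · by_contra! hcon
      have hE : ∀ {w w'}, G'.Adj u w → G'.Adj u w' → C.tgt u w = C.tgt u w' → w = w' :=
        C.edgeReduction.tgt_inj
      -- A vertex of `G` begins the path of at most one edge at `u`, so two forbidden vertices of
      -- `G` forbid at most two neighbours in `G'`.
      have key : ∀ t : V, ∃ w, ∀ w', G'.Adj u w' → C.tgt u w' = t → w' = w := by
        intro t
        by_cases h : ∃ w, G'.Adj u w ∧ C.tgt u w = t
        · obtain ⟨w, hw, hw'⟩ := h
          exact ⟨w, fun w' h1 h2 => hE h1 hw (h2.trans hw'.symm)⟩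
        · exact ⟨u, fun w' h1 h2 => absurd ⟨w', h1, h2⟩ h⟩
      obtain ⟨z', hz'⟩ := key z
      obtain ⟨t', ht'⟩ := key t
      obtain ⟨w, hw, h1, h2⟩ := hG.exists_adj u z' t'
      have h3 := hcon _ (C.adj_tgt hw)
      by_cases h4 : C.tgt u w = z
      · exact h1 (hz' w hw h4)
      · exact h2 (ht' w hw (h3 h4))
  eulerBound := C.edgeReduction.eulerBound hG.eulerBound
  exists_planar := by
    have hc : G.Connected := C.edgeReduction.connected hG.connected fun z => by
      rcases C.eq_or z with rfl | ⟨u, rfl⟩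
      · exact ⟨C.a, (C.adj_m.mpr (by simp)).reachable⟩
      · exact ⟨u, SimpleGraph.Reachable.refl _⟩
    have key : ∃ R' : RotationSystem G', R'.IsPlanar ∧ R'.TurnFace C.a C.b C.s := by
      obtain ⟨R', hR'⟩ := hG.exists_planar
      rcases hG.turnFace R' hR' _ _ _ C.adj_ab ((hb C.s).mpr (by simp))
        ((ha C.s).mpr (by simp)).symm with h | h
      · exact ⟨R', hR', h⟩
      · exact ⟨R'.mirror, hR'.mirror, h⟩
    obtain ⟨R', hR', hf⟩ := key
    obtain ⟨R, hR⟩ := exists_rotation_inserted (C := C) hf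
    have h1 := hR.faceCount_lt
    have h2 := C.edgeReduction.eulerBound hG.eulerBound R
    have h3 := C.edgeReduction.card_add
    have h4 := (R'.isPlanar_iff.mp hR').2
    exact ⟨R, R.isPlanar_iff.mpr ⟨hc, by omega⟩⟩
  unique R S hR hS := by
    obtain ⟨R', hR', h1⟩ := exists_inserted (C := C) hG ha hxb hxs hb hya hys hR
    obtain ⟨S', hS', h2⟩ := exists_inserted (C := C) hG ha hxb hxs hb hya hys hS
    rcases hG.unique R' S' hR' hS' with rfl | rfl
    · exact Or.inl (eq_of_inserted hG h1 h2)
    · right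
      rw [mirror_mirror] at h2
      rw [← eq_of_inserted hG h1 (S := S.mirror) (by rw [mirror_mirror]; exact h2.symm),
        mirror_mirror]
  turnFace R hR z t v hzt htv hvz := by
    obtain ⟨R', hR', h | h⟩ := exists_inserted (C := C) hG ha hxb hxs hb hya hys hR
    · exact h.turnFace hG hR' hzt htv hvz
    · have := h.turnFace hG hR'.mirror hzt htv hvz
      rw [mirror_mirror] at this
      exact this.symm

end SubdividedChord

/-! ### Triangle reductions: embeddings and the induction step. -/

namespace TriangleExpansion

open RotationSystem

variable {V X : Type u} {G : SimpleGraph V} {G' : SimpleGraph (Option X)}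
  {T : TriangleExpansion G G'} {R S : RotationSystem G} {R' S' : RotationSystem G'}

/-- `R` agrees with `R'` at the vertices outside the triangle. -/
def Agrees (T : TriangleExpansion G G') (R : RotationSystem G) (R' : RotationSystem G') : Prop :=
  ∀ x o o', R'.Turn (some x) o o' → R.Turn (T.emb x) (T.out x o) (T.out x o')

theorem Agrees.mirror (h : T.Agrees R R') : T.Agrees R.mirror R'.mirror := fun x o o' ht =>
  turn_mirror.mpr (h x o' o (turn_mirror.mp ht))

/-- `R` arises from `R'` by the replacement of the vertex `none` with the triangle. -/
structure Expanded (T : TriangleExpansion G G') (R : RotationSystem G) (R' : RotationSystem G') :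
    Prop where
  agrees : T.Agrees R R'
  turn_ab : R'.Turn none (some T.a) (some T.b)
  turn_bc : R'.Turn none (some T.b) (some T.c)
  turn_ca : R'.Turn none (some T.c) (some T.a)
  turn_p : R.Turn T.p (T.emb T.a) T.q ∧ R.Turn T.p T.q T.r ∧ R.Turn T.p T.r (T.emb T.a)
  turn_q : R.Turn T.q (T.emb T.b) T.r ∧ R.Turn T.q T.r T.p ∧ R.Turn T.q T.p (T.emb T.b)
  turn_r : R.Turn T.r (T.emb T.c) T.p ∧ R.Turn T.r T.p T.q ∧ R.Turn T.r T.q (T.emb T.c)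

/-- Because of the default value in `out`, this needs `o` to be a neighbour of `x`. -/
theorem out_rotate {x : X} {o : Option X} (h : G'.Adj (some x) o) :
    T.rotate.out x o = T.out x o := by
  rcases o with _ | y
  · rcases T.adj_none.mp h.symm with rfl | rfl | rfl
    · rw [T.out_a]
      exact T.rotate.out_c
    · rw [T.out_b]
      exact T.rotate.out_a
    · rw [T.out_c]
      exact T.rotate.out_b
  · rfl

theorem agrees_rotate (h : T.rotate.Agrees R R') : T.Agrees R R' := fun x o o' ht => by
  have := h x o o' ht
  rwa [out_rotate ht.adj_left, out_rotate ht.adj_right] at this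

theorem out_injective {x : X} {o o' : Option X} (h : T.out x o = T.out x o') : o = o' := by
  have := T.p_ne
  have := T.q_ne
  have := T.r_ne
  rcases o with _ | y <;> rcases o' with _ | y'
  · rfl
  · simp only [out, Option.elim] at h
    grind
  · simp only [out, Option.elim] at h
    grind
  · exact congrArg some (T.emb_injective h)

theorem adj_out {x : X} {o : Option X} (h : G'.Adj (some x) o) : G.Adj (T.emb x) (T.out x o) := by
  rcases o with _ | y
  · rcases T.adj_none.mp h.symm with rfl | rfl | rfl
    · rw [T.out_a, SimpleGraph.adj_comm, T.adj_p]
    · rw [T.out_b, SimpleGraph.adj_comm, T.adj_q]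
    · rw [T.out_c, SimpleGraph.adj_comm, T.adj_r]
  · exact T.adj_iff.mp h

theorem exists_out {x : X} {t : V} (h : G.Adj (T.emb x) t) :
    ∃ o, G'.Adj (some x) o ∧ t = T.out x o := by
  rcases T.eq_or t with rfl | rfl | rfl | ⟨w, rfl⟩
  · obtain rfl := T.adj_p.mp h.symm
    exact ⟨none, (T.adj_none.mpr (by simp)).symm, by simp⟩
  · obtain rfl := T.adj_q.mp h.symm
    exact ⟨none, (T.adj_none.mpr (by simp)).symm, by simp⟩
  · obtain rfl := T.adj_r.mp h.symm
    exact ⟨none, (T.adj_none.mpr (by simp)).symm, by simp⟩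
  · exact ⟨some w, T.adj_iff.mpr h, rfl⟩

theorem mk_emb_ne (x : X) (z : V) : s(T.emb x, z) ≠ s(T.p, T.q) := by
  intro h
  rcases Sym2.eq_iff.mp h with ⟨h, _⟩ | ⟨h, _⟩
  · exact T.p_ne _ h.symm
  · exact T.q_ne _ h.symm

theorem agrees_of_turnRel [Finite V] [Finite X] (h : T.edgeReduction.TurnRel R R') :
    T.Agrees R R' := by
  intro x o o' ht
  rcases h _ _ _ ht with h1 | ⟨z, hz, -⟩
  · exact h1
  · exact absurd hz (mk_emb_ne x z)

/-- The deleted edge `pq` does not end at `r`, so the rotation at `r` is that at `none`, with `p`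
and `q` standing for `a` and `b`. -/
theorem turn_r_of_turnRel [Finite V] [Finite X] (h : T.edgeReduction.TurnRel R R')
    (hab : R'.Turn none (some T.a) (some T.b)) (hbc : R'.Turn none (some T.b) (some T.c))
    (hca : R'.Turn none (some T.c) (some T.a)) :
    R.Turn T.r (T.emb T.c) T.p ∧ R.Turn T.r T.p T.q ∧ R.Turn T.r T.q (T.emb T.c) := by
  have ha : T.edgeReduction.tgt none (some T.a) = T.p := by simp [edgeReduction]
  have hb : T.edgeReduction.tgt none (some T.b) = T.q := by simp [edgeReduction, T.a_ne_b.symm]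
  have hc : T.edgeReduction.tgt none (some T.c) = T.emb T.c := by
    simp [edgeReduction, T.c_ne_a, T.b_ne_c.symm]
  have key : ∀ o o', R'.Turn none o o' →
      R.Turn T.r (T.edgeReduction.tgt none o) (T.edgeReduction.tgt none o') := by
    intro o o' ht
    rcases h _ _ _ ht with h1 | ⟨z, hz, -⟩
    · exact h1
    · have hz' : s(T.r, z) = s(T.p, T.q) := hz
      rcases Sym2.eq_iff.mp hz' with ⟨h, _⟩ | ⟨h, _⟩
      · exact absurd h T.adj_rp.ne
      · exact absurd h T.adj_qr.ne'
  have h1 := key _ _ hab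
  have h2 := key _ _ hbc
  have h3 := key _ _ hca
  rw [ha, hb] at h1
  rw [hb, hc] at h2
  rw [hc, ha] at h3
  exact ⟨h3, h1, h2⟩

/-- Otherwise the two are mirror images, and the rotation of `R` at the neighbour `a` of the
triangle would equal its own reverse. This is impossible, as `a` has degree at least three. -/
theorem eq_of_agrees [Finite V] (hG : UniquelyEmbedded G') (hR' : R'.IsPlanar) (hS' : S'.IsPlanar)
    (h : T.Agrees R R') (h' : T.Agrees R S') : S' = R' := by
  rcases hG.unique R' S' hR' hS' with h1 | rfl
  · exact h1
  · exfalso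
    have hadj : G'.Adj (some T.a) none := (T.adj_none.mpr (by simp)).symm
    obtain ⟨o, ho⟩ := R'.exists_turn hadj
    obtain ⟨w, hw, h1, h2⟩ := hG.exists_adj (some T.a) none o
    rcases eq_or_eq_of_turn_turn (h _ _ _ ho) (h' _ _ _ (turn_mirror.mpr ho)) (T.adj_out hw)
      with h3 | h3
    · exact h1 (out_injective h3)
    · exact h2 (out_injective h3)

theorem expanded_of_turnRel [Finite V] [Finite X] (h1 : T.edgeReduction.TurnRel R R')
    (h2 : T.rotate.edgeReduction.TurnRel R R') (h3 : T.rotate.rotate.edgeReduction.TurnRel R R')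
    (hab : R'.Turn none (some T.a) (some T.b)) (hbc : R'.Turn none (some T.b) (some T.c))
    (hca : R'.Turn none (some T.c) (some T.a)) : T.Expanded R R' where
  agrees := agrees_of_turnRel h1
  turn_ab := hab
  turn_bc := hbc
  turn_ca := hca
  turn_p := turn_r_of_turnRel h2 hbc hca hab
  turn_q := turn_r_of_turnRel h3 hca hab hbc
  turn_r := turn_r_of_turnRel h1 hab hbc hca

theorem turn_none [Finite X] (T : TriangleExpansion G G') (R' : RotationSystem G') :
    (R'.Turn none (some T.a) (some T.b) ∧ R'.Turn none (some T.b) (some T.c) ∧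
      R'.Turn none (some T.c) (some T.a)) ∨
    (R'.Turn none (some T.a) (some T.c) ∧ R'.Turn none (some T.c) (some T.b) ∧
      R'.Turn none (some T.b) (some T.a)) := by
  refine R'.turn_three (v := none) (fun t ht => ?_) (T.adj_none.mpr (by simp))
    (T.adj_none.mpr (by simp)) (T.adj_none.mpr (by simp)) (by simpa using T.a_ne_b)
    (by simpa using T.c_ne_a.symm) (by simpa using T.b_ne_c)
  rcases t with _ | t
  · exact absurd ht G'.irrefl
  · simpa using T.adj_none.mp ht

/-- Deleting an edge of the triangle lets the opposite corner play the role of `none`, so the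
induced embedding shows the rotation at that corner. The three induced embeddings coincide by
`eq_of_agrees`, which makes the three rotations consistent with each other. -/
theorem exists_expanded [Finite V] [Finite X]
    (T : TriangleExpansion G G') (hG : UniquelyEmbedded G')
    (hR : R.IsPlanar) : ∃ R' : RotationSystem G', R'.IsPlanar ∧
      (T.Expanded R R' ∨ T.Expanded R.mirror R'.mirror) := by
  obtain ⟨R1, hR1, h1, -⟩ :=
    T.edgeReduction.exists_isPlanar hG.eulerBound hG.connected hR
  obtain ⟨R2, hR2, h2, -⟩ :=
    T.rotate.edgeReduction.exists_isPlanar hG.eulerBound hG.connected hR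
  obtain ⟨R3, hR3, h3, -⟩ :=
    T.rotate.rotate.edgeReduction.exists_isPlanar hG.eulerBound hG.connected hR
  have e2 := eq_of_agrees hG hR1 hR2 (agrees_of_turnRel h1) (agrees_rotate (agrees_of_turnRel h2))
  have e3 := eq_of_agrees hG hR1 hR3 (agrees_of_turnRel h1)
    (agrees_rotate (agrees_rotate (agrees_of_turnRel h3)))
  subst e2 e3
  refine ⟨_, hR1, ?_⟩
  rcases T.turn_none _ with ⟨ha, hb, hc⟩ | ⟨ha, hb, hc⟩
  · exact Or.inl (expanded_of_turnRel h1 h2 h3 ha hb hc)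
  · exact Or.inr (expanded_of_turnRel h1.mirror h2.mirror h3.mirror (turn_mirror.mpr hc)
      (turn_mirror.mpr hb) (turn_mirror.mpr ha))

theorem Expanded.eq (hR : T.Expanded R R') (hS : T.Expanded S R') : S = R := by
  have key : ∀ v t, G.Adj v t → ∃ z, R.Turn v t z ∧ S.Turn v t z := by
    intro v t h
    rcases T.eq_or v with rfl | rfl | rfl | ⟨x, rfl⟩
    · rcases T.adj_p_iff.mp h with rfl | rfl | rfl
      · exact ⟨_, hR.turn_p.1, hS.turn_p.1⟩
      · exact ⟨_, hR.turn_p.2.1, hS.turn_p.2.1⟩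
      · exact ⟨_, hR.turn_p.2.2, hS.turn_p.2.2⟩
    · rcases T.adj_q_iff.mp h with rfl | rfl | rfl
      · exact ⟨_, hR.turn_q.1, hS.turn_q.1⟩
      · exact ⟨_, hR.turn_q.2.1, hS.turn_q.2.1⟩
      · exact ⟨_, hR.turn_q.2.2, hS.turn_q.2.2⟩
    · rcases T.adj_r_iff.mp h with rfl | rfl | rfl
      · exact ⟨_, hR.turn_r.1, hS.turn_r.1⟩
      · exact ⟨_, hR.turn_r.2.1, hS.turn_r.2.1⟩
      · exact ⟨_, hR.turn_r.2.2, hS.turn_r.2.2⟩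
    · obtain ⟨o, ho, rfl⟩ := exists_out h
      obtain ⟨o', ho'⟩ := R'.exists_turn ho
      exact ⟨_, hR.agrees _ _ _ ho', hS.agrees _ _ _ ho'⟩
  refine eq_of_turn fun v u w h => ?_
  obtain ⟨z, hz, hz'⟩ := key v u h.adj_left
  rwa [h.right_unique hz]

theorem eq_of_expanded (hR : T.Expanded R R' ∨ T.Expanded R.mirror R'.mirror)
    (hS : T.Expanded S R' ∨ T.Expanded S.mirror R'.mirror) : S = R := by
  have key : R'.Turn none (some T.a) (some T.b) → R'.Turn none (some T.b) (some T.c) →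
      ¬ R'.mirror.Turn none (some T.a) (some T.b) := fun h h1 h' =>
    T.c_ne_a (Option.some_injective _ (h1.right_unique (turn_mirror.mp h')))
  rcases hR with hR | hR <;> rcases hS with hS | hS
  · exact hR.eq hS
  · exact absurd hS.turn_ab (key hR.turn_ab hR.turn_bc)
  · exact absurd hR.turn_ab (key hS.turn_ab hS.turn_bc)
  · rw [← S.mirror_mirror, hR.eq hS, mirror_mirror]

/-- As `a`, `b`, `c` are distinct, no outside neighbour is joined to two corners; so `pqr` is the
only triangle that meets the new vertices, and it is the new face. The remaining triangles lie in
`G'`, and the rotations at their vertices are unchanged. -/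
theorem Expanded.turnFace [Finite V] (hG : UniquelyEmbedded G')
    (hR' : R'.IsPlanar) (hR : T.Expanded R R') {z t v : V} (hzt : G.Adj z t) (htv : G.Adj t v)
    (hvz : G.Adj v z) : R.TurnFace z t v ∨ R.mirror.TurnFace z t v := by
  have hf : R.TurnFace T.p T.r T.q := ⟨hR.turn_r.2.1, hR.turn_q.2.1, hR.turn_p.2.1⟩
  have hf' := turnFace_perm (Or.inl hf)
  have hpq := T.a_ne_b
  have hqr := T.b_ne_c
  have hrp := T.c_ne_a
  have hp : ∀ t v, G.Adj T.p t → G.Adj t v → G.Adj v T.p →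
      R.TurnFace T.p t v ∨ R.mirror.TurnFace T.p t v := by
    intro t v h1 h2 h3
    rcases T.adj_p_iff.mp h1 with rfl | rfl | rfl <;>
      rcases T.adj_p_iff.mp h3.symm with rfl | rfl | rfl
    · exact absurd h2 G.irrefl
    · exact absurd (T.adj_q.mp h2.symm) hpq
    · exact absurd (T.adj_r.mp h2.symm) hrp.symm
    · exact absurd (T.adj_q.mp h2) hpq
    · exact absurd h2 G.irrefl
    · exact hf'.2.2.2.1
    · exact absurd (T.adj_r.mp h2) hrp.symm
    · exact Or.inl hf
    · exact absurd h2 G.irrefl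
  have hq : ∀ t v, G.Adj T.q t → G.Adj t v → G.Adj v T.q →
      R.TurnFace T.q t v ∨ R.mirror.TurnFace T.q t v := by
    intro t v h1 h2 h3
    rcases T.adj_q_iff.mp h1 with rfl | rfl | rfl <;>
      rcases T.adj_q_iff.mp h3.symm with rfl | rfl | rfl
    · exact absurd h2 G.irrefl
    · exact absurd (T.adj_r.mp h2.symm) hqr
    · exact absurd (T.adj_p.mp h2.symm) hpq.symm
    · exact absurd (T.adj_r.mp h2) hqr
    · exact absurd h2 G.irrefl
    · exact hf'.2.2.2.2
    · exact absurd (T.adj_p.mp h2) hpq.symm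
    · exact hf'.2.1
    · exact absurd h2 G.irrefl
  have hr : ∀ t v, G.Adj T.r t → G.Adj t v → G.Adj v T.r →
      R.TurnFace T.r t v ∨ R.mirror.TurnFace T.r t v := by
    intro t v h1 h2 h3
    rcases T.adj_r_iff.mp h1 with rfl | rfl | rfl <;>
      rcases T.adj_r_iff.mp h3.symm with rfl | rfl | rfl
    · exact absurd h2 G.irrefl
    · exact absurd (T.adj_p.mp h2.symm) hrp
    · exact absurd (T.adj_q.mp h2.symm) hqr.symm
    · exact absurd (T.adj_p.mp h2) hrp
    · exact absurd h2 G.irrefl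
    · exact hf'.2.2.1
    · exact absurd (T.adj_q.mp h2) hqr.symm
    · exact hf'.1
    · exact absurd h2 G.irrefl
  have outer : ∀ z t v, G.Adj z t → G.Adj t v → G.Adj v z → (∀ x, z ≠ T.emb x) →
      R.TurnFace z t v ∨ R.mirror.TurnFace z t v := by
    intro z t v h1 h2 h3 h4
    rcases T.eq_or z with rfl | rfl | rfl | ⟨x, rfl⟩
    · exact hp _ _ h1 h2 h3
    · exact hq _ _ h1 h2 h3
    · exact hr _ _ h1 h2 h3
    · exact absurd rfl (h4 x)
  by_cases hz : ∃ x, z = T.emb x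
  swap
  · exact outer z t v hzt htv hvz (not_exists.mp hz)
  by_cases ht : ∃ x, t = T.emb x
  swap
  · exact (turnFace_perm (outer t v z htv hvz hzt (not_exists.mp ht))).2.1
  by_cases hv : ∃ x, v = T.emb x
  swap
  · exact (turnFace_perm (outer v z t hvz hzt htv (not_exists.mp hv))).1
  obtain ⟨x, rfl⟩ := hz
  obtain ⟨y, rfl⟩ := ht
  obtain ⟨w, rfl⟩ := hv
  rcases hG.turnFace R' hR' _ _ _ (T.adj_iff.mpr hzt) (T.adj_iff.mpr htv) (T.adj_iff.mpr hvz)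
    with ⟨h1, h2, h3⟩ | ⟨h1, h2, h3⟩
  · exact Or.inl ⟨hR.agrees _ _ _ h1, hR.agrees _ _ _ h2, hR.agrees _ _ _ h3⟩
  · exact Or.inr ⟨hR.agrees.mirror _ _ _ h1, hR.agrees.mirror _ _ _ h2, hR.agrees.mirror _ _ _ h3⟩

/-- Here `N x y z` is the cyclic order of three elements. The relation `Q` uses it at the corners
and copies `R'` elsewhere. -/
theorem exists_rotation_expanded [Finite V] [Finite X]
    (hab : R'.Turn none (some T.a) (some T.b)) (hbc : R'.Turn none (some T.b) (some T.c))
    (hca : R'.Turn none (some T.c) (some T.a)) : ∃ R : RotationSystem G, T.Expanded R R' := by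
  have hp := T.p_ne
  have hq := T.q_ne
  have hr := T.r_ne
  have hpq := T.adj_pq.ne
  have hqr := T.adj_qr.ne
  have hrp := T.adj_rp.ne
  let N : V → V → V → V → V → Prop := fun x y z t w =>
    (t = x ∧ w = y) ∨ (t = y ∧ w = z) ∨ (t = z ∧ w = x)
  let Q : V → V → V → Prop := fun v t z =>
    (∃ x o o', R'.Turn (some x) o o' ∧ v = T.emb x ∧ t = T.out x o ∧ z = T.out x o') ∨
    (v = T.p ∧ N (T.emb T.a) T.q T.r t z) ∨ (v = T.q ∧ N (T.emb T.b) T.r T.p t z) ∨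
    (v = T.r ∧ N (T.emb T.c) T.p T.q t z)
  have hQp : ∀ t z, Q T.p t z ↔ N (T.emb T.a) T.q T.r t z := by
    intro t z
    simp only [Q, hp, hpq, hrp.symm, false_and, and_false, exists_false, false_or, true_and,
      or_false]
  have hQq : ∀ t z, Q T.q t z ↔ N (T.emb T.b) T.r T.p t z := by
    intro t z
    simp only [Q, hq, hpq.symm, hqr, false_and, and_false, exists_false, false_or, true_and,
      or_false]
  have hQr : ∀ t z, Q T.r t z ↔ N (T.emb T.c) T.p T.q t z := by
    intro t z
    simp only [Q, hr, hqr.symm, hrp, false_and, and_false, exists_false, false_or, true_and]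
  have hQx : ∀ x t z, Q (T.emb x) t z ↔
      ∃ o o', R'.Turn (some x) o o' ∧ t = T.out x o ∧ z = T.out x o' := by
    intro x t z
    simp only [Q, (hp _).symm, (hq _).symm, (hr _).symm, false_and, or_false]
    constructor
    · rintro ⟨x', o, o', h1, h2, h3⟩
      obtain rfl := T.emb_injective h2
      exact ⟨o, o', h1, h3⟩
    · rintro ⟨o, o', h1, h3⟩
      exact ⟨x, o, o', h1, rfl, h3⟩
  have hN1 : ∀ {x y z t}, (t = x ∨ t = y ∨ t = z) → ∃ w, N x y z t w := by
    rintro x y z t (rfl | rfl | rfl)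
    · exact ⟨y, Or.inl ⟨rfl, rfl⟩⟩
    · exact ⟨z, Or.inr (Or.inl ⟨rfl, rfl⟩)⟩
    · exact ⟨x, Or.inr (Or.inr ⟨rfl, rfl⟩)⟩
  have hN2 : ∀ {x y z t w w'}, x ≠ y → y ≠ z → z ≠ x → N x y z t w → N x y z t w' → w = w' := by
    grind
  have hN3 : ∀ {x y z t t' w}, x ≠ y → y ≠ z → z ≠ x → N x y z t w → N x y z t' w → t = t' := by
    grind
  have hN4 : ∀ {x y z t w}, N x y z t w → (w = x ∨ w = y ∨ w = z) := by
    grind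
  have hN5 : ∀ {x y z t w}, (t = x ∨ t = y ∨ t = z) → (w = x ∨ w = y ∨ w = z) →
      Relation.ReflTransGen (N x y z) t w := by
    intro x y z t w ht hw
    have h1 : Relation.ReflTransGen (N x y z) x y := .single (Or.inl ⟨rfl, rfl⟩)
    have h2 : Relation.ReflTransGen (N x y z) y z := .single (Or.inr (Or.inl ⟨rfl, rfl⟩))
    have h3 : Relation.ReflTransGen (N x y z) z x := .single (Or.inr (Or.inr ⟨rfl, rfl⟩))
    rcases ht with rfl | rfl | rfl <;> rcases hw with rfl | rfl | rfl
    exacts [.refl, h1, h1.trans h2, h2.trans h3, .refl, h2, h3, h3.trans h1, .refl]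
  suffices h : ∃ R : RotationSystem G, ∀ v u w, G.Adj v u → Q v u w → R.Turn v u w by
    obtain ⟨R, hR⟩ := h
    have hP := fun t w h => hR _ t w (T.adj_p_iff.mpr h)
    have hQ := fun t w h => hR _ t w (T.adj_q_iff.mpr h)
    have hS := fun t w h => hR _ t w (T.adj_r_iff.mpr h)
    simp only [hQp, hQq, hQr] at hP hQ hS
    refine ⟨R, fun x o o' h => hR _ _ _ (T.adj_out h.adj_left) ((hQx _ _ _).mpr
      ⟨o, o', h, rfl, rfl⟩), hab, hbc, hca, ⟨?_, ?_, ?_⟩, ⟨?_, ?_, ?_⟩, ⟨?_, ?_, ?_⟩⟩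
    · exact hP _ _ (by simp) (by simp [N])
    · exact hP _ _ (by simp) (by simp [N])
    · exact hP _ _ (by simp) (by simp [N])
    · exact hQ _ _ (by simp) (by simp [N])
    · exact hQ _ _ (by simp) (by simp [N])
    · exact hQ _ _ (by simp) (by simp [N])
    · exact hS _ _ (by simp) (by simp [N])
    · exact hS _ _ (by simp) (by simp [N])
    · exact hS _ _ (by simp) (by simp [N])
  refine exists_of_relation ?_ ?_ ?_ ?_ ?_
  · intro v t z h
    rcases T.eq_or v with rfl | rfl | rfl | ⟨x, rfl⟩
    · exact T.adj_p_iff.mpr (hN4 ((hQp _ _).mp h))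
    · exact T.adj_q_iff.mpr (hN4 ((hQq _ _).mp h))
    · exact T.adj_r_iff.mpr (hN4 ((hQr _ _).mp h))
    · obtain ⟨o, o', h1, rfl, rfl⟩ := (hQx _ _ _).mp h
      exact T.adj_out h1.adj_right
  · intro v t h
    rcases T.eq_or v with rfl | rfl | rfl | ⟨x, rfl⟩
    · simpa only [hQp] using hN1 (T.adj_p_iff.mp h)
    · simpa only [hQq] using hN1 (T.adj_q_iff.mp h)
    · simpa only [hQr] using hN1 (T.adj_r_iff.mp h)
    · obtain ⟨o, ho, rfl⟩ := exists_out h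
      obtain ⟨o', ho'⟩ := R'.exists_turn ho
      exact ⟨_, (hQx _ _ _).mpr ⟨o, o', ho', rfl, rfl⟩⟩
  · intro v t z z' h h'
    rcases T.eq_or v with rfl | rfl | rfl | ⟨x, rfl⟩
    · exact hN2 (hq _).symm hqr (hr _) ((hQp _ _).mp h) ((hQp _ _).mp h')
    · exact hN2 (hr _).symm hrp (hp _) ((hQq _ _).mp h) ((hQq _ _).mp h')
    · exact hN2 (hp _).symm hpq (hq _) ((hQr _ _).mp h) ((hQr _ _).mp h')
    · obtain ⟨o, o', h1, h2, rfl⟩ := (hQx _ _ _).mp h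
      obtain ⟨p, p', h1', h2', rfl⟩ := (hQx _ _ _).mp h'
      obtain rfl := out_injective (h2.symm.trans h2')
      rw [h1.right_unique h1']
  · intro v t t' z h h'
    rcases T.eq_or v with rfl | rfl | rfl | ⟨x, rfl⟩
    · exact hN3 (hq _).symm hqr (hr _) ((hQp _ _).mp h) ((hQp _ _).mp h')
    · exact hN3 (hr _).symm hrp (hp _) ((hQq _ _).mp h) ((hQq _ _).mp h')
    · exact hN3 (hp _).symm hpq (hq _) ((hQr _ _).mp h) ((hQr _ _).mp h')
    · obtain ⟨o, o', h1, rfl, h2⟩ := (hQx _ _ _).mp h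
      obtain ⟨p, p', h1', rfl, h2'⟩ := (hQx _ _ _).mp h'
      obtain rfl := out_injective (h2.symm.trans h2')
      rw [h1.left_unique h1']
  · intro v t z h h'
    rcases T.eq_or v with rfl | rfl | rfl | ⟨x, rfl⟩
    · exact Relation.ReflTransGen.mono (fun a b => (hQp a b).mpr) _ _
        (hN5 (T.adj_p_iff.mp h) (T.adj_p_iff.mp h'))
    · exact Relation.ReflTransGen.mono (fun a b => (hQq a b).mpr) _ _
        (hN5 (T.adj_q_iff.mp h) (T.adj_q_iff.mp h'))
    · exact Relation.ReflTransGen.mono (fun a b => (hQr a b).mpr) _ _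
        (hN5 (T.adj_r_iff.mp h) (T.adj_r_iff.mp h'))
    · obtain ⟨o, ho, rfl⟩ := exists_out h
      obtain ⟨o', ho', rfl⟩ := exists_out h'
      exact Relation.ReflTransGen.lift (T.out x)
        (fun a b h => (hQx x (T.out x a) (T.out x b)).mpr ⟨a, b, h, rfl, rfl⟩) _ _
        (R'.reflTransGen_turn ho ho')

/-- The inner walk `prq` is labelled `none`. The other darts that leave a corner are labelled
through `F` with faces of `R'` at the vertex `none`, and the remaining darts keep their faces. -/
theorem Expanded.faceCount_lt [Finite V] [Finite X] (hR : T.Expanded R R') :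
    R'.faceCount + 1 ≤ R.faceCount := by
  classical
  have hp := T.p_ne
  have hq := T.q_ne
  have hr := T.r_ne
  have hpq := T.adj_pq.ne
  have hqr := T.adj_qr.ne
  have hrp := T.adj_rp.ne
  let E := T.edgeReduction
  let F : ∀ x, (x = T.a ∨ x = T.b ∨ x = T.c) → Option (Set G'.Dart) := fun x hx =>
    some (R'.faceOf ⟨(none, some x), T.adj_none.mpr hx⟩)
  let f : G.Dart → Option (Set G'.Dart) := fun d =>
    if d.fst = T.p then if d.snd = T.q then F T.b (by simp) else if d.snd = T.r then none
      else F T.a (by simp)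
    else if d.fst = T.q then if d.snd = T.r then F T.c (by simp) else if d.snd = T.p then none
      else F T.b (by simp)
    else if d.fst = T.r then if d.snd = T.p then F T.a (by simp) else if d.snd = T.q then none
      else F T.c (by simp)
    else Function.extend E.dart (fun d => some (R'.faceOf d)) (fun _ => none) d
  have f_x : ∀ {x o} (h : G'.Adj (some x) o),
      f ⟨(T.emb x, T.out x o), T.adj_out h⟩ = some (R'.faceOf ⟨(some x, o), h⟩) := by
    intro x o h
    simp only [f, (hp x).symm, (hq x).symm, (hr x).symm, if_false]
    exact E.dart_injective.extend_apply _ _ ⟨(some x, o), h⟩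
  have f_pa : ∀ h, f ⟨(T.p, T.emb T.a), h⟩ = F T.a (by simp) := by
    simp [f, (hq _).symm, (hr _).symm]
  have f_pq : ∀ h, f ⟨(T.p, T.q), h⟩ = F T.b (by simp) := by simp [f]
  have f_pr : ∀ h, f ⟨(T.p, T.r), h⟩ = none := by simp [f, hqr.symm]
  have f_qb : ∀ h, f ⟨(T.q, T.emb T.b), h⟩ = F T.b (by simp) := by
    simp [f, (hp _).symm, (hr _).symm, hpq.symm]
  have f_qr : ∀ h, f ⟨(T.q, T.r), h⟩ = F T.c (by simp) := by simp [f, hpq.symm]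
  have f_qp : ∀ h, f ⟨(T.q, T.p), h⟩ = none := by simp [f, hpq.symm, hrp.symm]
  have f_rc : ∀ h, f ⟨(T.r, T.emb T.c), h⟩ = F T.c (by simp) := by
    simp [f, (hq _).symm, (hp _).symm, hqr.symm, hrp]
  have f_rp : ∀ h, f ⟨(T.r, T.p), h⟩ = F T.a (by simp) := by simp [f, hqr.symm, hrp]
  have f_rq : ∀ h, f ⟨(T.r, T.q), h⟩ = none := by simp [f, hqr.symm, hrp, hpq.symm]
  have f_ap : ∀ h, f ⟨(T.emb T.a, T.p), h⟩ = F T.b (by simp) := by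
    intro h
    have h1 := f_x hR.turn_ab.adj_left.symm
    rw [hR.turn_ab.faceOf_eq] at h1
    refine Eq.trans ?_ h1
    congr 1
    simp
  have f_bq : ∀ h, f ⟨(T.emb T.b, T.q), h⟩ = F T.c (by simp) := by
    intro h
    have h1 := f_x hR.turn_bc.adj_left.symm
    rw [hR.turn_bc.faceOf_eq] at h1
    refine Eq.trans ?_ h1
    congr 1
    simp
  have f_cr : ∀ h, f ⟨(T.emb T.c, T.r), h⟩ = F T.a (by simp) := by
    intro h
    have h1 := f_x hR.turn_ca.adj_left.symm
    rw [hR.turn_ca.faceOf_eq] at h1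
    refine Eq.trans ?_ h1
    congr 1
    simp
  refine le_trans ?_ (R.ncard_range_le_faceCount (f := f) ?_)
  · have hsub : insert none (some '' Set.range R'.faceOf) ⊆ Set.range f := by
      rintro o (rfl | ⟨_, ⟨⟨⟨o, o'⟩, h⟩, rfl⟩, rfl⟩)
      · exact ⟨_, f_pr T.adj_rp.symm⟩
      · rcases o with _ | x
        · rcases o' with _ | y
          · exact absurd h G'.irrefl
          · rcases T.adj_none.mp h with rfl | rfl | rfl
            · exact ⟨_, f_pa (T.adj_p.mpr rfl)⟩
            · exact ⟨_, f_qb (T.adj_q.mpr rfl)⟩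
            · exact ⟨_, f_rc (T.adj_r.mpr rfl)⟩
        · exact ⟨_, f_x h⟩
    have h1 := Set.ncard_le_ncard hsub (Set.toFinite _)
    rw [Set.ncard_insert_of_notMem (by simp) (Set.toFinite _),
      Set.ncard_image_of_injective _ (Option.some_injective _)] at h1
    exact h1
  · have key : ∀ v t (h : G.Adj v t), ∃ z, ∃ h' : R.Turn v t z,
        f ⟨(v, z), h'.adj_right⟩ = f ⟨(t, v), h.symm⟩ := by
      intro v t h
      rcases T.eq_or v with rfl | rfl | rfl | ⟨x, rfl⟩
      · rcases T.adj_p_iff.mp h with rfl | rfl | rfl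
        · exact ⟨_, hR.turn_p.1, by rw [f_pq, f_ap]⟩
        · exact ⟨_, hR.turn_p.2.1, by rw [f_pr, f_qp]⟩
        · exact ⟨_, hR.turn_p.2.2, by rw [f_pa, f_rp]⟩
      · rcases T.adj_q_iff.mp h with rfl | rfl | rfl
        · exact ⟨_, hR.turn_q.1, by rw [f_qr, f_bq]⟩
        · exact ⟨_, hR.turn_q.2.1, by rw [f_qp, f_rq]⟩
        · exact ⟨_, hR.turn_q.2.2, by rw [f_qb, f_pq]⟩
      · rcases T.adj_r_iff.mp h with rfl | rfl | rfl
        · exact ⟨_, hR.turn_r.1, by rw [f_rp, f_cr]⟩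
        · exact ⟨_, hR.turn_r.2.1, by rw [f_rq, f_pr]⟩
        · exact ⟨_, hR.turn_r.2.2, by rw [f_rc, f_qr]⟩
      · obtain ⟨o, ho, rfl⟩ := exists_out h
        obtain ⟨o', ho'⟩ := R'.exists_turn ho
        refine ⟨_, hR.agrees _ _ _ ho', ?_⟩
        rw [f_x ho'.adj_right, ← ho'.faceOf_eq]
        rcases o with _ | y
        · rcases T.adj_none.mp ho.symm with rfl | rfl | rfl
          · refine (f_pa (T.adj_p.mpr rfl)).symm.trans ?_
            congr 1
            simp
          · refine (f_qb (T.adj_q.mpr rfl)).symm.trans ?_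
            congr 1
            simp
          · refine (f_rc (T.adj_r.mpr rfl)).symm.trans ?_
            congr 1
            simp
        · exact (f_x ho.symm).symm
    intro v t z h
    obtain ⟨z', hz', he⟩ := key v t h.adj_left
    obtain rfl := h.right_unique hz'
    exact he

theorem uniquelyEmbedded [Finite V] [Finite X] (T : TriangleExpansion G G')
    (hG : UniquelyEmbedded G') : UniquelyEmbedded G := by
  have hc : G.Connected := T.edgeReduction.connected hG.connected fun z => by
    rcases T.eq_or z with rfl | rfl | rfl | ⟨x, rfl⟩
    · exact ⟨none, T.adj_rp.symm.reachable⟩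
    · exact ⟨none, T.adj_qr.reachable⟩
    · exact ⟨none, SimpleGraph.Reachable.refl _⟩
    · exact ⟨some x, SimpleGraph.Reachable.refl _⟩
  refine ⟨hc, ?_, T.edgeReduction.eulerBound hG.eulerBound, ?_, ?_, ?_⟩
  · have aux : ∀ (T : TriangleExpansion G G') (z t : V), ∃ w, G.Adj T.p w ∧ w ≠ z ∧ w ≠ t := by
      intro T z t
      have h1 := T.adj_qr.ne
      have h2 := T.q_ne T.a
      have h3 := T.r_ne T.a
      by_contra! hcon
      have := or_iff_not_imp_left.mpr (hcon _ (T.adj_p.mpr rfl))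
      have := or_iff_not_imp_left.mpr (hcon _ T.adj_pq)
      have := or_iff_not_imp_left.mpr (hcon _ T.adj_rp.symm)
      grind
    intro v z t
    rcases T.eq_or v with rfl | rfl | rfl | ⟨x, rfl⟩
    · exact aux T z t
    · exact aux T.rotate z t
    · exact aux T.rotate.rotate z t
    · have key : ∀ t : V, ∃ w, ∀ w', T.out x w' = t → w' = w := by
        intro t
        by_cases h : ∃ w, T.out x w = t
        · obtain ⟨w, hw⟩ := h
          exact ⟨w, fun w' h2 => out_injective (h2.trans hw.symm)⟩
        · exact ⟨none, fun w' h2 => absurd ⟨w', h2⟩ h⟩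
      obtain ⟨z', hz'⟩ := key z
      obtain ⟨t', ht'⟩ := key t
      obtain ⟨w, hw, h1, h2⟩ := hG.exists_adj (some x) z' t'
      exact ⟨_, T.adj_out hw, fun h => h1 (hz' w h), fun h => h2 (ht' w h)⟩
  · have key : ∃ R' : RotationSystem G', R'.IsPlanar ∧ R'.Turn none (some T.a) (some T.b) ∧
        R'.Turn none (some T.b) (some T.c) ∧ R'.Turn none (some T.c) (some T.a) := by
      obtain ⟨R', hR'⟩ := hG.exists_planar
      rcases T.turn_none R' with h | ⟨h1, h2, h3⟩
      · exact ⟨R', hR', h⟩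
      · exact ⟨R'.mirror, hR'.mirror, turn_mirror.mpr h3, turn_mirror.mpr h2, turn_mirror.mpr h1⟩
    obtain ⟨R', hR', h1, h2, h3⟩ := key
    obtain ⟨R, hR⟩ := exists_rotation_expanded h1 h2 h3
    have h1 := hR.faceCount_lt
    have h2 := T.edgeReduction.eulerBound hG.eulerBound R
    have h3 := T.edgeReduction.card_add
    have h4 := (R'.isPlanar_iff.mp hR').2
    exact ⟨R, R.isPlanar_iff.mpr ⟨hc, by omega⟩⟩
  · intro R S hR hS
    obtain ⟨R', hR', h1⟩ := T.exists_expanded hG hR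
    obtain ⟨S', hS', h2⟩ := T.exists_expanded hG hS
    rcases hG.unique R' S' hR' hS' with rfl | rfl
    · exact Or.inl (eq_of_expanded h1 h2)
    · right
      rw [mirror_mirror] at h2
      rw [← eq_of_expanded h1 (S := S.mirror) (by rw [mirror_mirror]; exact h2.symm),
        mirror_mirror]
  · intro R hR z t v hzt htv hvz
    obtain ⟨R', hR', h | h⟩ := T.exists_expanded hG hR
    · exact h.turnFace hG hR' hzt htv hvz
    · have := h.turnFace hG hR'.mirror hzt htv hvz
      rw [mirror_mirror] at this
      exact this.symm

end TriangleExpansion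

/-! ### The two reductions in terms of the structures above. -/

namespace D3

variable {V : Type u} {G : SimpleGraph V}

theorem DegThree.exists_third {p q s : V} (h : DegThree G p) (hq : G.Adj p q) (hs : G.Adj p s)
    (hqs : q ≠ s) : ∃ x, x ≠ q ∧ x ≠ s ∧ ∀ w, G.Adj p w ↔ w = q ∨ w = s ∨ w = x := by
  obtain ⟨a, b, c, hab, hac, hbc, hN⟩ := Set.ncard_eq_three.mp h
  have hN' : ∀ w, G.Adj p w ↔ w = a ∨ w = b ∨ w = c := fun w => by
    rw [← SimpleGraph.mem_neighborSet, hN]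
    simp
  rw [hN'] at hq hs
  simp only [hN']
  rcases hq with rfl | rfl | rfl <;> rcases hs with rfl | rfl | rfl
  · exact absurd rfl hqs
  · exact ⟨c, by tauto, by tauto, by tauto⟩
  · exact ⟨b, by tauto, by tauto, by tauto⟩
  · exact ⟨c, by tauto, by tauto, by tauto⟩
  · exact absurd rfl hqs
  · exact ⟨a, by tauto, by tauto, by tauto⟩
  · exact ⟨b, by tauto, by tauto, by tauto⟩
  · exact ⟨a, by tauto, by tauto, by tauto⟩
  · exact absurd rfl hqs

theorem shortenPath_adj {p q r : V} {u w : ({q}ᶜ : Set V)} :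
    (shortenPath G p q r).Adj u w ↔
      G.Adj u w ∨ (((u : V) = p ∧ (w : V) = r) ∨ ((u : V) = r ∧ (w : V) = p)) ∧ (u : V) ≠ w := by
  simp only [shortenPath, SimpleGraph.comap_adj, SimpleGraph.sup_adj, SimpleGraph.edge_adj,
    Function.Embedding.subtype_apply]

/-- A path reduction, seen from the reduced graph. -/
theorem IsPathTriple.exists_subdividedChord {p q r : V} (h : IsPathTriple G p q r) :
    ∃ (C : SubdividedChord G (shortenPath G p q r)) (x y : ({q}ᶜ : Set V)),
      (∀ w, (shortenPath G p q r).Adj C.a w ↔ w = C.b ∨ w = C.s ∨ w = x) ∧ x ≠ C.b ∧ x ≠ C.s ∧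
      (∀ w, (shortenPath G p q r).Adj C.b w ↔ w = C.a ∨ w = C.s ∨ w = y) ∧ y ≠ C.a ∧ y ≠ C.s := by
  obtain ⟨s, hsp, hsq, hsr⟩ := h.apex
  obtain ⟨x, hxq, hxs, hx⟩ := h.deg_p.exists_third h.adj_pq hsp.symm hsq.ne'
  obtain ⟨y, hyq, hys, hy⟩ := h.deg_r.exists_third h.adj_qr.symm hsr.symm hsq.ne'
  obtain ⟨t, -, -, ht⟩ := h.deg_q.exists_third h.adj_pq.symm h.adj_qr h.ne_pr
  -- The middle vertex has degree three, so the apex is its only neighbour outside the path.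
  have hts : t = s := by
    rcases (ht s).mp hsq.symm with h1 | h1 | h1
    · exact absurd h1 hsp.ne
    · exact absurd h1 hsr.ne
    · exact h1.symm
  subst hts
  have hpr := h.not_adj_pr
  have hrp : ¬ G.Adj r p := fun h' => hpr h'.symm
  have hxr : x ≠ r := fun h' => hpr ((hx r).mpr (by simp [h']))
  have hyp : y ≠ p := fun h' => hrp ((hy p).mpr (by simp [h']))
  have hne := h.ne_pr
  have hpq := h.adj_pq.ne
  have hqr := h.adj_qr.ne
  have hpx := ((hx x).mpr (by simp)).ne
  have hry := ((hy y).mpr (by simp)).ne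
  let C : SubdividedChord G (shortenPath G p q r) :=
    { vert := Subtype.val
      vert_injective := Subtype.val_injective
      m := q
      vert_ne := fun u => u.2
      eq_or := fun z => by
        by_cases hz : z = q
        · exact Or.inl hz
        · exact Or.inr ⟨⟨z, hz⟩, rfl⟩
      a := ⟨p, hpq⟩
      b := ⟨r, hqr.symm⟩
      s := ⟨t, hsq.ne⟩
      adj_ab := shortenPath_adj.mpr (Or.inr ⟨Or.inl ⟨rfl, rfl⟩, hne⟩)
      s_ne_a := fun h' => hsp.ne (congrArg Subtype.val h')
      s_ne_b := fun h' => hsr.ne (congrArg Subtype.val h')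
      adj_iff := by
        rintro ⟨u, hu⟩ ⟨w, hw⟩
        simp only [shortenPath_adj, ne_eq, Sym2.eq_iff, Subtype.ext_iff]
        constructor
        · intro h'
          refine ⟨Or.inl h', ?_⟩
          rintro (⟨rfl, rfl⟩ | ⟨rfl, rfl⟩)
          · exact hpr h'
          · exact hrp h'
        · tauto
      adj_m := by
        rintro ⟨u, hu⟩
        simp only [ht, Subtype.ext_iff] }
  refine ⟨C, ⟨x, hxq⟩, ⟨y, hyq⟩, ?_, fun h' => hxr (congrArg Subtype.val h'),
    fun h' => hxs (congrArg Subtype.val h'), ?_, fun h' => hyp (congrArg Subtype.val h'),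
    fun h' => hys (congrArg Subtype.val h')⟩
  · rintro ⟨w, hw⟩
    have hw' : w ≠ q := hw
    simp only [C, shortenPath_adj, Subtype.ext_iff, hx]
    grind
  · rintro ⟨w, hw⟩
    have hw' : w ≠ q := hw
    simp only [C, shortenPath_adj, Subtype.ext_iff, hy]
    grind

/-- A triangle reduction, seen from the reduced graph. -/
theorem IsTriangleTriple.nonempty_triangleExpansion {p q r : V} (h : IsTriangleTriple G p q r) :
    Nonempty (TriangleExpansion G (collapseTriangle G p q r)) := by
  have hpq := h.adj_pq.ne
  have hqr := h.adj_qr.ne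
  have hrp := h.adj_rp.ne
  obtain ⟨a, haq, har, ha⟩ := h.deg_p.exists_third h.adj_pq h.adj_rp.symm hqr
  obtain ⟨b, hbr, hbp, hb⟩ := h.deg_q.exists_third h.adj_qr h.adj_pq.symm hrp
  obtain ⟨c, hcp, hcq, hc⟩ := h.deg_r.exists_third h.adj_rp h.adj_qr.symm hpq
  have hpa := ((ha a).mpr (by simp)).ne
  have hqb := ((hb b).mpr (by simp)).ne
  have hrc := ((hc c).mpr (by simp)).ne
  have hm : ∀ {z}, z ∈ ({p, q, r}ᶜ : Set V) ↔ z ≠ p ∧ z ≠ q ∧ z ≠ r := by simp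
  exact ⟨
    { emb := Subtype.val
      emb_injective := Subtype.val_injective
      p := p
      q := q
      r := r
      p_ne := fun x h' => (hm.mp x.2).1 h'.symm
      q_ne := fun x h' => (hm.mp x.2).2.1 h'.symm
      r_ne := fun x h' => (hm.mp x.2).2.2 h'.symm
      eq_or := fun z => by
        by_cases hz : z ∈ ({p, q, r}ᶜ : Set V)
        · exact Or.inr (Or.inr (Or.inr ⟨⟨z, hz⟩, rfl⟩))
        · rw [hm] at hz
          tauto
      a := ⟨a, hm.mpr ⟨hpa.symm, haq, har⟩⟩
      b := ⟨b, hm.mpr ⟨hbp, hqb.symm, hbr⟩⟩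
      c := ⟨c, hm.mpr ⟨hcp, hcq, hrc.symm⟩⟩
      a_ne_b := fun h' => har (h.distinct_pq a ((ha a).mpr (by simp)) ((hb a).mpr (by
        simp [show a = b from congrArg Subtype.val h'])))
      b_ne_c := fun h' => hbp (h.distinct_qr b ((hb b).mpr (by simp)) ((hc b).mpr (by
        simp [show b = c from congrArg Subtype.val h'])))
      c_ne_a := fun h' => hcq (h.distinct_rp c ((hc c).mpr (by simp)) ((ha c).mpr (by
        simp [show c = a from congrArg Subtype.val h'])))
      adj_pq := h.adj_pq
      adj_qr := h.adj_qr
      adj_rp := h.adj_rp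
      adj_p := by
        rintro ⟨x, hx⟩
        obtain ⟨h1, h2, h3⟩ := hm.mp hx
        simp [ha, h2, h3]
      adj_q := by
        rintro ⟨x, hx⟩
        obtain ⟨h1, h2, h3⟩ := hm.mp hx
        simp [hb, h1, h3]
      adj_r := by
        rintro ⟨x, hx⟩
        obtain ⟨h1, h2, h3⟩ := hm.mp hx
        simp [hc, h1, h2]
      adj_none := by
        rintro ⟨x, hx⟩
        obtain ⟨h1, h2, h3⟩ := hm.mp hx
        change G.Adj p x ∨ G.Adj q x ∨ G.Adj r x ↔ _
        simp [ha, hb, hc, h1, h2, h3]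
      adj_iff := Iff.rfl }⟩

end D3

/-! ### Face lengths, and the base case of the tetrahedron. -/

namespace RotationSystem

variable {V : Type u} {G : SimpleGraph V} {R : RotationSystem G}

theorem next_ne (d : G.Dart) : R.next d ≠ d := fun h =>
  d.adj.ne' ((R.fst_rot d.symm).symm.trans (congrArg (fun d : G.Dart => d.fst) h))

/-- A face of length two would turn back at `b`, so that `b` has only one neighbour. -/
theorem next_next_ne [Finite V] (hd : ∀ v y, ∃ w, G.Adj v w ∧ w ≠ y) (d : G.Dart) :
    R.next (R.next d) ≠ d := by
  obtain ⟨⟨a, b⟩, h⟩ := d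
  intro h'
  obtain ⟨c, hc⟩ := R.exists_turn h.symm
  have h1 : R.next ⟨(a, b), h⟩ = ⟨(b, c), hc.adj_right⟩ := hc.rot_eq
  rw [h1] at h'
  have h2 := (R.fst_rot (SimpleGraph.Dart.symm ⟨(b, c), hc.adj_right⟩)).symm.trans
    (congrArg (fun d : G.Dart => d.fst) h')
  obtain rfl : c = a := h2
  obtain ⟨w, hw, hne⟩ := hd b c
  exact hne (eq_of_turn_self hc hw)

/-- If every vertex has two neighbours, then every face has at least three darts. -/
theorem three_mul_faceCount_le [Finite V] (R : RotationSystem G)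
    (hd : ∀ v y, ∃ w, G.Adj v w ∧ w ≠ y) :
    3 * R.faceCount ≤ Nat.card G.Dart ∧
      (3 * R.faceCount = Nat.card G.Dart → ∀ d, R.next (R.next (R.next d)) = d) := by
  classical
  have := Fintype.ofFinite G.Dart
  have hcard : Nat.card G.Dart = ∑ F ∈ Finset.univ.image R.faceOf,
      (Finset.univ.filter fun d => R.faceOf d = F).card := by
    rw [Nat.card_eq_fintype_card, ← Finset.card_univ]
    exact Finset.card_eq_sum_card_image _ _
  have hF : R.faceCount = (Finset.univ.image R.faceOf).card := by
    rw [faceCount, ← Set.ncard_coe_finset]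
    congr 1
    simp
  have h3 : ∀ d, ({d, R.next d, R.next (R.next d)} : Finset G.Dart).card = 3 := fun d =>
    Finset.card_eq_three.mpr ⟨_, _, _, (next_ne d).symm, (next_next_ne hd d).symm,
      (next_ne _).symm, rfl⟩
  have hsub : ∀ d, ({d, R.next d, R.next (R.next d)} : Finset G.Dart) ⊆
      Finset.univ.filter fun e => R.faceOf e = R.faceOf d := by
    intro d e he
    simp only [Finset.mem_insert, Finset.mem_singleton] at he
    rcases he with rfl | rfl | rfl <;> simp [faceOf_next]
  have hle : ∀ F ∈ Finset.univ.image R.faceOf,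
      3 ≤ (Finset.univ.filter fun d => R.faceOf d = F).card := by
    intro F hF
    obtain ⟨d, -, rfl⟩ := Finset.mem_image.mp hF
    rw [← h3 d]
    exact Finset.card_le_card (hsub d)
  have hsum := Finset.sum_le_sum hle
  rw [Finset.sum_const, smul_eq_mul, ← hF, ← hcard, mul_comm] at hsum
  refine ⟨hsum, fun heq d => ?_⟩
  have heq' : ∑ _F ∈ Finset.univ.image R.faceOf, 3 = ∑ F ∈ Finset.univ.image R.faceOf,
      (Finset.univ.filter fun d => R.faceOf d = F).card := by
    rw [Finset.sum_const, smul_eq_mul, ← hF, ← hcard, mul_comm, heq]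
  have h4 := (Finset.sum_eq_sum_iff_of_le hle).mp heq' (R.faceOf d)
    (Finset.mem_image_of_mem _ (Finset.mem_univ d))
  have h5 := Finset.eq_of_subset_of_card_le (hsub d) (by rw [h3, ← h4])
  have h6 : R.next (R.next (R.next d)) ∈ ({d, R.next d, R.next (R.next d)} : Finset G.Dart) := by
    rw [h5]
    simp [faceOf_next]
  simp only [Finset.mem_insert, Finset.mem_singleton] at h6
  rcases h6 with h6 | h6 | h6
  · exact h6
  · exact absurd (R.next.injective h6) (next_next_ne hd d)
  · exact absurd h6 (next_ne _)

end RotationSystem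

/-- A rotation system of the tetrahedron: around `v`, the vertex `t` is followed by
`tetrahedronNext v t`. -/
def tetrahedronNext : Fin 4 → Fin 4 → Fin 4 :=
  ![![0, 2, 3, 1], ![3, 1, 0, 2], ![1, 3, 2, 0], ![2, 0, 1, 3]]

-- There are twelve darts and each face has at least three, so at most four faces exist, and
-- planarity means that all faces are triangles. Then a single turn determines the embedding
-- (`heq`), and the two possible turns at one vertex are exchanged by reflection.
open RotationSystem in
theorem UniquelyEmbedded.of_iso {V : Type u} [Finite V] {G : SimpleGraph V}
    (e : G ≃g (⊤ : SimpleGraph (Fin 4))) : UniquelyEmbedded G := by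
  classical
  have hadj : ∀ {u w}, G.Adj u w ↔ u ≠ w := by
    intro u w
    rw [← e.map_adj_iff, SimpleGraph.top_adj, e.injective.ne_iff]
  have hV : Nat.card V = 4 := by
    rw [Nat.card_congr e.toEquiv, Nat.card_eq_fintype_card, Fintype.card_fin]
  have := Fintype.ofFinite V
  have hE : G.edgeFinset.card = 6 := by
    rw [e.card_edgeFinset_eq, SimpleGraph.card_edgeFinset_top_eq_card_choose_two]
    rfl
  have hE' : G.edgeSet.ncard = 6 := by
    rw [← hE, ← SimpleGraph.coe_edgeFinset, Set.ncard_coe_finset]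
  have hD : Nat.card G.Dart = 12 := by
    rw [Nat.card_eq_fintype_card, SimpleGraph.dart_card_eq_twice_card_edges, hE]
  have h4 : ∀ a b c : V, a ≠ b → b ≠ c → c ≠ a → ∃ d, d ≠ a ∧ d ≠ b ∧ d ≠ c ∧
      ∀ t, t = a ∨ t = b ∨ t = c ∨ t = d := by
    have : ∀ a b c : Fin 4, a ≠ b → b ≠ c → c ≠ a → ∃ d, d ≠ a ∧ d ≠ b ∧ d ≠ c ∧
      ∀ t, t = a ∨ t = b ∨ t = c ∨ t = d := by decide
    intro a b c hab hbc hca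
    obtain ⟨d, h1, h2, h3, h⟩ := this (e a) (e b) (e c) (e.injective.ne hab) (e.injective.ne hbc)
      (e.injective.ne hca)
    refine ⟨e.symm d, ?_, ?_, ?_, fun t => ?_⟩
    · exact fun h' => h1 (by rw [← h', e.apply_symm_apply])
    · exact fun h' => h2 (by rw [← h', e.apply_symm_apply])
    · exact fun h' => h3 (by rw [← h', e.apply_symm_apply])
    · rcases h (e t) with h | h | h | h
      · exact Or.inl (e.injective h)
      · exact Or.inr (Or.inl (e.injective h))
      · exact Or.inr (Or.inr (Or.inl (e.injective h)))
      · exact Or.inr (Or.inr (Or.inr (by rw [← h, e.symm_apply_apply])))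
  have h3 : ∀ v y z : V, ∃ w, G.Adj v w ∧ w ≠ y ∧ w ≠ z := by
    have : ∀ v y z : Fin 4, ∃ w, w ≠ v ∧ w ≠ y ∧ w ≠ z := by decide
    intro v y z
    obtain ⟨w, h1, h2, h3⟩ := this (e v) (e y) (e z)
    refine ⟨e.symm w, hadj.mpr ?_, ?_, ?_⟩
    · exact fun h' => h1 (by rw [h', e.apply_symm_apply])
    · exact fun h' => h2 (by rw [← h', e.apply_symm_apply])
    · exact fun h' => h3 (by rw [← h', e.apply_symm_apply])
  have hd : ∀ v y, ∃ w, G.Adj v w ∧ w ≠ y := fun v y => by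
    obtain ⟨w, hw, h, -⟩ := h3 v y y
    exact ⟨w, hw, h⟩
  have hc : G.Connected := by
    rw [SimpleGraph.connected_iff_exists_forall_reachable]
    refine ⟨e.symm 0, fun w => ?_⟩
    by_cases h : e.symm 0 = w
    · rw [h]
    · exact (hadj.mpr h).reachable
  have hb : EulerBound G := fun R => by
    have := (R.three_mul_faceCount_le hd).1
    omega
  have htri : ∀ R : RotationSystem G, R.IsPlanar → ∀ a b c, R.Turn b a c → R.TurnFace a b c := by
    intro R hR a b c h
    have h1 := (R.isPlanar_iff.mp hR).2
    have h2 := (R.three_mul_faceCount_le hd).2 (by omega) ⟨(a, b), h.adj_left.symm⟩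
    have n1 : R.next ⟨(a, b), h.adj_left.symm⟩ = ⟨(b, c), h.adj_right⟩ := h.rot_eq
    rw [n1] at h2
    obtain ⟨x, hx⟩ := R.exists_turn h.adj_right.symm
    have n2 : R.next ⟨(b, c), h.adj_right⟩ = ⟨(c, x), hx.adj_right⟩ := hx.rot_eq
    rw [n2] at h2
    obtain ⟨y, hy⟩ := R.exists_turn hx.adj_right.symm
    have n3 : R.next ⟨(c, x), hx.adj_right⟩ = ⟨(x, y), hy.adj_right⟩ := hy.rot_eq
    rw [n3] at h2
    obtain rfl : x = a := congrArg (fun d : G.Dart => d.fst) h2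
    obtain rfl : y = b := congrArg (fun d : G.Dart => d.snd) h2
    exact ⟨h, hx, hy⟩
  have hthree : ∀ (R : RotationSystem G) (v x y z : V), x ≠ v → y ≠ v → z ≠ v → x ≠ y → x ≠ z →
      y ≠ z → (∀ t, t = v ∨ t = x ∨ t = y ∨ t = z) →
      (R.Turn v x y ∧ R.Turn v y z ∧ R.Turn v z x) ∨
        (R.Turn v x z ∧ R.Turn v z y ∧ R.Turn v y x) := by
    intro R v x y z hx hy hz hxy hxz hyz h
    refine R.turn_three (fun t ht => ?_) (hadj.mpr hx.symm) (hadj.mpr hy.symm)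
      (hadj.mpr hz.symm) hxy hxz hyz
    have := h t
    have := ht.ne'
    tauto
  have heq : ∀ (R S : RotationSystem G), R.IsPlanar → S.IsPlanar → ∀ v x y, R.Turn v x y →
      S.Turn v x y → S = R := by
    intro R S hR hS v x y h h'
    have hvx := h.adj_left.ne
    have hvy := h.adj_right.ne
    have hxy : x ≠ y := by
      rintro rfl
      obtain ⟨w, hw, hne⟩ := hd v x
      exact hne (eq_of_turn_self h hw)
    obtain ⟨z, hzv, hzx, hzy, hall⟩ := h4 v x y hvx hxy hvy.symm
    -- Triangular faces carry the given turn to the other vertices, and degree three completes the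
    -- rotation at each of them; this accounts for all twelve turns.
    have key : ∀ T : RotationSystem G, T.IsPlanar → T.Turn v x y →
        (T.Turn v x y ∧ T.Turn v y z ∧ T.Turn v z x) ∧
        (T.Turn y v x ∧ T.Turn y x z ∧ T.Turn y z v) ∧
        (T.Turn x y v ∧ T.Turn x v z ∧ T.Turn x z y) ∧
        (T.Turn z y x ∧ T.Turn z x v ∧ T.Turn z v y) := by
      intro T hT ht
      have t1 := turn_three_of_turn (z := z) (fun t ht => by
        have := hall t
        have := ht.ne'
        tauto) (hadj.mpr hzv.symm) hzx hzy ht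
      have f1 := htri T hT _ _ _ ht
      have f2 := htri T hT _ _ _ t1.1
      have f3 := htri T hT _ _ _ t1.2
      have t2 := turn_three_of_turn (z := z) (fun t ht => by
        have := hall t
        have := ht.ne'
        tauto) (hadj.mpr hzy.symm) hzv hzx f1.2.1
      have t3 := turn_three_of_turn (z := z) (fun t ht => by
        have := hall t
        have := ht.ne'
        tauto) (hadj.mpr hzx.symm) hzy hzv f1.2.2
      exact ⟨⟨ht, t1⟩, ⟨f1.2.1, t2⟩, ⟨f1.2.2, t3⟩, ⟨(htri T hT _ _ _ t2.1).2.1, f3.2.2, f2.2.1⟩⟩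
    have hRk := key R hR h
    have hSk := key S hS h'
    have hRu : ∀ {v u w w'}, R.Turn v u w → R.Turn v u w' → w = w' := fun h h' =>
      h.right_unique h'
    refine eq_of_turn fun a b c hab => ?_
    have hne := hab.adj_left.ne
    rcases hall a with rfl | rfl | rfl | rfl <;> rcases hall b with rfl | rfl | rfl | rfl <;>
      first
      | exact absurd rfl hne
      | (obtain rfl := hRu hab hRk.1.1; exact hSk.1.1)
      | (obtain rfl := hRu hab hRk.1.2.1; exact hSk.1.2.1)
      | (obtain rfl := hRu hab hRk.1.2.2; exact hSk.1.2.2)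
      | (obtain rfl := hRu hab hRk.2.1.1; exact hSk.2.1.1)
      | (obtain rfl := hRu hab hRk.2.1.2.1; exact hSk.2.1.2.1)
      | (obtain rfl := hRu hab hRk.2.1.2.2; exact hSk.2.1.2.2)
      | (obtain rfl := hRu hab hRk.2.2.1.1; exact hSk.2.2.1.1)
      | (obtain rfl := hRu hab hRk.2.2.1.2.1; exact hSk.2.2.1.2.1)
      | (obtain rfl := hRu hab hRk.2.2.1.2.2; exact hSk.2.2.1.2.2)
      | (obtain rfl := hRu hab hRk.2.2.2.1; exact hSk.2.2.2.1)
      | (obtain rfl := hRu hab hRk.2.2.2.2.1; exact hSk.2.2.2.2.1)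
      | (obtain rfl := hRu hab hRk.2.2.2.2.2; exact hSk.2.2.2.2.2)
  refine ⟨hc, h3, hb, ?_, ?_, ?_⟩
  · let T : V → V → V → Prop := fun v t z => t ≠ v ∧ e z = tetrahedronNext (e v) (e t)
    have hT : ∀ v t, t ≠ v → T v t (e.symm (tetrahedronNext (e v) (e t))) := fun v t h =>
      ⟨h, e.apply_symm_apply _⟩
    have t1 : ∀ v t, t ≠ v → tetrahedronNext v t ≠ v := by decide
    have t2 : ∀ v t t', t ≠ v → t' ≠ v → tetrahedronNext v t = tetrahedronNext v t' →
      t = t' := by decide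
    have t3 : ∀ v t z, t ≠ v → z ≠ v → z = t ∨ z = tetrahedronNext v t ∨
      z = tetrahedronNext v (tetrahedronNext v t) := by decide
    have t4 : ∀ v t, t ≠ v → tetrahedronNext v (tetrahedronNext v t) =
      tetrahedronNext (tetrahedronNext v t) (tetrahedronNext (tetrahedronNext v t) v) := by decide
    have t5 : ∀ i, ∃ v t, t ≠ v ∧ tetrahedronNext t (tetrahedronNext t v) = i := by decide
    obtain ⟨R, hR⟩ := exists_of_relation (G := G) (T := T)
      (fun v u w h => hadj.mpr fun h' => t1 (e v) (e u) (e.injective.ne h.1) (by rw [← h.2, h']))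
      (fun v u h => ⟨_, hT v u h.ne'⟩)
      (fun v u w w' h h' => e.injective (h.2.trans h'.2.symm))
      (fun v u u' w h h' => e.injective (t2 (e v) (e u) (e u') (e.injective.ne h.1)
        (e.injective.ne h'.1) (h.2.symm.trans h'.2)))
      (fun v u w hu hw => by
        rcases t3 (e v) (e u) (e w) (e.injective.ne hu.ne') (e.injective.ne hw.ne') with h | h | h
        · rw [e.injective h]
        · exact .single ⟨hu.ne', h⟩
        · have h1 := hT v u hu.ne'
          refine (Relation.ReflTransGen.single h1).tail ⟨?_, ?_⟩
          · exact fun h' => t1 (e v) (e u) (e.injective.ne hu.ne')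
              ((e.apply_symm_apply _).symm.trans (congrArg e h'))
          · rw [e.apply_symm_apply, h])
    have hcount := R.ncard_range_le_faceCount
      -- The first application gives the third vertex of the face through `d`, the second one the
      -- vertex opposite to that face. Thus the faces are labelled with all four vertices.
      (f := fun d => tetrahedronNext (e d.snd) (tetrahedronNext (e d.snd) (e d.fst))) (by
        intro v t z h
        have h1 := hR v t _ h.adj_left (hT v t h.adj_left.ne')
        obtain rfl := h.right_unique h1
        dsimp only
        rw [e.apply_symm_apply]
        exact (t4 (e v) (e t) (e.injective.ne h.adj_left.ne')).symm)
    rw [Set.range_eq_univ.mpr, Set.ncard_univ, Nat.card_eq_fintype_card, Fintype.card_fin] at hcount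
    · have := hb R
      exact ⟨R, R.isPlanar_iff.mpr ⟨hc, by omega⟩⟩
    · intro i
      obtain ⟨v, t, hvt, h⟩ := t5 i
      refine ⟨⟨(e.symm v, e.symm t), hadj.mpr (e.symm.injective.ne hvt.symm)⟩, ?_⟩
      simpa using h
  · intro R S hR hS
    obtain ⟨x, hx, -⟩ := h3 (e.symm 0) (e.symm 0) (e.symm 0)
    obtain ⟨y, hy⟩ := R.exists_turn hx
    have hxy : x ≠ y := by
      rintro rfl
      obtain ⟨w, hw, hne⟩ := hd (e.symm 0) x
      exact hne (eq_of_turn_self hy hw)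
    obtain ⟨z, h1, h2, h5, hall⟩ := h4 _ x y hx.ne hxy hy.adj_right.ne'
    rcases hthree S _ x y z hx.ne' hy.adj_right.ne' h1 hxy h2.symm h5.symm hall with h | h
    · exact Or.inl (heq R S hR hS _ _ _ hy h.1)
    · right
      have := heq R S.mirror hR hS.mirror _ _ _ hy (turn_mirror.mpr h.2.2)
      rw [← this, mirror_mirror]
  · intro R hR a b c hab hbc hca
    obtain ⟨d, h1, h2, h5, hall⟩ := h4 a b c hab.ne hbc.ne hca.ne
    rcases hthree R b a c d hab.ne hbc.ne' h2 hca.ne' h1.symm h5.symm (fun t => by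
      have := hall t
      tauto) with h | h
    · exact Or.inl (htri R hR _ _ _ h.1)
    · exact Or.inr (htri R.mirror hR.mirror _ _ _ (turn_mirror.mpr h.2.2))

/-- Finiteness stands behind the colon because the vertex type changes in the induction. -/
theorem D3Reducible.uniquelyEmbedded {V : Type u} {G : SimpleGraph V}
    (h : D3Reducible G) : Finite V → UniquelyEmbedded G := by
  induction h with
  | base G e => exact fun _ => UniquelyEmbedded.of_iso e
  | triangle G p q r h _ ih =>
    intro _
    obtain ⟨T⟩ := h.nonempty_triangleExpansion
    exact T.uniquelyEmbedded (ih inferInstance)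
  | path G p q r h _ ih =>
    intro _
    obtain ⟨C, x, y, ha, hxb, hxs, hb, hya, hys⟩ := h.exists_subdividedChord
    exact C.uniquelyEmbedded (ih inferInstance) ha hxb hxs hb hya hys

/-! ### Segments and cones. -/

section Segments

variable {E : Type*} [NormedAddCommGroup E] [NormedSpace ℝ E]

/-- Two segments from `a` with a second common point point in the same direction, so one of them
contains the far end of the other. -/
theorem eq_of_mem_segment_of_mem_segment {a b c x : E} (hb : b ∉ segment ℝ a c)
    (hc : c ∉ segment ℝ a b) (h : x ∈ segment ℝ a b) (h' : x ∈ segment ℝ a c) : x = a := by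
  rw [segment_eq_image'] at *
  obtain ⟨s, ⟨hs0, hs1⟩, rfl⟩ := h
  obtain ⟨t, ⟨ht0, ht1⟩, hst⟩ := h'
  have hst : t • (c - a) = s • (b - a) := add_left_cancel hst
  rcases hs0.eq_or_lt with rfl | hs
  · show a + (0 : ℝ) • (b - a) = a
    simp
  rcases ht0.eq_or_lt with rfl | ht
  · show a + s • (b - a) = a
    rw [← hst]
    simp
  rcases le_total s t with h | h
  · refine absurd ⟨s / t, ⟨by positivity, (div_le_one ht).mpr h⟩, ?_⟩ hc
    show a + (s / t) • (b - a) = c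
    rw [div_eq_inv_mul, mul_smul, ← hst, smul_smul, inv_mul_cancel₀ ht.ne']
    simp
  · refine absurd ⟨t / s, ⟨by positivity, (div_le_one hs).mpr h⟩, ?_⟩ hb
    show a + (t / s) • (c - a) = b
    rw [div_eq_inv_mul, mul_smul, hst, smul_smul, inv_mul_cancel₀ hs.ne']
    simp

theorem segment_subset_segment_left {a b m : E} (h : m ∈ segment ℝ a b) :
    segment ℝ m a ⊆ segment ℝ a b :=
  (convex_segment a b).segment_subset h (left_mem_segment ℝ a b)

theorem segment_subset_segment_right {a b m : E} (h : m ∈ segment ℝ a b) :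
    segment ℝ m b ⊆ segment ℝ a b :=
  (convex_segment a b).segment_subset h (right_mem_segment ℝ a b)

theorem left_notMem_segment {a b m : E} (h : m ∈ segment ℝ a b) (hm : m ≠ a) :
    a ∉ segment ℝ m b := by
  intro h'
  rw [segment_eq_image'] at h h'
  obtain ⟨s, ⟨hs0, hs1⟩, rfl⟩ := h
  obtain ⟨t, ⟨ht0, ht1⟩, ht⟩ := h'
  have hs : s ≠ 0 := by
    rintro rfl
    simp at hm
  have hba : b - a ≠ 0 := by
    intro h
    simp [h] at hm
  have h1 : (s + t * (1 - s)) • (b - a) = 0 := by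
    have : (s + t * (1 - s)) • (b - a) =
        (a + s • (b - a) + t • (b - (a + s • (b - a)))) - a := by module
    rw [this]
    exact sub_eq_zero.mpr ht
  have h2 := (smul_eq_zero.mp h1).resolve_right hba
  have h3 : 0 < s := lt_of_le_of_ne hs0 hs.symm
  nlinarith [mul_nonneg ht0 (sub_nonneg.mpr hs1)]

theorem right_notMem_segment {a b m : E} (h : m ∈ segment ℝ a b) (hm : m ≠ b) :
    b ∉ segment ℝ m a :=
  left_notMem_segment (segment_symm ℝ a b ▸ h) hm

/-- A segment that avoids a closed set still does so after a small motion of one end. -/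
theorem eventually_disjoint_segment {K : Set E} (hK : IsClosed K) {a s : E} (w : E)
    (h : Disjoint K (segment ℝ a s)) :
    ∀ᶠ ε in nhds (0 : ℝ), Disjoint K (segment ℝ (a + ε • w) s) := by
  -- Compactness of the parameter interval makes the bound on `ε` uniform along the segment.
  have key := isCompact_Icc.eventually_forall_of_forall_eventually (x₀ := (0 : ℝ))
    (K := Set.Icc (0 : ℝ) 1)
    (P := fun ε t => (a + ε • w) + t • (s - (a + ε • w)) ∈ Kᶜ) (fun t ht => by
      have hc : Continuous fun z : ℝ × ℝ => (a + z.1 • w) + z.2 • (s - (a + z.1 • w)) := by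
        fun_prop
      refine hc.continuousAt.eventually_mem (hK.isOpen_compl.mem_nhds ?_)
      intro hmem
      refine Set.disjoint_left.mp h hmem ?_
      rw [segment_eq_image']
      exact ⟨t, ht, by simp⟩)
  filter_upwards [key] with ε hε
  rw [Set.disjoint_right, segment_eq_image']
  rintro _ ⟨t, ht, rfl⟩
  exact hε t ht

/-- With `s` a negative multiple of `a`, the relation makes `l • b` a nonnegative multiple of `a`.
This contradicts `hba` if `l` is positive, and `hne` if `l` vanishes. -/
theorem false_of_opposite {a b s : E} (hba : ∀ k : ℝ, 0 ≤ k → b ≠ k • a) {k τ l m : ℝ}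
    (hk : 0 < k) (ha : a = -k • s) (hτ : 0 ≤ τ) (hl : 0 ≤ l) (hm : 0 ≤ m)
    (h : τ • a = l • b + m • s) (hne : l = 0 → m ≠ 0) (hs : s ≠ 0) : False := by
  have hs' : s = -k⁻¹ • a := by
    rw [ha, smul_smul, neg_mul_neg, inv_mul_cancel₀ hk.ne', one_smul]
  have h1 : l • b = (τ + m * k⁻¹) • a := by
    have : l • b = τ • a - m • s := by rw [h]; module
    rw [this, show m • s = m • (-k⁻¹ • a) by rw [← hs']]
    module
  rcases hl.eq_or_lt with rfl | hl
  · have ha0 : a ≠ 0 := by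
      rw [ha]
      exact smul_ne_zero (neg_ne_zero.mpr hk.ne') hs
    rw [zero_smul] at h1
    have h2 := (smul_eq_zero.mp h1.symm).resolve_right ha0
    have h3 : 0 < m := lt_of_le_of_ne hm (hne rfl).symm
    have : 0 < m * k⁻¹ := by positivity
    linarith
  · refine hba ((τ + m * k⁻¹) / l) (by positivity) ?_
    rw [div_eq_inv_mul, mul_smul, ← h1, smul_smul, inv_mul_cancel₀ hl.ne', one_smul]

theorem false_of_cone_degenerate {a b s : E} (hs : s ≠ 0) (ha : a ≠ 0)
    (hba : ∀ k : ℝ, 0 ≤ k → b ≠ k • a) {l m τ₂ l₂ m₂ : ℝ} (hl : 0 ≤ l) (hm : 0 ≤ m)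
    (hτ₂ : 0 ≤ τ₂) (hl₂ : 0 ≤ l₂) (hm₂ : 0 ≤ m₂) (h : l • a + m • s = 0) (hne : l = 0 → m ≠ 0)
    (h₂ : τ₂ • a = l₂ • b + m₂ • s) (hne₂ : l₂ = 0 → m₂ ≠ 0) : False := by
  rcases hl.eq_or_lt with rfl | hl
  · exact smul_ne_zero (hne rfl) hs (by simpa using h)
  rcases hm.eq_or_lt with rfl | hm
  · exact smul_ne_zero hl.ne' ha (by simpa using h)
  refine false_of_opposite hba (k := m / l) (by positivity) ?_ hτ₂ hl₂ hm₂ h₂ hne₂ hs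
  rw [neg_smul, div_eq_inv_mul, mul_smul, ← smul_neg, ← eq_neg_of_add_eq_zero_left h, smul_smul,
    inv_mul_cancel₀ hl.ne', one_smul]

/-- Of three directions that are pairwise not parallel, one of the first two does not lie in the
cone that is spanned by the other two. -/
theorem not_mem_cone_or {a b s : E} (hs : s ≠ 0) (hab : ∀ k : ℝ, 0 ≤ k → a ≠ k • b)
    (hba : ∀ k : ℝ, 0 ≤ k → b ≠ k • a) (has : ∀ k : ℝ, 0 ≤ k → a ≠ k • s) :
    (∀ τ l m : ℝ, 0 ≤ τ → 0 ≤ l → 0 ≤ m → τ • b = l • a + m • s → l = 0 ∧ m = 0) ∨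
      (∀ τ l m : ℝ, 0 ≤ τ → 0 ≤ l → 0 ≤ m → τ • a = l • b + m • s → l = 0 ∧ m = 0) := by
  by_contra hcon
  push Not at hcon
  obtain ⟨⟨τ, l, m, hτ, hl, hm, h, hne⟩, τ₂, l₂, m₂, hτ₂, hl₂, hm₂, h₂, hne₂⟩ := hcon
  have ha : a ≠ 0 := by simpa using hab 0 le_rfl
  have hb : b ≠ 0 := by simpa using hba 0 le_rfl
  rcases hτ.eq_or_lt with rfl | hτ
  · exact false_of_cone_degenerate hs ha hba hl hm hτ₂ hl₂ hm₂ (by rw [← h, zero_smul]) hne h₂ hne₂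
  rcases hτ₂.eq_or_lt with rfl | hτ₂
  · exact false_of_cone_degenerate hs hb hab hl₂ hm₂ hτ.le hl hm (by rw [← h₂, zero_smul]) hne₂ h
      hne
  -- Elimination of `b` from the two relations. According to the sign of the coefficient, `a` is
  -- opposite to `s` (or zero), a multiple of `b`, or a nonnegative multiple of `s`.
  have h3 : (τ * τ₂ - l * l₂) • a = (l₂ * m + m₂ * τ) • s := by
    have e1 : (τ * τ₂) • a = (l₂ * τ) • b + (m₂ * τ) • s := by
      rw [mul_smul, h₂]
      module
    have e2 : (l₂ * τ) • b = (l₂ * l) • a + (l₂ * m) • s := by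
      rw [mul_smul, h]
      module
    rw [sub_smul, e1, e2]
    module
  rcases lt_trichotomy (τ * τ₂ - l * l₂) 0 with hD | hD | hD
  · have h4 : a = -((l₂ * m + m₂ * τ) / (l * l₂ - τ * τ₂)) • s := by
      have : -((l₂ * m + m₂ * τ) / (l * l₂ - τ * τ₂)) =
          (τ * τ₂ - l * l₂)⁻¹ * (l₂ * m + m₂ * τ) := by
        rw [← neg_sub (τ * τ₂), div_neg, neg_neg, div_eq_inv_mul]
      rw [this, mul_smul, ← h3, smul_smul, inv_mul_cancel₀ hD.ne, one_smul]
    have hD' : 0 < l * l₂ - τ * τ₂ := by linarith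
    have h5 : 0 ≤ (l₂ * m + m₂ * τ) / (l * l₂ - τ * τ₂) := by positivity
    rcases h5.eq_or_lt with h6 | h6
    · rw [← h6] at h4
      exact ha (by simpa using h4)
    · exact false_of_opposite hba h6 h4 hτ₂.le hl₂ hm₂ h₂ hne₂ hs
  · rw [hD, zero_smul] at h3
    have h4 := (smul_eq_zero.mp h3.symm).resolve_right hs
    have h5 : 0 ≤ l₂ * m := by positivity
    have h6 : m₂ = 0 := by
      rcases hm₂.eq_or_lt with h | h'
      · exact h.symm
      · have := mul_pos h' hτ
        linarith
    subst h6
    refine hab (τ₂⁻¹ * l₂) (by positivity) ?_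
    rw [mul_smul, show l₂ • b = τ₂ • a by rw [h₂]; simp, smul_smul, inv_mul_cancel₀ hτ₂.ne',
      one_smul]
  · refine has ((τ * τ₂ - l * l₂)⁻¹ * (l₂ * m + m₂ * τ)) (by positivity) ?_
    rw [mul_smul, ← h3, smul_smul, inv_mul_cancel₀ hD.ne', one_smul]

end Segments

/-! ### Straight-line drawings, and the base case of planarity. -/

/-- The straight-line drawing of `G` with the vertex positions `pos` has no crossings. -/
structure StraightDrawing {V E : Type*} [NormedAddCommGroup E] [NormedSpace ℝ E]
    (G : SimpleGraph V) (pos : V → E) : Prop where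
  inj : Function.Injective pos
  vert : ∀ {a b v}, G.Adj a b → v ≠ a → v ≠ b → pos v ∉ segment ℝ (pos a) (pos b)
  edge : ∀ {a b c d}, G.Adj a b → G.Adj c d → a ≠ c → a ≠ d → b ≠ c → b ≠ d →
    Disjoint (segment ℝ (pos a) (pos b)) (segment ℝ (pos c) (pos d))

namespace StraightDrawing

variable {V : Type*} {E : Type*} [NormedAddCommGroup E] [NormedSpace ℝ E] {G : SimpleGraph V}
  {pos : V → E}

/-- It suffices to treat the edges of one kind, and those of the other kind in one direction. -/
theorem of_cover {P N : V → V → Prop} (hadj : ∀ {a b}, G.Adj a b → P a b ∨ N a b ∨ N b a)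
    (inj : Function.Injective pos)
    (vertP : ∀ {a b v}, P a b → v ≠ a → v ≠ b → pos v ∉ segment ℝ (pos a) (pos b))
    (vertN : ∀ {a b v}, N a b → v ≠ a → v ≠ b → pos v ∉ segment ℝ (pos a) (pos b))
    (edgePP : ∀ {a b c d}, P a b → P c d → a ≠ c → a ≠ d → b ≠ c → b ≠ d →
      Disjoint (segment ℝ (pos a) (pos b)) (segment ℝ (pos c) (pos d)))
    (edgePN : ∀ {a b c d}, P a b → N c d → a ≠ c → a ≠ d → b ≠ c → b ≠ d →
      Disjoint (segment ℝ (pos a) (pos b)) (segment ℝ (pos c) (pos d)))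
    (edgeNN : ∀ {a b c d}, N a b → N c d → a ≠ c → a ≠ d → b ≠ c → b ≠ d →
      Disjoint (segment ℝ (pos a) (pos b)) (segment ℝ (pos c) (pos d))) :
    StraightDrawing G pos where
  inj := inj
  vert {a b v} h ha hb := by
    rcases hadj h with h | h | h
    · exact vertP h ha hb
    · exact vertN h ha hb
    · rw [segment_symm]
      exact vertN h hb ha
  edge {a b c d} h h' h1 h2 h3 h4 := by
    rcases hadj h with h | h | h <;> rcases hadj h' with h' | h' | h'
    · exact edgePP h h' h1 h2 h3 h4
    · exact edgePN h h' h1 h2 h3 h4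
    · rw [segment_symm ℝ (pos c)]
      exact edgePN h h' h2 h1 h4 h3
    · exact (edgePN h' h h1.symm h3.symm h2.symm h4.symm).symm
    · exact edgeNN h h' h1 h2 h3 h4
    · rw [segment_symm ℝ (pos c)]
      exact edgeNN h h' h2 h1 h4 h3
    · rw [segment_symm ℝ (pos a)]
      exact (edgePN h' h h3.symm h1.symm h4.symm h2.symm).symm
    · rw [segment_symm ℝ (pos a)]
      exact edgeNN h h' h3 h4 h1 h2
    · rw [segment_symm ℝ (pos a), segment_symm ℝ (pos c)]
      exact edgeNN h h' h4 h3 h2 h1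

theorem eq_of_mem_of_mem (D : StraightDrawing G pos) {a b c : V} {x : E} (hb : G.Adj a b)
    (hc : G.Adj a c) (hbc : b ≠ c) (h : x ∈ segment ℝ (pos a) (pos b))
    (h' : x ∈ segment ℝ (pos a) (pos c)) : x = pos a :=
  eq_of_mem_segment_of_mem_segment (D.vert hc hb.ne' hbc) (D.vert hb hc.ne' hbc.symm) h h'

/-- Two edges meet only in a common end. -/
theorem inter (D : StraightDrawing G pos) {a b c d : V} {x : E} (hab : G.Adj a b)
    (hcd : G.Adj c d) (hne : s(a, b) ≠ s(c, d)) (h : x ∈ segment ℝ (pos a) (pos b))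
    (h' : x ∈ segment ℝ (pos c) (pos d)) :
    ∃ v, (v = a ∨ v = b) ∧ (v = c ∨ v = d) ∧ x = pos v := by
  by_cases h1 : a = c
  · subst h1
    exact ⟨a, .inl rfl, .inl rfl, D.eq_of_mem_of_mem hab hcd (fun e => hne (by rw [e])) h h'⟩
  by_cases h2 : a = d
  · subst h2
    rw [segment_symm] at h'
    exact ⟨a, .inl rfl, .inr rfl,
      D.eq_of_mem_of_mem hab hcd.symm (fun e => hne (by rw [e, Sym2.eq_swap])) h h'⟩
  by_cases h3 : b = c
  · subst h3
    rw [segment_symm] at h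
    exact ⟨b, .inr rfl, .inl rfl,
      D.eq_of_mem_of_mem hab.symm hcd (fun e => hne (by rw [e, Sym2.eq_swap])) h h'⟩
  by_cases h4 : b = d
  · subst h4
    rw [segment_symm] at h h'
    exact ⟨b, .inr rfl, .inr rfl,
      D.eq_of_mem_of_mem hab.symm hcd.symm (fun e => hne (by rw [e])) h h'⟩
  · exact absurd h' (Set.disjoint_left.mp (D.edge hab hcd h1 h2 h3 h4) h)

end StraightDrawing

/-- A graph with a straight-line drawing in the plane is planar. -/
theorem StraightDrawing.planarGraph {V : Type u} {G : SimpleGraph V}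
    {pos : V → EuclideanSpace ℝ (Fin 2)} (D : StraightDrawing G pos) : PlanarGraph G := by
  refine ⟨⟨pos, D.inj, Sym2.lift ⟨fun a b => segment ℝ (pos a) (pos b),
    fun a b => segment_symm ℝ (pos a) (pos b)⟩, ?_, ?_, ?_⟩⟩
  · intro a b hab
    have hc : Continuous fun t : unitInterval => AffineMap.lineMap (k := ℝ) (pos a) (pos b)
        (t : ℝ) := AffineMap.lineMap_continuous.comp continuous_subtype_val
    refine ⟨⟨⟨_, hc⟩, by simp, by simp⟩, ?_, ?_⟩
    · intro s t h
      exact Subtype.ext (AffineMap.lineMap_injective ℝ (D.inj.ne hab.ne) h)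
    · show _ = segment ℝ (pos a) (pos b)
      rw [segment_eq_image_lineMap]
      ext x
      constructor
      · rintro ⟨t, rfl⟩
        exact ⟨t, t.2, rfl⟩
      · rintro ⟨t, ht, rfl⟩
        exact ⟨⟨t, ht⟩, rfl⟩
  · intro e he v hv
    induction e with | _ a b
    by_contra h
    rw [Sym2.mem_iff, not_or] at h
    exact D.vert he h.1 h.2 hv
  · intro e he f hf hne x hx hx'
    induction e with | _ a b
    induction f with | _ c d
    obtain ⟨v, h1, h2, h3⟩ := D.inter he hf hne hx hx'
    exact ⟨v, Sym2.mem_iff.mpr h1, Sym2.mem_iff.mpr h2, h3⟩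

theorem exists_straightDrawing_of_iso {V : Type u} {G : SimpleGraph V}
    (e : G ≃g (⊤ : SimpleGraph (Fin 4))) :
    ∃ pos : V → EuclideanSpace ℝ (Fin 2), StraightDrawing G pos := by
  -- Three corners of a triangle and the interior point `(1, 1)`.
  let X : Fin 4 → ℝ := ![0, 4, 0, 1]
  let Y : Fin 4 → ℝ := ![0, 0, 4, 1]
  let p : Fin 4 → EuclideanSpace ℝ (Fin 2) := fun i => !₂[X i, Y i]
  have hseg : ∀ {x : EuclideanSpace ℝ (Fin 2)} {i j : Fin 4}, x ∈ segment ℝ (p i) (p j) →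
      ∃ r : ℝ, 0 ≤ r ∧ r ≤ 1 ∧ x 0 = X i + r * (X j - X i) ∧ x 1 = Y i + r * (Y j - Y i) := by
    intro x i j h
    rw [segment_eq_image'] at h
    obtain ⟨r, ⟨h0, h1⟩, rfl⟩ := h
    exact ⟨r, h0, h1, by simp [p], by simp [p]⟩
  have hp : ∀ i j, p i = p j → i = j := by
    intro i j h
    have h0 : X i = X j := by simpa [p] using congrArg (fun x => x 0) h
    have h1 : Y i = Y j := by simpa [p] using congrArg (fun x => x 1) h
    fin_cases i <;> fin_cases j <;> simp [X, Y] at h0 h1 ⊢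
  have hv : ∀ i j k, i ≠ j → k ≠ i → k ≠ j → p k ∉ segment ℝ (p i) (p j) := by
    intro i j k hij hki hkj h
    obtain ⟨r, hr0, hr1, h0, h1⟩ := hseg h
    have e0 : p k 0 = X k := by simp [p]
    have e1 : p k 1 = Y k := by simp [p]
    rw [e0] at h0
    rw [e1] at h1
    fin_cases i <;> fin_cases j <;> first | exact hij rfl | skip
    all_goals fin_cases k <;> first | exact hki rfl | exact hkj rfl | skip
    all_goals
      simp [X, Y] at h0 h1
      try linarith
  have he : ∀ i j k l, i ≠ j → k ≠ l → i ≠ k → i ≠ l → j ≠ k → j ≠ l →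
      Disjoint (segment ℝ (p i) (p j)) (segment ℝ (p k) (p l)) := by
    intro i j k l hij hkl hik hil hjk hjl
    rw [Set.disjoint_left]
    intro x h h'
    obtain ⟨r, hr0, hr1, h0, h1⟩ := hseg h
    obtain ⟨t, ht0, ht1, h0', h1'⟩ := hseg h'
    rw [h0] at h0'
    rw [h1] at h1'
    fin_cases i <;> fin_cases j <;> first | exact hij rfl | skip
    all_goals fin_cases k <;> first | exact hik rfl | exact hjk rfl | skip
    all_goals fin_cases l <;> first | exact hil rfl | exact hjl rfl | exact hkl rfl | skip
    all_goals
      simp [X, Y] at h0' h1'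
      try linarith
  refine ⟨p ∘ e, fun a b h => e.injective (hp _ _ h), ?_, ?_⟩
  · intro a b v h h1 h2
    exact hv _ _ _ (e.injective.ne h.ne) (e.injective.ne h1) (e.injective.ne h2)
  · intro a b c d h h' h1 h2 h3 h4
    exact he _ _ _ _ (e.injective.ne h.ne) (e.injective.ne h'.ne) (e.injective.ne h1)
      (e.injective.ne h2) (e.injective.ne h3) (e.injective.ne h4)

/-! ### Path reductions of straight-line drawings. -/

namespace SubdividedChord

variable {V V' : Type u} {G : SimpleGraph V} {G' : SimpleGraph V'} (C : SubdividedChord G G')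
  {E : Type*} [NormedAddCommGroup E] [NormedSpace ℝ E] {pos' : V' → E}

/-- For `ε = 0` the segment is the edge `as`, which avoids all these vertices and edges. Finitely
many such conditions persist for small `ε`. -/
theorem exists_point [Finite V'] (D : StraightDrawing G' pos') (has : G'.Adj C.a C.s) :
    ∃ ε : ℝ, 0 < ε ∧ ε < 1 ∧
      (∀ u, u ≠ C.a → u ≠ C.s → pos' u ∉
        segment ℝ (pos' C.a + ε • (pos' C.b - pos' C.a)) (pos' C.s)) ∧
      ∀ u w, G'.Adj u w → u ≠ C.a → u ≠ C.s → w ≠ C.a → w ≠ C.s →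
        Disjoint (segment ℝ (pos' u) (pos' w))
          (segment ℝ (pos' C.a + ε • (pos' C.b - pos' C.a)) (pos' C.s)) := by
  have h1 : ∀ᶠ ε in nhds (0 : ℝ), ∀ u, u ≠ C.a → u ≠ C.s → Disjoint {pos' u}
      (segment ℝ (pos' C.a + ε • (pos' C.b - pos' C.a)) (pos' C.s)) := by
    rw [Filter.eventually_all]
    intro u
    by_cases hu : u ≠ C.a ∧ u ≠ C.s
    · filter_upwards [eventually_disjoint_segment (K := {pos' u}) isClosed_singleton
        (pos' C.b - pos' C.a) (Set.disjoint_singleton_left.mpr (D.vert has hu.1 hu.2))]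
        with ε h _ _ using h
    · exact .of_forall fun _ h h' => absurd ⟨h, h'⟩ hu
  have h2 : ∀ᶠ ε in nhds (0 : ℝ), ∀ z : V' × V', G'.Adj z.1 z.2 → z.1 ≠ C.a → z.1 ≠ C.s →
      z.2 ≠ C.a → z.2 ≠ C.s → Disjoint (segment ℝ (pos' z.1) (pos' z.2))
        (segment ℝ (pos' C.a + ε • (pos' C.b - pos' C.a)) (pos' C.s)) := by
    rw [Filter.eventually_all]
    intro z
    by_cases hz : G'.Adj z.1 z.2 ∧ z.1 ≠ C.a ∧ z.1 ≠ C.s ∧ z.2 ≠ C.a ∧ z.2 ≠ C.s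
    · have hK : IsClosed (segment ℝ (pos' z.1) (pos' z.2)) := by
        rw [segment_eq_image']
        exact (isCompact_Icc.image (by fun_prop)).isClosed
      filter_upwards [eventually_disjoint_segment hK (pos' C.b - pos' C.a)
        (D.edge hz.1 has hz.2.1 hz.2.2.1 hz.2.2.2.1 hz.2.2.2.2)] with ε h _ _ _ _ _ using h
    · exact .of_forall fun _ h h' h3 h4 h5 => absurd ⟨h, h', h3, h4, h5⟩ hz
  have h3 : ∀ᶠ ε in nhdsWithin (0 : ℝ) (Set.Ioi 0), 0 < ε ∧ ε < 1 :=
    Ioo_mem_nhdsGT one_pos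
  obtain ⟨ε, ⟨h0, h0'⟩, h1, h2⟩ := (h3.and ((h1.and h2).filter_mono nhdsWithin_le_nhds)).exists
  exact ⟨ε, h0, h0', fun u h h' => Set.disjoint_singleton_left.mp (h1 u h h'),
    fun u w => h2 (u, w)⟩

/-- A straight-line drawing of `G'` extends to one of `G`, if the directions of the edges at `a`
are as they should be. -/
theorem exists_straightDrawing_of_cone [Finite V'] (D : StraightDrawing G' pos') {x : V'}
    (hN : ∀ w, G'.Adj C.a w ↔ w = C.b ∨ w = C.s ∨ w = x)
    (hcone : ∀ τ l m : ℝ, 0 ≤ τ → 0 ≤ l → 0 ≤ m → τ • (pos' x - pos' C.a) =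
      l • (pos' C.b - pos' C.a) + m • (pos' C.s - pos' C.a) → l = 0 ∧ m = 0) :
    ∃ pos : V → E, StraightDrawing G pos := by
  have has : G'.Adj C.a C.s := (hN _).mpr (.inr (.inl rfl))
  obtain ⟨ε, hε0, hε1, hvert, hedge⟩ := C.exists_point D has
  set M := pos' C.a + ε • (pos' C.b - pos' C.a) with hM
  have hMmem : M ∈ segment ℝ (pos' C.a) (pos' C.b) := by
    rw [segment_eq_image']
    exact ⟨ε, ⟨hε0.le, hε1.le⟩, rfl⟩
  have hba : pos' C.b - pos' C.a ≠ 0 := sub_ne_zero.mpr (D.inj.ne C.adj_ab.ne')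
  have hMa : M ≠ pos' C.a := by
    rw [hM, Ne, add_eq_left]
    exact smul_ne_zero hε0.ne' hba
  have hMb : M ≠ pos' C.b := by
    intro h
    have : (1 - ε) • (pos' C.b - pos' C.a) = 0 := by
      have : (1 - ε) • (pos' C.b - pos' C.a) = pos' C.b - M := by rw [hM]; module
      rw [this, h, sub_self]
    exact smul_ne_zero (by linarith) hba this
  have hMne : ∀ u, pos' u ≠ M := by
    intro u h
    by_cases h1 : u = C.a
    · exact hMa (by rw [← h, h1])
    by_cases h2 : u = C.b
    · exact hMb (by rw [← h, h2])
    · exact D.vert C.adj_ab h1 h2 (h ▸ hMmem)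
  -- Relative to `a`, a point of the segment `Ms` is a nonnegative combination of the directions to
  -- `b` and `s`, not with both coefficients zero. The value `τ = 0` shows that the segment misses
  -- `a` itself.
  have hray : ∀ τ : ℝ, 0 ≤ τ →
      pos' C.a + τ • (pos' x - pos' C.a) ∉ segment ℝ M (pos' C.s) := by
    intro τ hτ h
    rw [segment_eq_image'] at h
    obtain ⟨t, ⟨ht0, ht1⟩, ht⟩ := h
    have h1 : τ • (pos' x - pos' C.a) =
        ((1 - t) * ε) • (pos' C.b - pos' C.a) + t • (pos' C.s - pos' C.a) := by
      have : τ • (pos' x - pos' C.a) = (M + t • (pos' C.s - M)) - pos' C.a := by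
        rw [show M + t • (pos' C.s - M) = _ from ht]
        abel
      rw [this, hM]
      module
    obtain ⟨h2, rfl⟩ := hcone τ _ t hτ (mul_nonneg (by linarith) hε0.le) ht0 h1
    simp [hε0.ne'] at h2
  set pos : V → E := Function.extend C.vert pos' fun _ => M with hpos
  have hposv : ∀ u, pos (C.vert u) = pos' u := C.vert_injective.extend_apply _ _
  have hposm : pos C.m = M := Function.extend_apply' _ _ _ fun ⟨u, hu⟩ => C.vert_ne u hu
  have hMleft := segment_subset_segment_left hMmem
  have hMright := segment_subset_segment_right hMmem
  have ha : pos' C.a ∉ segment ℝ M (pos' C.b) := left_notMem_segment hMmem hMa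
  have hb : pos' C.b ∉ segment ℝ M (pos' C.a) := right_notMem_segment hMmem hMb
  refine ⟨pos, .of_cover
    (P := fun z t => ∃ u w, C.vert u = z ∧ C.vert w = t ∧ G'.Adj u w ∧ s(u, w) ≠ s(C.a, C.b))
    (N := fun z t => z = C.m ∧ (t = C.vert C.a ∨ t = C.vert C.b ∨ t = C.vert C.s))
    ?_ ?_ ?_ ?_ ?_ ?_ ?_⟩
  · intro z t h
    rcases C.eq_or z with rfl | ⟨u, rfl⟩
    · exact .inr (.inl ⟨rfl, C.adj_m_iff.mp h⟩)
    rcases C.eq_or t with rfl | ⟨w, rfl⟩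
    · exact .inr (.inr ⟨rfl, C.adj_m_iff.mp h.symm⟩)
    · exact .inl ⟨u, w, rfl, rfl, C.adj_iff.mp h⟩
  · intro z t h
    rcases C.eq_or z with rfl | ⟨u, rfl⟩ <;> rcases C.eq_or t with rfl | ⟨w, rfl⟩
    · rfl
    · rw [hposm, hposv] at h
      exact absurd h.symm (hMne w)
    · rw [hposm, hposv] at h
      exact absurd h (hMne u)
    · rw [hposv, hposv] at h
      rw [D.inj h]
  · rintro _ _ v ⟨u, w, rfl, rfl, h, hne⟩ h1 h2
    rw [hposv, hposv]
    rcases C.eq_or v with rfl | ⟨v, rfl⟩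
    · rw [hposm]
      intro h3
      obtain ⟨v, -, -, h4⟩ := D.inter h C.adj_ab hne h3 hMmem
      exact hMne v h4.symm
    · rw [hposv]
      exact D.vert h (fun e => h1 (by rw [e])) (fun e => h2 (by rw [e]))
  · rintro _ _ v ⟨rfl, h⟩ h1 h2
    obtain ⟨v, rfl⟩ := (C.eq_or v).resolve_left h1
    rw [hposm, hposv]
    rcases h with rfl | rfl | rfl <;> rw [hposv] <;> rw [C.vert_injective.ne_iff] at h2
    · by_cases h3 : v = C.b
      · rwa [h3]
      · exact fun h4 => D.vert C.adj_ab h2 h3 (hMleft h4)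
    · by_cases h3 : v = C.a
      · rwa [h3]
      · exact fun h4 => D.vert C.adj_ab h3 h2 (hMright h4)
    · by_cases h3 : v = C.a
      · have := hray 0 le_rfl
        rw [zero_smul, add_zero] at this
        rwa [h3]
      · exact hvert v h3 h2
  · rintro _ _ _ _ ⟨u, w, rfl, rfl, h, -⟩ ⟨u', w', rfl, rfl, h', -⟩ h1 h2 h3 h4
    rw [C.vert_injective.ne_iff] at h1 h2 h3 h4
    simp only [hposv]
    exact D.edge h h' h1 h2 h3 h4
  · rintro _ _ _ _ ⟨u, w, rfl, rfl, h, hne⟩ ⟨rfl, h'⟩ - h2 - h4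
    rw [hposm, hposv, hposv]
    have hx : ∀ w, G'.Adj C.a w → s(C.a, w) ≠ s(C.a, C.b) → w ≠ C.s →
        Disjoint (segment ℝ (pos' C.a) (pos' w)) (segment ℝ M (pos' C.s)) := by
      intro w h hne hw
      rcases (hN w).mp h with rfl | rfl | rfl
      · exact absurd rfl hne
      · exact absurd rfl hw
      · rw [Set.disjoint_left, segment_eq_image']
        rintro _ ⟨t, ht, rfl⟩
        exact hray t ht.1
    rcases h' with rfl | rfl | rfl <;> rw [hposv] <;> rw [C.vert_injective.ne_iff] at h2 h4
    · rw [Set.disjoint_left]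
      intro y h5 h6
      obtain ⟨v, h7, h8, rfl⟩ := D.inter h C.adj_ab hne h5 (hMleft h6)
      rcases h8 with rfl | rfl
      · rcases h7 with h7 | h7
        · exact h2 h7.symm
        · exact h4 h7.symm
      · exact hb h6
    · rw [Set.disjoint_left]
      intro y h5 h6
      obtain ⟨v, h7, h8, rfl⟩ := D.inter h C.adj_ab hne h5 (hMright h6)
      rcases h8 with rfl | rfl
      · exact ha h6
      · rcases h7 with h7 | h7
        · exact h2 h7.symm
        · exact h4 h7.symm
    · by_cases h5 : u = C.a
      · subst h5
        exact hx w h hne h4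
      by_cases h6 : w = C.a
      · subst h6
        rw [segment_symm]
        exact hx u h.symm (by rwa [Sym2.eq_swap]) h2
      · exact hedge u w h h5 h2 h6 h4
  · rintro _ _ _ _ ⟨rfl, -⟩ ⟨rfl, -⟩ h
    exact absurd rfl h

/-- The new edge to `s` must not cross the third edge at `a`. If the cone condition fails for `x`,
it holds with `b` and `x` interchanged. Then `slide` applies: `m` takes the place of `a`, and the
old `a` moves onto the edge towards `x`. -/
theorem exists_straightDrawing [Finite V'] (D : StraightDrawing G' pos') {x : V'}
    (hN : ∀ w, G'.Adj C.a w ↔ w = C.b ∨ w = C.s ∨ w = x) (hxb : x ≠ C.b) (hxs : x ≠ C.s) :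
    ∃ pos : V → E, StraightDrawing G pos := by
  have has : G'.Adj C.a C.s := (hN _).mpr (.inr (.inl rfl))
  have hax : G'.Adj C.a x := (hN _).mpr (.inr (.inr rfl))
  -- If two edges at `a` had the same direction, the shorter one would end on the longer one.
  have hpar : ∀ {u w}, G'.Adj C.a u → G'.Adj C.a w → u ≠ w → ∀ k : ℝ, 0 ≤ k →
      pos' u - pos' C.a ≠ k • (pos' w - pos' C.a) := by
    intro u w hu hw huw k hk h
    rcases le_total k 1 with hk1 | hk1
    · refine D.vert hw hu.ne' huw ?_
      rw [segment_eq_image']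
      exact ⟨k, ⟨hk, hk1⟩, show pos' C.a + k • (pos' w - pos' C.a) = _ by rw [← h]; abel⟩
    · refine D.vert hu hw.ne' huw.symm ?_
      rw [segment_eq_image']
      refine ⟨k⁻¹, ⟨by positivity, inv_le_one_of_one_le₀ hk1⟩, ?_⟩
      show pos' C.a + k⁻¹ • (pos' u - pos' C.a) = _
      rw [h, smul_smul, inv_mul_cancel₀ (by linarith), one_smul]
      abel
  rcases not_mem_cone_or (sub_ne_zero.mpr (D.inj.ne has.ne')) (hpar C.adj_ab hax hxb.symm)
    (hpar hax C.adj_ab hxb) (hpar C.adj_ab has C.s_ne_b.symm) with h | h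
  · exact C.exists_straightDrawing_of_cone D hN h
  · refine (C.slide hN hxb hxs).exists_straightDrawing_of_cone D (x := C.b) ?_ h
    intro w
    show G'.Adj C.a w ↔ w = x ∨ w = C.s ∨ w = C.b
    rw [hN]
    tauto

end SubdividedChord

/-! ### Triangle reductions of straight-line drawings. -/

section Chords

variable {E : Type*} [NormedAddCommGroup E] [NormedSpace ℝ E]

/-- The distance from `o` increases along the ray towards `k`, so only `p` is as close as `p`. -/
theorem eq_left_of_mem_segment_of_dist_le {o k p y : E} {c : ℝ} (hc1 : c < 1) (hok : o ≠ k)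
    (hp : p = o + c • (k - o)) (hc0 : 0 ≤ c) (h : y ∈ segment ℝ p k)
    (hy : dist y o ≤ dist p o) : y = p := by
  rw [segment_eq_image'] at h
  obtain ⟨r, ⟨hr0, hr1⟩, rfl⟩ := h
  dsimp only at hy ⊢
  have h1 : p + r • (k - p) = o + (c + r * (1 - c)) • (k - o) := by
    rw [hp]
    module
  have h2 : 0 < ‖k - o‖ := norm_pos_iff.mpr (sub_ne_zero.mpr hok.symm)
  have h3 : 0 ≤ r * (1 - c) := mul_nonneg hr0 (by linarith)
  rw [h1, hp, dist_eq_norm, dist_eq_norm, add_sub_cancel_left, add_sub_cancel_left, norm_smul,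
    norm_smul, Real.norm_of_nonneg (by positivity), Real.norm_of_nonneg hc0] at hy
  have h4 : c + r * (1 - c) ≤ c := le_of_mul_le_mul_right hy h2
  have h5 : r = 0 := by nlinarith
  simp [h5]

/-- By strict convexity the inner points of a chord lie in the open ball. -/
theorem notMem_segment_of_dist_eq [StrictConvexSpace ℝ E] {o p q y : E} {ε : ℝ}
    (hp : dist p o = ε) (hq : dist q o = ε) (hy : dist y o = ε) (hyp : y ≠ p) (hyq : y ≠ q) :
    y ∉ segment ℝ p q := by
  intro h
  by_cases hpq : p = q
  · rw [hpq, segment_same] at h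
    exact hyq h
  · have h1 := openSegment_subset_ball_of_ne (Metric.mem_closedBall.mpr hp.le)
      (Metric.mem_closedBall.mpr hq.le) hpq (mem_openSegment_of_ne_left_right hyp.symm hyq.symm h)
    exact (Metric.mem_ball.mp h1).ne hy

end Chords

namespace TriangleExpansion

variable {V X : Type u} {G : SimpleGraph V} {G' : SimpleGraph (Option X)}
  (T : TriangleExpansion G G') {E : Type*} [NormedAddCommGroup E] [NormedSpace ℝ E]
  {pos' : Option X → E}

theorem eq_out_or (z : V) :
    (∃ x, z = T.emb x) ∨ ∃ k, G'.Adj none (some k) ∧ z = T.out k none := by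
  rcases T.eq_or z with rfl | rfl | rfl | ⟨x, rfl⟩
  · exact .inr ⟨T.a, T.adj_none.mpr (by simp), by simp⟩
  · exact .inr ⟨T.b, T.adj_none.mpr (by simp), by simp⟩
  · exact .inr ⟨T.c, T.adj_none.mpr (by simp), by simp⟩
  · exact .inl ⟨x, rfl⟩

theorem out_none_ne (k x : X) : T.out k none ≠ T.emb x := fun h => by
  simpa using T.out_injective (x := k) (o := none) (o' := some x) h

theorem out_none_injective {k l : X} (hk : G'.Adj none (some k)) (hl : G'.Adj none (some l))
    (h : T.out k none = T.out l none) : k = l := by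
  have h1 := T.adj_pq.ne
  have h2 := T.adj_qr.ne
  have h3 := T.adj_rp.ne
  rcases T.adj_none.mp hk with rfl | rfl | rfl <;> rcases T.adj_none.mp hl with rfl | rfl | rfl <;>
    simp only [out_a, out_b, out_c] at h <;> first | rfl | simp_all

/-- The circle on which the triangle will be inscribed must keep clear of everything that does not
meet the vertex `none`. The obstacles are finitely many closed sets. -/
theorem _root_.StraightDrawing.exists_radius [Finite X] (D : StraightDrawing G' pos') :
    ∃ ε : ℝ, 0 < ε ∧
    (∀ x, ε < dist (pos' (some x)) (pos' none)) ∧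
    ∀ x y, G'.Adj (some x) (some y) → ∀ z ∈ segment ℝ (pos' (some x)) (pos' (some y)),
      ε < dist z (pos' none) := by
  have h1 : ∀ᶠ ε in nhdsWithin (0 : ℝ) (Set.Ioi 0), ∀ x, ε < dist (pos' (some x)) (pos' none) := by
    rw [Filter.eventually_all]
    intro x
    exact nhdsWithin_le_nhds (Iio_mem_nhds (dist_pos.mpr (D.inj.ne (by simp))))
  have h2 : ∀ᶠ ε in nhdsWithin (0 : ℝ) (Set.Ioi 0), ∀ w : X × X, G'.Adj (some w.1) (some w.2) →
      ∀ z ∈ segment ℝ (pos' (some w.1)) (pos' (some w.2)), ε < dist z (pos' none) := by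
    rw [Filter.eventually_all]
    rintro ⟨x, y⟩
    by_cases h : G'.Adj (some x) (some y)
    · have hK : IsClosed (segment ℝ (pos' (some x)) (pos' (some y))) := by
        rw [segment_eq_image']
        exact (isCompact_Icc.image (by fun_prop)).isClosed
      obtain ⟨δ, hδ, hball⟩ := Metric.isOpen_iff.mp hK.isOpen_compl (pos' none)
        (D.vert h (by simp) (by simp))
      filter_upwards [nhdsWithin_le_nhds (Iio_mem_nhds hδ)] with ε hε _ z hz
      by_contra hz'
      exact hball (Metric.mem_ball.mpr ((not_lt.mp hz').trans_lt hε)) hz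
    · exact .of_forall fun _ h' => absurd h' h
  have h3 : ∀ᶠ ε in nhdsWithin (0 : ℝ) (Set.Ioi 0), 0 < ε := self_mem_nhdsWithin
  obtain ⟨ε, h0, h1, h2⟩ := (h3.and (h1.and h2)).exists
  exact ⟨ε, h0, h1, fun x y => h2 (x, y)⟩

/-- In a straight-line drawing, the vertex `none` may be replaced with a small triangle. -/
theorem exists_straightDrawing [Finite X] [StrictConvexSpace ℝ E] (T : TriangleExpansion G G')
    (D : StraightDrawing G' pos') :
    ∃ pos : V → E, StraightDrawing G pos := by
  classical
  obtain ⟨ε, hε, hfar, hfar'⟩ := D.exists_radius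
  set O := pos' none with hO
  -- Scaled so that `P k`, the new corner on the edge to `k`, has distance `ε` from the old vertex
  -- `O`.
  let c : X → ℝ := fun k => ε / dist (pos' (some k)) O
  let P : X → E := fun k => O + c k • (pos' (some k) - O)
  have hpos : ∀ k, 0 < dist (pos' (some k)) O := fun k => hε.trans (hfar k)
  have hc0 : ∀ k, 0 < c k := fun k => div_pos hε (hpos k)
  have hc1 : ∀ k, c k < 1 := fun k => (div_lt_one (hpos k)).mpr (hfar k)
  have hPdist : ∀ k, dist (P k) O = ε := by
    intro k
    rw [dist_eq_norm, add_sub_cancel_left, norm_smul, Real.norm_of_nonneg (hc0 k).le,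
      ← dist_eq_norm]
    exact div_mul_cancel₀ _ (hpos k).ne'
  have hPmem : ∀ k, P k ∈ segment ℝ O (pos' (some k)) := by
    intro k
    rw [segment_eq_image']
    exact ⟨c k, ⟨(hc0 k).le, (hc1 k).le⟩, rfl⟩
  have hPO : ∀ k, P k ≠ O := fun k h => by
    have := hPdist k
    rw [h, dist_self] at this
    exact hε.ne this
  have hout : ∀ k, segment ℝ (P k) (pos' (some k)) ⊆ segment ℝ O (pos' (some k)) := fun k =>
    segment_subset_segment_right (hPmem k)
  have hmeet : ∀ {k l y}, G'.Adj none (some k) → G'.Adj none (some l) → k ≠ l →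
      y ∈ segment ℝ O (pos' (some k)) → y ∈ segment ℝ O (pos' (some l)) → y = O :=
    fun hk hl hkl => D.eq_of_mem_of_mem hk hl (by simpa using hkl)
  have hPne : ∀ {k l}, G'.Adj none (some k) → G'.Adj none (some l) → k ≠ l → P k ≠ P l :=
    fun {k l} hk hl hkl h => hPO k (hmeet hk hl hkl (hPmem k) (h ▸ hPmem l))
  have hnear : ∀ {k l y}, y ∈ segment ℝ (P k) (P l) → dist y O ≤ ε := fun {k l} _ h =>
    (convex_closedBall O ε).segment_subset (Metric.mem_closedBall.mpr (hPdist k).le)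
      (Metric.mem_closedBall.mpr (hPdist l).le) h
  -- What remains of an edge at `O` meets the closed disc only in its corner, whereas the triangle
  -- lies inside the disc.
  have hfirst : ∀ {k y}, y ∈ segment ℝ (P k) (pos' (some k)) → dist y O ≤ ε → y = P k :=
    fun {k _} h h' => eq_left_of_mem_segment_of_dist_le (hc1 k)
      (fun h => (hpos k).ne' (by rw [← h, dist_self])) rfl (hc0 k).le h
      (h'.trans_eq (hPdist k).symm)
  let pos : V → E := fun z => if h : ∃ x, z = T.emb x then pos' (some h.choose) else
    if h : ∃ k, G'.Adj none (some k) ∧ z = T.out k none then P h.choose else 0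
  have hemb : ∀ x, pos (T.emb x) = pos' (some x) := by
    intro x
    have h : ∃ y, T.emb x = T.emb y := ⟨x, rfl⟩
    show dite _ _ _ = _
    rw [dif_pos h, ← T.emb_injective h.choose_spec]
  have hcor : ∀ {k}, G'.Adj none (some k) → pos (T.out k none) = P k := by
    intro k hk
    have h : ∃ l, G'.Adj none (some l) ∧ T.out k none = T.out l none := ⟨k, hk, rfl⟩
    show dite _ _ _ = _
    rw [dif_neg fun ⟨x, h⟩ => T.out_none_ne k x h, dif_pos h,
      ← T.out_none_injective hk h.choose_spec.1 h.choose_spec.2]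
  refine ⟨pos, .of_cover
    (P := fun z t => ∃ x y, G'.Adj (some x) (some y) ∧ z = T.emb x ∧ t = T.emb y)
    (N := fun z t => (∃ k, G'.Adj none (some k) ∧ z = T.out k none ∧ t = T.emb k) ∨
      ∃ k l, G'.Adj none (some k) ∧ G'.Adj none (some l) ∧ k ≠ l ∧ z = T.out k none ∧
        t = T.out l none) ?_ ?_ ?_ ?_ ?_ ?_ ?_⟩
  · intro z t h
    rcases T.eq_out_or z with ⟨x, rfl⟩ | ⟨k, hk, rfl⟩
    · obtain ⟨_ | y, h', rfl⟩ := T.exists_out h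
      · exact .inr (.inr (.inl ⟨x, h'.symm, rfl, rfl⟩))
      · exact .inl ⟨x, y, h', rfl, rfl⟩
    rcases T.eq_out_or t with ⟨y, rfl⟩ | ⟨l, hl, rfl⟩
    · obtain ⟨_ | w, h', h''⟩ := T.exists_out h.symm
      · rw [h'']
        exact .inr (.inl (.inl ⟨y, h'.symm, rfl, rfl⟩))
      · exact absurd h'' (T.out_none_ne k w)
    · exact .inr (.inl (.inr ⟨k, l, hk, hl, fun e => h.ne (by rw [e]), rfl, rfl⟩))
  · intro z t h
    rcases T.eq_out_or z with ⟨x, rfl⟩ | ⟨k, hk, rfl⟩ <;>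
      rcases T.eq_out_or t with ⟨y, rfl⟩ | ⟨l, hl, rfl⟩
    · rw [hemb, hemb] at h
      rw [Option.some_injective _ (D.inj h)]
    · rw [hemb, hcor hl] at h
      have := hfar x
      rw [h, hPdist] at this
      exact absurd this (lt_irrefl _)
    · rw [hemb, hcor hk] at h
      have := hfar y
      rw [← h, hPdist] at this
      exact absurd this (lt_irrefl _)
    · rw [hcor hk, hcor hl] at h
      by_contra hne
      exact hPne hk hl (fun e => hne (by rw [e])) h
  · rintro _ _ v ⟨x, y, h, rfl, rfl⟩ h1 h2
    rw [hemb, hemb]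
    rcases T.eq_out_or v with ⟨w, rfl⟩ | ⟨k, hk, rfl⟩
    · rw [T.emb_injective.ne_iff] at h1 h2
      rw [hemb]
      exact D.vert h (by simpa using h1) (by simpa using h2)
    · rw [hcor hk]
      exact fun h3 => (hfar' x y h _ h3).ne' (hPdist k)
  · rintro _ _ v (⟨k, hk, rfl, rfl⟩ | ⟨k, l, hk, hl, hkl, rfl, rfl⟩) h1 h2
    · rw [hemb, hcor hk]
      rcases T.eq_out_or v with ⟨w, rfl⟩ | ⟨j, hj, rfl⟩
      · rw [T.emb_injective.ne_iff] at h2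
        rw [hemb]
        exact fun h3 => D.vert hk (by simp) (by simpa using h2) (hout k h3)
      · rw [hcor hj]
        exact fun h3 => hPne hj hk (fun e => h1 (by rw [e])) (hfirst h3 (hPdist j).le)
    · rw [hcor hk, hcor hl]
      rcases T.eq_out_or v with ⟨w, rfl⟩ | ⟨j, hj, rfl⟩
      · rw [hemb]
        exact fun h3 => ((hfar w).trans_le (hnear h3)).false
      · rw [hcor hj]
        exact notMem_segment_of_dist_eq (hPdist k) (hPdist l) (hPdist j)
          (hPne hj hk fun e => h1 (by rw [e])) (hPne hj hl fun e => h2 (by rw [e]))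
  · rintro _ _ _ _ ⟨x, y, h, rfl, rfl⟩ ⟨x', y', h', rfl, rfl⟩ h1 h2 h3 h4
    rw [T.emb_injective.ne_iff] at h1 h2 h3 h4
    simp only [hemb]
    exact D.edge h h' (by simpa using h1) (by simpa using h2) (by simpa using h3)
      (by simpa using h4)
  · rintro _ _ _ _ ⟨x, y, h, rfl, rfl⟩ (⟨k, hk, rfl, rfl⟩ | ⟨k, l, hk, hl, hkl, rfl, rfl⟩)
      - h2 - h4
    · rw [T.emb_injective.ne_iff] at h2 h4
      rw [hemb, hemb, hemb, hcor hk]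
      exact (D.edge h hk (by simp) (by simpa using h2) (by simp) (by simpa using h4)).mono_right
        (hout k)
    · rw [hemb, hemb, hcor hk, hcor hl, Set.disjoint_left]
      exact fun z h5 h6 => ((hfar' x y h z h5).trans_le (hnear h6)).false
  · have hchord : ∀ {k l j}, G'.Adj none (some k) → G'.Adj none (some l) → G'.Adj none (some j) →
        j ≠ k → j ≠ l →
        Disjoint (segment ℝ (P j) (pos' (some j))) (segment ℝ (P k) (P l)) := by
      intro k l j hk hl hj hjk hjl
      rw [Set.disjoint_left]
      intro y h1 h2
      obtain rfl := hfirst h1 (hnear h2)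
      exact notMem_segment_of_dist_eq (hPdist k) (hPdist l) (hPdist j) (hPne hj hk hjk)
        (hPne hj hl hjl) h2
    rintro _ _ _ _ (⟨k, hk, rfl, rfl⟩ | ⟨k, l, hk, hl, hkl, rfl, rfl⟩)
      (⟨k', hk', rfl, rfl⟩ | ⟨k', l', hk', hl', hkl', rfl, rfl⟩) h1 h2 h3 h4
    · rw [hemb, hemb, hcor hk, hcor hk', Set.disjoint_left]
      intro y h5 h6
      have hne : k ≠ k' := fun e => h1 (by rw [e])
      obtain rfl := hmeet hk hk' hne (hout k h5) (hout k' h6)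
      exact left_notMem_segment (hPmem k) (hPO k) h5
    · rw [hemb, hcor hk, hcor hk', hcor hl']
      exact hchord hk' hl' hk (fun e => h1 (by rw [e])) (fun e => h2 (by rw [e]))
    · rw [hemb, hcor hk, hcor hk', hcor hl]
      exact (hchord hk hl hk' (fun e => h1 (by rw [e])) (fun e => h3 (by rw [e]))).symm
    · have e1 : k ≠ k' := fun e => h1 (by rw [e])
      have e2 : k ≠ l' := fun e => h2 (by rw [e])
      have e3 : l ≠ k' := fun e => h3 (by rw [e])
      have e4 : l ≠ l' := fun e => h4 (by rw [e])
      -- Two sides of a triangle always share a corner.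
      rcases T.adj_none.mp hk with rfl | rfl | rfl <;>
        rcases T.adj_none.mp hl with rfl | rfl | rfl <;>
          rcases T.adj_none.mp hk' with rfl | rfl | rfl <;>
            rcases T.adj_none.mp hl' with rfl | rfl | rfl <;> contradiction

end TriangleExpansion

/-! ### Induction for planarity, and the theorem. -/

theorem D3Reducible.exists_straightDrawing {V : Type u} {G : SimpleGraph V}
    (h : D3Reducible G) : Finite V →
      ∃ pos : V → EuclideanSpace ℝ (Fin 2), StraightDrawing G pos := by
  induction h with
  | base G e => exact fun _ => exists_straightDrawing_of_iso e
  | triangle G p q r h _ ih =>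
    intro _
    obtain ⟨T⟩ := h.nonempty_triangleExpansion
    obtain ⟨pos', D⟩ := ih inferInstance
    exact T.exists_straightDrawing D
  | path G p q r h _ ih =>
    intro _
    obtain ⟨C, x, -, ha, hxb, hxs, -⟩ := h.exists_subdividedChord
    obtain ⟨pos', D⟩ := ih inferInstance
    exact C.exists_straightDrawing D ha hxb hxs

theorem mainTheorem7 {V : Type u} [Finite V] (G : SimpleGraph V) (hG : D3Reducible G) :
    PlanarGraph G ∧
    (∃ R : RotationSystem G, R.IsPlanar) ∧
    (∀ R S : RotationSystem G, R.IsPlanar → S.IsPlanar → S = R ∨ S = R.mirror) ∧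
    (∀ R : RotationSystem G, R.IsPlanar →
      ∀ (a b c : V) (hab : G.Adj a b) (hbc : G.Adj b c) (hca : G.Adj c a),
        R.TriangleIsFace hab hbc hca) := by
  obtain ⟨pos, D⟩ := hG.exists_straightDrawing ‹_›
  have h := hG.uniquelyEmbedded ‹_›
  exact ⟨D.planarGraph, h.exists_planar, h.unique, fun R hR a b c hab hbc hca =>
    (R.triangleIsFace_iff hab hbc hca).mpr (h.turnFace R hR a b c hab hbc hca)⟩
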